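/- Let $0<r<\infty$ and let $f\in C^2[0,r)$ satisfy $f(u)>0$ for $0\le u<r$, $f'(u)>0$ and $f''(u)>0$ for $0<u<r$, and $0<\liminf_{u\to r^-}(r-u)f(u)\le\infty$. For $\lambda>0$ consider $$u''''(x)=\lambda f(u(x)),\quad x\in(0,1),\qquad u(0)=u(1)=u'(0)=u'(1)=0, \tag{1}$$ and call $u\in C^4[0,1]$ with values in $[0,r)$ a positive solution if it satisfies (1) and $u\not\equiv 0$ (so $u\ge 0$). Then all positive solutions lie on one smooth curve. More precisely, there is a $C^2$ curve $[0,r)\to\mathbb R\times C^4[0,1]$, $p\mapsto(\lambda(p),u_p)$, with $(\lambda(0),u_0)=(0,0)$ and $u_p(\tfrac12)=p$ for all $p$, such that $$\{(\lambda,u):\lambda>0,\ u\text{ is a positive solution of (1)}\}=\{(\lambda(p),u_p):0<p<r\};$$ in particular $u(\tfrac12)$ is strictly monotone along the curve. There is $p_0\in(0,r)$ such that $\lambda(\cdot)$ is strictly increasing on $[0,p_0]$ and strictly decreasing on $[p_0,r)$, that is, the curve turns exactly once, at $\lambda_0:=\lambda(p_0)$. Problem (1) has exactly two positive solutions for $0<\lambda<\lambda_0$,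 exactly one for $\lambda=\lambda_0$ and none for $\lambda>\lambda_0$. Every positive solution is symmetric about $x=\tfrac12$ and attains its maximum at $x=\tfrac12$. Along the upper branch $p\to r^-$ one has $\lambda(p)\to0$ and $u_p\to w$ in $C^{2+\alpha}[0,1]$ for every $\alpha\in(0,1)$, where $$w(x)=\begin{cases}-16rx^3+12rx^2,&0\le x\le\frac12,\\-16r(1-x)^3+12r(1-x)^2,&\frac12\le x\le1.\end{cases}$$ The function $w$ is symmetric about $x=\frac12$, has the maximum value $w(\frac12)=r$, and belongs to $\bigl(C^{2+\alpha}[0,1]\setminus C^3[0,1]\bigr)\cap C^4\bigl([0,1]\setminus\{\tfrac12\}\bigr)$ for every $\alpha\in(0,1)$. -/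

import Mathlib

/-- The space `C^k[0,1]` of real functions, realised as the closed subspace of `C([0,1])^(k+1)`
that consists of the tuples `(u, u', …, u^(k))` (derivatives relative to `[0,1]`, so one-sided at
the endpoints). Such a tuple is determined by its first entry. The norm inherited from the product
is `max_{j ≤ k} sup |u^(j)|`, so a curve in this space is `C^n` exactly when it is `C^n` for the
usual `C^k[0,1]` norm. -/
def ckSubmodule (k : ℕ) : Submodule ℝ (Fin (k + 1) → C(unitInterval, ℝ)) where
  carrier := {g | ∀ (i : Fin k) (x : unitInterval),
    HasDerivWithinAt (Set.IccExtend zero_le_one (g i.castSucc)) (g i.succ x)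
      (Set.Icc (0 : ℝ) 1) (x : ℝ)}
  add_mem' := by
    intro a b ha hb i x
    exact (ha i x).add (hb i x)
  zero_mem' := by
    intro i x
    exact hasDerivWithinAt_const _ _ (0 : ℝ)
  smul_mem' := by
    intro c a ha i x
    exact (ha i x).const_smul c

/-- The normed space `C^k[0,1]`. -/
abbrev CkFun (k : ℕ) : Type := ckSubmodule k

/-- The `j`-th derivative of `u ∈ C^k[0,1]`, for `0 ≤ j ≤ k`; `u.der 0` is the function itself. -/
def CkFun.der {k : ℕ} (u : CkFun k) (j : Fin (k + 1)) : C(unitInterval, ℝ) := u.1 j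

/-- The inclusion `C^k[0,1] ⊆ C^m[0,1]` for `m ≤ k`. -/
def CkFun.incl {k m : ℕ} (h : m ≤ k) (u : CkFun k) : CkFun m :=
  ⟨fun j => u.der (Fin.castLE (Nat.succ_le_succ h) j), fun i x => u.2 (Fin.castLE h i) x⟩

/-- The midpoint `1/2` of `[0,1]`. -/
noncomputable def midpt : unitInterval := ⟨1 / 2, by norm_num, by norm_num⟩

/-- The norm of `C^{2+α}[0,1]`, with value `∞` on the functions of `C^2[0,1]` whose second
derivative is not Hölder continuous with exponent `α`. -/
noncomputable def holderNorm (α : NNReal) (v : CkFun 2) : ENNReal :=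
  ‖v‖ₑ + eHolderNorm α (v.der 2)

/-- `u ∈ C^4[0,1]` is a positive solution of `u'''' = lam * f u` on `(0,1)`,
`u(0) = u(1) = u'(0) = u'(1) = 0`, where `f` is a function on `[0,r)`
(so that the values of `u` have to lie there). -/
structure IsPositiveSolution (f : ℝ → ℝ) (r lam : ℝ) (u : CkFun 4) : Prop where
  nonneg : ∀ x : unitInterval, 0 ≤ u.der 0 x
  lt : ∀ x : unitInterval, u.der 0 x < r
  nontrivial : ∃ x : unitInterval, u.der 0 x ≠ 0
  eqn : ∀ x : unitInterval, 0 < x → x < 1 → u.der 4 x = lam * f (u.der 0 x)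
  left : u.der 0 0 = 0
  right : u.der 0 1 = 0
  left' : u.der 1 0 = 0
  right' : u.der 1 1 = 0

/-- The set `S` of all pairs `(lam, u)` with `lam > 0` and `u` a positive solution for `lam`. -/
def solutionSet (f : ℝ → ℝ) (r : ℝ) : Set (ℝ × CkFun 4) :=
  {q | 0 < q.1 ∧ IsPositiveSolution f r q.1 q.2}

/-- The function `-16 r x^3 + 12 r x^2` on `[0,1/2]`, reflected about `x = 1/2`. -/
noncomputable def limitProfile (r : ℝ) (x : ℝ) : ℝ :=
  if x ≤ 1 / 2 then -16 * r * x ^ 3 + 12 * r * x ^ 2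
  else -16 * r * (1 - x) ^ 3 + 12 * r * (1 - x) ^ 2

/-!
Cut at its maximum `p`, a positive solution falls into two profiles: up to scaling, solutions of
`v'''' = f v` with `v = p`, `v' = 0` at the start and `v = v' = 0` at the end. Comparison shows that
two profiles with opposite third derivatives at the start coincide. So every solution is symmetric
about `1/2`, and likewise `p` determines both the solution and `lam`.

For fixed `lam`, solutions are ordered by their maxima, which follows by touching `w - v` with
multiples of `v'`. There cannot be three solutions `v < w < x`: since `f` is convex, the bilinear
concomitant of `w - v` and `x - w` would be decreasing, strictly near the maximum, although it
vanishes at both ends.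

For the existence of a solution with given `p < r`, the parameter is eliminated from
`u = lam G(f(u))` by evaluation at the midpoint. A kernel element of the linearization solves
`z'''' = f'(v) z - η f(v)`. The dilations of `v` provide a particular solution, and the homogeneous
equation has only the trivial solution with the resulting boundary values, so `z = 0`. The implicit
function theorem and compactness then give the `C^2` curve.

As `p → r`, the third derivatives stay bounded while `f` blows up at least like `1 / (r - u)`, so
`lam` is at most a multiple of `√(r - p)`. Being zero at both ends of `[0, r)` and taking no value
three times, `lam` increases and then decreases. Away from the midpoint the fourth derivatives tend
to `0`, so the second derivatives converge uniformly to that of a clamped cubic. By interpolation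
with their uniform Lipschitz bound, the convergence takes place in `C^{2 + α}` for every `α < 1`.
-/

open Set Filter Topology

section IntervalCalculus

variable {a b : ℝ} {g g' : ℝ → ℝ}

lemma monotoneOn_of_hasDerivWithinAt_Icc
    (hg : ∀ t ∈ Icc a b, HasDerivWithinAt g (g' t) (Icc a b) t)
    (hg' : ∀ t ∈ Icc a b, 0 ≤ g' t) : MonotoneOn g (Icc a b) :=
  monotoneOn_of_hasDerivWithinAt_nonneg (convex_Icc a b)
    (fun t ht => (hg t ht).continuousWithinAt)
    (fun t ht => (hg t (interior_subset ht)).mono interior_subset)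
    (fun t ht => hg' t (interior_subset ht))

lemma antitoneOn_of_hasDerivWithinAt_Icc
    (hg : ∀ t ∈ Icc a b, HasDerivWithinAt g (g' t) (Icc a b) t)
    (hg' : ∀ t ∈ Icc a b, g' t ≤ 0) : AntitoneOn g (Icc a b) :=
  antitoneOn_of_hasDerivWithinAt_nonpos (convex_Icc a b)
    (fun t ht => (hg t ht).continuousWithinAt)
    (fun t ht => (hg t (interior_subset ht)).mono interior_subset)
    (fun t ht => hg' t (interior_subset ht))

lemma deriv_eq_zero_of_const_Icc {c : ℝ} (hab : a < b)
    (hg : ∀ t ∈ Icc a b, HasDerivWithinAt g (g' t) (Icc a b) t)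
    (hc : ∀ t ∈ Icc a b, g t = c) : ∀ t ∈ Icc a b, g' t = 0 := fun t ht =>
  (uniqueDiffOn_Icc hab t ht).eq_deriv _ (hg t ht)
    ((hasDerivWithinAt_const t (Icc a b) c).congr hc (hc t ht))

lemma eqOn_of_hasDerivWithinAt_Icc {k : ℝ → ℝ}
    (hg : ∀ t ∈ Icc a b, HasDerivWithinAt g (g' t) (Icc a b) t)
    (hk : ∀ t ∈ Icc a b, HasDerivWithinAt k (g' t) (Icc a b) t) (hgk : g a = k a) :
    ∀ t ∈ Icc a b, g t = k t :=
  eq_of_has_deriv_right_eq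
    (fun t ht => (hg t (Ico_subset_Icc_self ht)).mono_of_mem_nhdsWithin (Icc_mem_nhdsGE_of_mem ht))
    (fun t ht => (hk t (Ico_subset_Icc_self ht)).mono_of_mem_nhdsWithin (Icc_mem_nhdsGE_of_mem ht))
    (fun t ht => (hg t ht).continuousWithinAt) (fun t ht => (hk t ht).continuousWithinAt) hgk

lemma convexOn_of_hasDerivWithinAt_Icc {g'' : ℝ → ℝ}
    (hg : ∀ t ∈ Icc a b, HasDerivWithinAt g (g' t) (Icc a b) t)
    (hg' : ∀ t ∈ Icc a b, HasDerivWithinAt g' (g'' t) (Icc a b) t)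
    (hg'' : ∀ t ∈ Icc a b, 0 ≤ g'' t) : ConvexOn ℝ (Icc a b) g :=
  convexOn_of_hasDerivWithinAt2_nonneg (convex_Icc a b)
    (fun t ht => (hg t ht).continuousWithinAt)
    (fun t ht => (hg t (interior_subset ht)).mono interior_subset)
    (fun t ht => (hg' t (interior_subset ht)).mono interior_subset)
    (fun t ht => hg'' t (interior_subset ht))

lemma nonpos_of_convexOn_Icc (hconv : ConvexOn ℝ (Icc a b) g) (ha : g a ≤ 0) (hb : g b ≤ 0) {t : ℝ}
    (ht : t ∈ Icc a b) : g t ≤ 0 :=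
  have hab := ht.1.trans ht.2
  (hconv.le_max_of_mem_Icc (left_mem_Icc.2 hab) (right_mem_Icc.2 hab) ht).trans (max_le ha hb)

lemma le_neg_mul_min_of_convexOn_Icc {c ξ : ℝ} (hconv : ConvexOn ℝ (Icc a b) g) (ha : g a ≤ 0)
    (hb : g b ≤ 0) (hξ : ξ ∈ Ioo a b) (hc : 0 ≤ c) (hgξ : g ξ ≤ -c) {t : ℝ} (ht : t ∈ Icc a b) :
    g t ≤ -(c / (b - a) * min (t - a) (b - t)) := by
  have hab : 0 < b - a := sub_pos.2 (hξ.1.trans hξ.2)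
  have hgt : g t ≤ 0 := nonpos_of_convexOn_Icc hconv ha hb ht
  suffices h : g t * (b - a) ≤ -(c * (t - a)) ∨ g t * (b - a) ≤ -(c * (b - t)) by
    rw [div_mul_eq_mul_div, ← neg_div, le_div_iff₀ hab]
    rcases h with h | h
    · linarith [mul_le_mul_of_nonneg_left (min_le_left (t - a) (b - t)) hc]
    · linarith [mul_le_mul_of_nonneg_left (min_le_right (t - a) (b - t)) hc]
  have chord : ∀ x ∈ Icc a b, ∀ z ∈ Icc a b, x < t → t < z →
      g t * (z - x) ≤ g x * (z - t) + g z * (t - x) := fun x hx z hz hxt htz => by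
    have := hconv.slope_mono_adjacent hx hz hxt htz
    rw [div_le_div_iff₀ (sub_pos.2 hxt) (sub_pos.2 htz)] at this
    linarith
  have haI : a ∈ Icc a b := left_mem_Icc.2 (hξ.1.trans hξ.2).le
  have hbI : b ∈ Icc a b := right_mem_Icc.2 (hξ.1.trans hξ.2).le
  rcases lt_trichotomy t ξ with hlt | rfl | hlt
  · left
    rcases ht.1.eq_or_lt with rfl | hat
    · simpa using mul_nonpos_of_nonpos_of_nonneg hgt hab.le
    · have := chord a haI ξ (Ioo_subset_Icc_self hξ) hat hlt
      nlinarith [hξ.2]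
  · left
    nlinarith [hξ.2]
  · right
    rcases ht.2.eq_or_lt with rfl | htb
    · simpa using mul_nonpos_of_nonpos_of_nonneg hgt hab.le
    · have := chord ξ (Ioo_subset_Icc_self hξ) b hbI hlt htb
      nlinarith [hξ.1]

lemma mul_exp_le_of_mul_exp_le_deriv {K c : ℝ} (hK : 0 < K) (hc : c ≤ 0)
    (hg : ∀ t ∈ Icc 0 b, HasDerivWithinAt g (g' t) (Icc 0 b) t) (h0 : 0 ≤ g 0)
    (hg' : ∀ t ∈ Icc 0 b, c * Real.exp (K * t) ≤ g' t) :
    ∀ t ∈ Icc 0 b, c / K * Real.exp (K * t) ≤ g t := by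
  intro t ht
  have hdiff : ∀ t ∈ Icc 0 b, HasDerivWithinAt (fun t => g t - c / K * Real.exp (K * t))
      (g' t - c * Real.exp (K * t)) (Icc 0 b) t := by
    intro t ht
    have hexp : HasDerivAt (fun t : ℝ => Real.exp (K * t)) (Real.exp (K * t) * K) t := by
      simpa using ((hasDerivAt_id t).const_mul K).exp
    rw [show c * Real.exp (K * t) = c / K * (Real.exp (K * t) * K) by field_simp]
    exact (hg t ht).sub ((hexp.const_mul (c / K)).hasDerivWithinAt)
  have hmono := monotoneOn_of_hasDerivWithinAt_Icc hdiff (fun t ht => sub_nonneg.2 (hg' t ht))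
    (left_mem_Icc.2 (ht.1.trans ht.2)) ht ht.1
  have hcK : c / K ≤ 0 := div_nonpos_of_nonpos_of_nonneg hc hK.le
  simp only [mul_zero, Real.exp_zero, mul_one] at hmono
  linarith

lemma eventually_pos_of_hasDerivWithinAt_neg {c : ℝ} (hg : HasDerivWithinAt g c (Iio b) b)
    (hb : g b = 0) (hc : c < 0) : ∀ᶠ t in 𝓝[<] b, 0 < g t := by
  rw [hasDerivWithinAt_iff_tendsto_slope' self_notMem_Iio] at hg
  filter_upwards [hg.eventually_lt_const hc, self_mem_nhdsWithin] with t hslope htb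
  rwa [slope_def_field, hb, sub_zero, div_lt_iff_of_neg (sub_neg.2 htb), zero_mul] at hslope

lemma exists_touching {d q : ℝ → ℝ} (hd : ContinuousOn d (Ioo a b)) (hq : ContinuousOn q (Ioo a b))
    (hqpos : ∀ t ∈ Ioo a b, 0 < q t) (hneg : ∃ s ∈ Ioo a b, d s < 0)
    (ha : ∀ κ > 0, ∀ᶠ t in 𝓝[>] a, 0 < d t + κ * q t)
    (hb : ∀ κ > 0, ∀ᶠ t in 𝓝[<] b, 0 < d t + κ * q t) :
    ∃ k > 0, ∃ m ∈ Ioo a b, d m + k * q m = 0 ∧ ∀ t ∈ Ioo a b, 0 ≤ d t + k * q t := by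
  obtain ⟨s, hs, hsneg⟩ := hneg
  set κ := -(d s / q s)
  have hκ : 0 < κ := neg_pos.2 (div_neg_of_neg_of_pos hsneg (hqpos s hs))
  obtain ⟨l, hl, hal⟩ := (mem_nhdsGT_iff_exists_mem_Ioc_Ioo_subset hs.1).1 (ha κ hκ)
  obtain ⟨u, hu, hub⟩ := (mem_nhdsLT_iff_exists_mem_Ico_Ioo_subset hs.2).1 (hb κ hκ)
  have hsub : Icc l u ⊆ Ioo a b := fun t ht => ⟨hl.1.trans_le ht.1, ht.2.trans_lt hu.2⟩
  obtain ⟨m, hm, hmin⟩ := isCompact_Icc.exists_isMinOn ⟨s, hl.2, hu.1⟩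
    ((hd.mono hsub).div (hq.mono hsub) fun t ht => (hqpos t (hsub ht)).ne')
  have hκm : κ ≤ -(d m / q m) := neg_le_neg (hmin ⟨hl.2, hu.1⟩)
  refine ⟨-(d m / q m), hκ.trans_le hκm, m, hsub hm, ?_, fun t ht => ?_⟩
  · rw [neg_mul, div_mul_cancel₀ _ (hqpos m (hsub hm)).ne', add_neg_cancel]
  have outside (h : 0 < d t + κ * q t) : 0 ≤ d t + -(d m / q m) * q t :=
    h.le.trans (by have := hqpos t ht; gcongr)
  by_cases htl : t < l
  · exact outside (hal ⟨ht.1, htl⟩)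
  by_cases hut : u < t
  · exact outside (hub ⟨hut, ht.2⟩)
  have : d m / q m * q t ≤ d t :=
    (le_div_iff₀ (hqpos t ht)).1 (hmin ⟨not_lt.1 htl, not_lt.1 hut⟩)
  linarith

end IntervalCalculus

/-- On `[a, b]`, each of `v 0, …, v n` is the derivative of its predecessor, one-sided at `a` and
`b`. Higher derivatives are carried along as data, which keeps them meaningful at the endpoints;
the functions `v i` with `i > n` are irrelevant. -/
def DerivChain (n : ℕ) (a b : ℝ) (v : ℕ → ℝ → ℝ) : Prop :=
  ∀ i < n, ∀ t ∈ Icc a b, HasDerivWithinAt (v i) (v (i + 1) t) (Icc a b) t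

namespace DerivChain

variable {n : ℕ} {a b : ℝ} {v w : ℕ → ℝ → ℝ}

lemma mono (h : DerivChain n a b v) {a' b' : ℝ} (ha : a ≤ a') (hb : b' ≤ b) :
    DerivChain n a' b' v := fun i hi t ht =>
  (h i hi t ⟨ha.trans ht.1, ht.2.trans hb⟩).mono (Icc_subset_Icc ha hb)

lemma sub (hv : DerivChain n a b v) (hw : DerivChain n a b w) :
    DerivChain n a b (fun i t => v i t - w i t) := fun i hi t ht =>
  (hv i hi t ht).sub (hw i hi t ht)

lemma add (hv : DerivChain n a b v) (hw : DerivChain n a b w) :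
    DerivChain n a b (fun i t => v i t + w i t) := fun i hi t ht =>
  (hv i hi t ht).add (hw i hi t ht)

lemma neg (h : DerivChain n a b v) : DerivChain n a b (fun i t => -v i t) := fun i hi t ht =>
  (h i hi t ht).neg

lemma const_mul (h : DerivChain n a b v) (c : ℝ) : DerivChain n a b (fun i t => c * v i t) :=
  fun i hi t ht => (h i hi t ht).const_mul c

lemma comp_affine (h : DerivChain n a b v) {a' b' x c : ℝ}
    (hmaps : ∀ t ∈ Icc a' b', x + c * t ∈ Icc a b) :
    DerivChain n a' b' (fun i t => c ^ i * v i (x + c * t)) := by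
  intro i hi t ht
  have haffine : HasDerivWithinAt (fun t => x + c * t) c (Icc a' b') t := by
    simpa using ((hasDerivWithinAt_id t (Icc a' b')).const_mul c).const_add x
  beta_reduce
  rw [show c ^ (i + 1) * v (i + 1) (x + c * t) = c ^ i * (v (i + 1) (x + c * t) * c) by ring]
  exact ((h i hi _ (hmaps t ht)).comp t haffine hmaps).const_mul (c ^ i)

lemma continuousOn (h : DerivChain n a b v) {i : ℕ} (hi : i < n) : ContinuousOn (v i) (Icc a b) :=
  fun t ht => (h i hi t ht).continuousWithinAt

lemma monotoneOn (h : DerivChain n a b v) {i : ℕ} (hi : i < n)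
    (h' : ∀ t ∈ Icc a b, 0 ≤ v (i + 1) t) : MonotoneOn (v i) (Icc a b) :=
  monotoneOn_of_hasDerivWithinAt_Icc (h i hi) h'

lemma antitoneOn (h : DerivChain n a b v) {i : ℕ} (hi : i < n)
    (h' : ∀ t ∈ Icc a b, v (i + 1) t ≤ 0) : AntitoneOn (v i) (Icc a b) :=
  antitoneOn_of_hasDerivWithinAt_Icc (h i hi) h'

lemma convexOn (h : DerivChain n a b v) {i : ℕ} (hi : i + 1 < n)
    (h' : ∀ t ∈ Icc a b, 0 ≤ v (i + 2) t) : ConvexOn ℝ (Icc a b) (v i) :=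
  convexOn_of_hasDerivWithinAt_Icc (h i (i.lt_succ_self.trans hi)) (h (i + 1) hi) h'

lemma left_le_of_deriv_nonneg (h : DerivChain n a b v) {i : ℕ} (hi : i < n)
    (h' : ∀ t ∈ Icc a b, 0 ≤ v (i + 1) t) {t : ℝ} (ht : t ∈ Icc a b) : v i a ≤ v i t :=
  h.monotoneOn hi h' (left_mem_Icc.2 (ht.1.trans ht.2)) ht ht.1

lemma deriv_eq_zero_of_const (h : DerivChain n a b v) (hab : a < b) {i : ℕ} (hi : i < n) {c : ℝ}
    (hc : ∀ t ∈ Icc a b, v i t = c) : ∀ t ∈ Icc a b, v (i + 1) t = 0 :=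
  deriv_eq_zero_of_const_Icc hab (h i hi) hc

lemma eq_zero_of_le (h : DerivChain n a b v) (hab : a < b) {i j : ℕ}
    (h0 : ∀ t ∈ Icc a b, v i t = 0) (hij : i ≤ j) (hj : j ≤ n) : ∀ t ∈ Icc a b, v j t = 0 := by
  induction j, hij using Nat.le_induction with
  | base => exact h0
  | succ j _ ih => exact h.deriv_eq_zero_of_const hab hj (ih (j.le_succ.trans hj))

lemma eq_of_eq_zero (hv : DerivChain n a b v) (hw : DerivChain n a b w) (hab : a < b)
    (h0 : ∀ t ∈ Icc a b, v 0 t = w 0 t) {i : ℕ} (hi : i ≤ n) : ∀ t ∈ Icc a b, v i t = w i t :=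
  fun t ht => sub_eq_zero.1 <|
    (hv.sub hw).eq_zero_of_le hab (fun t ht => sub_eq_zero.2 (h0 t ht)) i.zero_le hi t ht

lemma second_deriv_right_nonneg (h : DerivChain n a b v) (hn : 2 < n) (hab : a < b)
    (h0 : ∀ t ∈ Icc a b, 0 ≤ v 0 t) (hb : v 0 b = 0) (hb' : v 1 b = 0) : 0 ≤ v 2 b := by
  by_contra! hneg
  have hnhds : {t | v 2 t < 0} ∈ 𝓝[≤] b := by
    rw [← nhdsWithin_Icc_eq_nhdsLE hab]
    exact (h.continuousOn hn b (right_mem_Icc.2 hab.le)).eventually_lt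
      continuousWithinAt_const hneg
  obtain ⟨l, hl, hsub⟩ := (mem_nhdsLE_iff_exists_mem_Ico_Ioc_subset hab).1 hnhds
  obtain ⟨s, hls, hsb⟩ := exists_between hl.2
  have has : a ≤ s := hl.1.trans hls.le
  have hbI := right_mem_Icc.2 hsb.le
  have ch := h.mono has le_rfl
  have deriv_nonneg : ∀ t ∈ Icc s b, 0 ≤ v 1 t := fun t ht => by
    simpa [hb'] using ch.antitoneOn (i := 1) (by lia)
      (fun t ht => (hsub ⟨hls.trans_le ht.1, ht.2⟩).le) ht hbI ht.2
  have eq_zero : ∀ t ∈ Icc s b, v 0 t = 0 := fun t ht => le_antisymm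
    (by simpa [hb] using ch.monotoneOn (i := 0) (by lia) deriv_nonneg ht hbI ht.2)
    (h0 t ⟨has.trans ht.1, ht.2⟩)
  exact hneg.ne (ch.eq_zero_of_le hsb eq_zero (Nat.zero_le 2) hn.le b hbI)

lemma nonneg_of_init (h : DerivChain n a b v) {m : ℕ} (hn : ∀ t ∈ Icc a b, 0 ≤ v n t)
    (ha : ∀ i ∈ Ico m n, 0 ≤ v i a) {i : ℕ} (hi : i ∈ Icc m n) : ∀ t ∈ Icc a b, 0 ≤ v i t := by
  obtain ⟨hmi, hin⟩ := hi
  induction hin using Nat.decreasingInduction with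
  | self => exact hn
  | of_succ i hi ih =>
    exact fun t ht => (ha i ⟨hmi, hi⟩).trans
      (h.left_le_of_deriv_nonneg hi (ih (hmi.trans i.le_succ)) ht)

lemma lt_and_deriv_pos_of_init (h : DerivChain n a b v) (hab : a < b)
    (hn : ∀ t ∈ Icc a b, 0 ≤ v n t) (ha : ∀ i ∈ Ico 1 n, 0 ≤ v i a)
    (hne : ∃ i ∈ Ico 1 n, v i a ≠ 0) : v 0 a < v 0 b ∧ 0 < v 1 b := by
  obtain ⟨i, ⟨h1i, hin⟩, hi⟩ := hne
  have haI := left_mem_Icc.2 hab.le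
  have hbI := right_mem_Icc.2 hab.le
  have hnn : ∀ j ∈ Icc 1 n, ∀ t ∈ Icc a b, 0 ≤ v j t := fun j hj => h.nonneg_of_init hn ha hj
  have hv1 : ¬ ∀ t ∈ Icc a b, v 1 t = 0 := fun h0 => hi (h.eq_zero_of_le hab h0 h1i hin.le a haI)
  have mono0 := h.monotoneOn (i := 0) (by lia) (hnn 1 ⟨le_rfl, by lia⟩)
  have mono1 := h.monotoneOn (i := 1) (by lia) (hnn 2 ⟨by lia, by lia⟩)
  constructor
  · by_contra! hle
    exact hv1 <| h.deriv_eq_zero_of_const (c := v 0 a) hab (by lia) fun t ht =>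
      le_antisymm ((mono0 ht hbI ht.2).trans hle) (mono0 haI ht ht.1)
  · by_contra! hle
    exact hv1 fun t ht =>
      le_antisymm ((mono1 ht hbI ht.2).trans hle) (hnn 1 ⟨le_rfl, by lia⟩ t ht)

lemma div_pow_mul_exp_le {T K c : ℝ} (hK : 0 < K) (hc : c ≤ 0) (h : DerivChain n 0 T v)
    (h0 : ∀ i < n, 0 ≤ v i 0) (hn : ∀ t ∈ Icc 0 T, c * Real.exp (K * t) ≤ v n t) {j : ℕ}
    (hj : j ≤ n) : ∀ t ∈ Icc 0 T, c / K ^ j * Real.exp (K * t) ≤ v (n - j) t := by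
  induction j with
  | zero => simpa using hn
  | succ j ih =>
    rw [pow_succ, ← div_div]
    refine mul_exp_le_of_mul_exp_le_deriv hK (div_nonpos_of_nonpos_of_nonneg hc (by positivity))
      (h (n - (j + 1)) (by lia)) (h0 _ (by lia)) ?_
    rw [show n - (j + 1) + 1 = n - j by lia]
    exact ih (by lia)

/-- With `m` the minimum of `v 0 t * exp (-K t)`, integrating `n` times returns the bound
`v 0 ≥ m exp (K t)` improved by the factor `L / K ^ n < 1`, so `m` cannot be negative. -/
lemma nonneg_of_ivp {T L : ℝ} (hn : 0 < n) (hL : 0 ≤ L) (h : DerivChain n 0 T v)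
    (h0 : ∀ i < n, 0 ≤ v i 0) (hode : ∀ t ∈ Icc 0 T, L * min (v 0 t) 0 ≤ v n t) :
    ∀ t ∈ Icc 0 T, 0 ≤ v 0 t := by
  by_contra! ⟨s, hs, hsneg⟩
  set K := L + 1
  have hK : 0 < K := by positivity
  obtain ⟨t₁, ht₁, hmin⟩ := isCompact_Icc.exists_isMinOn ⟨s, hs⟩
    (f := fun t => v 0 t * Real.exp (-(K * t))) ((h.continuousOn hn).mul (by fun_prop))
  set m := v 0 t₁ * Real.exp (-(K * t₁)) with hm
  have hm0 : m < 0 := (hmin hs).trans_lt (mul_neg_of_neg_of_pos hsneg (Real.exp_pos _))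
  have hlow : ∀ t ∈ Icc 0 T, m * Real.exp (K * t) ≤ v 0 t := by
    intro t ht
    have := mul_le_mul_of_nonneg_right (hmin ht) (Real.exp_pos (K * t)).le
    rwa [mul_assoc (v 0 t), ← Real.exp_add, neg_add_cancel, Real.exp_zero, mul_one] at this
  have hLm : L * m ≤ 0 := mul_nonpos_of_nonneg_of_nonpos hL hm0.le
  have htop : ∀ t ∈ Icc 0 T, L * m * Real.exp (K * t) ≤ v n t := fun t ht => by
    refine le_trans ?_ (hode t ht)
    rw [mul_assoc]
    exact mul_le_mul_of_nonneg_left (le_min (hlow t ht)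
      (mul_nonpos_of_nonpos_of_nonneg hm0.le (Real.exp_pos _).le)) hL
  have hv : v 0 t₁ = m * Real.exp (K * t₁) := by
    rw [hm, mul_assoc, ← Real.exp_add, neg_add_cancel, Real.exp_zero, mul_one]
  have hle := h.div_pow_mul_exp_le hK hLm h0 htop le_rfl t₁ ht₁
  rw [Nat.sub_self, hv] at hle
  have hratio : L / K ^ n < 1 := by
    rw [div_lt_one (by positivity)]
    exact (lt_add_one L).trans_le (le_self_pow₀ (by simp [hL]) hn.ne')
  have := le_of_mul_le_mul_right hle (Real.exp_pos _)
  rw [mul_div_right_comm] at this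
  nlinarith

end DerivChain

/-- One side of a clamped solution of `v'''' = f v`, followed from its maximum `p` at `t = 0` to the
clamped end `t = T`. The two sides of the maximum are compared as profiles of possibly different
lengths. -/
structure IsProfile (f : ℝ → ℝ) (p T : ℝ) (v : ℕ → ℝ → ℝ) : Prop where
  T_pos : 0 < T
  p_pos : 0 < p
  chain : DerivChain 4 0 T v
  apply_zero : v 0 0 = p
  deriv_zero : v 1 0 = 0
  apply_end : v 0 T = 0
  deriv_end : v 1 T = 0
  nonneg : ∀ t ∈ Icc 0 T, 0 ≤ v 0 t
  le : ∀ t ∈ Icc 0 T, v 0 t ≤ p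
  eqn : ∀ t ∈ Icc 0 T, v 4 t = f (v 0 t)

namespace IsProfile

variable {f : ℝ → ℝ} {p T T₁ T₂ lam lam₁ lam₂ : ℝ} {K : NNReal} {v w : ℕ → ℝ → ℝ}

lemma mem_Icc (h : IsProfile f p T v) {t : ℝ} (ht : t ∈ Icc 0 T) : v 0 t ∈ Icc 0 p :=
  ⟨h.nonneg t ht, h.le t ht⟩

lemma fourth_deriv_pos (h : IsProfile f p T v) (hf : ∀ x ∈ Icc 0 p, 0 < f x) :
    ∀ t ∈ Icc 0 T, 0 < v 4 t := fun t ht => by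
  rw [h.eqn t ht]
  exact hf _ (h.mem_Icc ht)

lemma third_deriv_end_pos (h : IsProfile f p T v) (hf : ∀ x ∈ Icc 0 p, 0 < f x) : 0 < v 3 T := by
  have h0 := left_mem_Icc.2 h.T_pos.le
  have hT := right_mem_Icc.2 h.T_pos.le
  have mono3 := h.chain.monotoneOn (i := 3) (by simp) fun t ht => (h.fourth_deriv_pos hf t ht).le
  by_contra! hneg
  have hconv : ConvexOn ℝ (Icc 0 T) (fun t => -v 1 t) := h.chain.neg.convexOn (i := 1) (by simp)
    fun t ht => neg_nonneg.2 ((mono3 ht hT ht.2).trans hneg)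
  have deriv_nonneg : ∀ t ∈ Icc 0 T, -v 1 t ≤ 0 := fun t ht =>
    nonpos_of_convexOn_Icc hconv (by simp [h.deriv_zero]) (by simp [h.deriv_end]) ht
  have := h.chain.monotoneOn (i := 0) (by simp) (fun t ht => neg_nonpos.1 (deriv_nonneg t ht))
    h0 hT h.T_pos.le
  rw [h.apply_zero, h.apply_end] at this
  exact this.not_gt h.p_pos

lemma second_deriv_end_nonneg (h : IsProfile f p T v) : 0 ≤ v 2 T :=
  h.chain.second_deriv_right_nonneg (by simp) h.T_pos h.nonneg h.apply_end h.deriv_end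

lemma length_le_of_nonneg (h : IsProfile f p T v) (hf : ∀ x ∈ Icc 0 p, 0 < f x) {s : ℝ}
    (hs : 0 ≤ s) (h1 : 0 ≤ v 1 s) (h2 : 0 ≤ v 2 s) (h3 : 0 < v 3 s) : T ≤ s := by
  by_contra! hsT
  have := (h.chain.mono hs le_rfl).lt_and_deriv_pos_of_init hsT
    (fun t ht => (h.fourth_deriv_pos hf t ⟨hs.trans ht.1, ht.2⟩).le)
    (by rintro i ⟨hi, hi'⟩; interval_cases i; exacts [h1, h2, h3.le])
    ⟨3, by simp, h3.ne'⟩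
  exact this.2.ne' h.deriv_end

lemma sub_nonneg_of_init (hv : IsProfile f p T₁ v) (hw : IsProfile f p T₂ w)
    (hmono : MonotoneOn f (Icc 0 p)) (hlip : LipschitzOnWith K f (Icc 0 p))
    (h2 : w 2 0 ≤ v 2 0) (h3 : w 3 0 ≤ v 3 0) :
    ∀ t ∈ Icc 0 (min T₁ T₂), 0 ≤ v 0 t - w 0 t ∧ 0 ≤ v 4 t - w 4 t := by
  have ch := (hv.chain.mono le_rfl (min_le_left T₁ T₂)).sub
    (hw.chain.mono le_rfl (min_le_right T₁ T₂))
  have mem₁ : ∀ t ∈ Icc 0 (min T₁ T₂), t ∈ Icc 0 T₁ := fun t ht =>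
    ⟨ht.1, ht.2.trans (min_le_left _ _)⟩
  have mem₂ : ∀ t ∈ Icc 0 (min T₁ T₂), t ∈ Icc 0 T₂ := fun t ht =>
    ⟨ht.1, ht.2.trans (min_le_right _ _)⟩
  have hode : ∀ t ∈ Icc 0 (min T₁ T₂), K * min (v 0 t - w 0 t) 0 ≤ v 4 t - w 4 t := by
    intro t ht
    have hvt := hv.mem_Icc (mem₁ t ht)
    have hwt := hw.mem_Icc (mem₂ t ht)
    rw [hv.eqn t (mem₁ t ht), hw.eqn t (mem₂ t ht)]
    rcases le_total (v 0 t) (w 0 t) with hle | hle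
    · have := hlip.le_add_mul hwt hvt
      rw [Real.dist_eq, abs_of_nonneg (sub_nonneg.2 hle)] at this
      rw [min_eq_left (sub_nonpos.2 hle)]
      linarith
    · rw [min_eq_right (sub_nonneg.2 hle), mul_zero, sub_nonneg]
      exact hmono hwt hvt hle
  have hnn : ∀ t ∈ Icc 0 (min T₁ T₂), 0 ≤ v 0 t - w 0 t := by
    refine ch.nonneg_of_ivp (by simp) K.2 (fun i hi => ?_) hode
    interval_cases i
    exacts [by simp [hv.apply_zero, hw.apply_zero], by simp [hv.deriv_zero, hw.deriv_zero],
      sub_nonneg.2 h2, sub_nonneg.2 h3]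
  refine fun t ht => ⟨hnn t ht, ?_⟩
  have := hode t ht
  rwa [min_eq_right (hnn t ht), mul_zero] at this

/-- If the data differ, then `v` stays above `w`. So `w` ends first, and from that moment on `v` has
nonnegative derivatives and cannot come down to its clamped end. -/
lemma init_eq_of_init_le (hv : IsProfile f p T₁ v) (hw : IsProfile f p T₂ w)
    (hf : ∀ x ∈ Icc 0 p, 0 < f x) (hmono : MonotoneOn f (Icc 0 p))
    (hlip : LipschitzOnWith K f (Icc 0 p)) (h2 : w 2 0 ≤ v 2 0) (h3 : w 3 0 ≤ v 3 0) :
    w 2 0 = v 2 0 ∧ w 3 0 = v 3 0 := by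
  by_contra hne
  have hT : 0 < min T₁ T₂ := lt_min hv.T_pos hw.T_pos
  have ch := (hv.chain.mono le_rfl (min_le_left T₁ T₂)).sub
    (hw.chain.mono le_rfl (min_le_right T₁ T₂))
  have h4 : ∀ t ∈ Icc 0 (min T₁ T₂), 0 ≤ v 4 t - w 4 t := fun t ht =>
    (hv.sub_nonneg_of_init hw hmono hlip h2 h3 t ht).2
  have hinit : ∀ i ∈ Ico 1 4, 0 ≤ v i 0 - w i 0 := by
    rintro i ⟨hi, hi'⟩
    interval_cases i
    exacts [by simp [hv.deriv_zero, hw.deriv_zero], sub_nonneg.2 h2, sub_nonneg.2 h3]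
  have hinit_ne : ∃ i ∈ Ico 1 4, v i 0 - w i 0 ≠ 0 := by
    by_contra! h0
    exact hne ⟨(sub_eq_zero.1 (h0 2 (by simp))).symm, (sub_eq_zero.1 (h0 3 (by simp))).symm⟩
  have hlt := (ch.lt_and_deriv_pos_of_init hT h4 hinit hinit_ne).1
  have hend : ∀ i ∈ Icc 1 4, 0 ≤ v i (min T₁ T₂) - w i (min T₁ T₂) := fun i hi =>
    ch.nonneg_of_init h4 hinit hi _ (right_mem_Icc.2 hT.le)
  simp only [hv.apply_zero, hw.apply_zero, sub_self] at hlt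
  rcases le_or_gt T₁ T₂ with hle | hlt'
  · rw [min_eq_left hle, hv.apply_end] at hlt
    linarith [hw.nonneg T₁ ⟨hv.T_pos.le, hle⟩]
  · rw [min_eq_right hlt'.le] at hend
    refine hlt'.not_ge (hv.length_le_of_nonneg hf hw.T_pos.le ?_ ?_ ?_)
    · linarith [hend 1 (by simp), hw.deriv_end]
    · linarith [hend 2 (by simp), hw.second_deriv_end_nonneg]
    · linarith [hend 3 (by simp), hw.third_deriv_end_pos hf]

lemma length_le_of_eq (hv : IsProfile f p T₁ v) (hw : IsProfile f p T₂ w)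
    (hf : ∀ x ∈ Icc 0 p, 0 < f x) (h : ∀ t ∈ Icc 0 (min T₁ T₂), v 0 t = w 0 t) : T₂ ≤ T₁ := by
  by_contra! hlt
  rw [min_eq_left hlt.le] at h
  have hvw : ∀ i ≤ 4, v i T₁ = w i T₁ := fun i hi =>
    hv.chain.eq_of_eq_zero (hw.chain.mono le_rfl hlt.le) hv.T_pos h hi T₁
      (right_mem_Icc.2 hv.T_pos.le)
  refine hlt.not_ge (hw.length_le_of_nonneg hf hv.T_pos.le ?_ ?_ ?_)
  · rw [← hvw 1 (by simp), hv.deriv_end]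
  · rw [← hvw 2 (by simp)]
    exact hv.second_deriv_end_nonneg
  · rw [← hvw 3 (by simp)]
    exact hv.third_deriv_end_pos hf

theorem eq_of_init_le (hv : IsProfile f p T₁ v) (hw : IsProfile f p T₂ w)
    (hf : ∀ x ∈ Icc 0 p, 0 < f x) (hmono : MonotoneOn f (Icc 0 p))
    (hlip : LipschitzOnWith K f (Icc 0 p)) (h2 : w 2 0 ≤ v 2 0) (h3 : w 3 0 ≤ v 3 0) :
    T₁ = T₂ ∧ ∀ i ≤ 4, ∀ t ∈ Icc 0 T₁, v i t = w i t := by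
  obtain ⟨e2, e3⟩ := hv.init_eq_of_init_le hw hf hmono hlip h2 h3
  have heq : ∀ t ∈ Icc 0 (min T₁ T₂), v 0 t = w 0 t := fun t ht => by
    linarith [(hv.sub_nonneg_of_init hw hmono hlip e2.le e3.le t ht).1,
      (hw.sub_nonneg_of_init hv hmono hlip e2.ge e3.ge t (by rwa [min_comm])).1]
  have hT : T₁ = T₂ := le_antisymm
    (hw.length_le_of_eq hv hf fun t ht => (heq t (by rwa [min_comm])).symm)
    (hv.length_le_of_eq hw hf heq)
  subst hT
  rw [min_self] at heq
  exact ⟨rfl, fun i hi => hv.chain.eq_of_eq_zero hw.chain hv.T_pos heq hi⟩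

lemma rescale {c : ℝ} (hc : 0 < c) (hlam : c ^ 4 * lam = 1)
    (h : IsProfile (fun x => lam * f x) p T v) :
    IsProfile f p (T / c) (fun i t => c ^ i * v i (0 + c * t)) := by
  have hmaps : ∀ t ∈ Icc 0 (T / c), 0 + c * t ∈ Icc 0 T := fun t ht => by
    rw [zero_add]
    exact ⟨mul_nonneg hc.le ht.1, (le_div_iff₀' hc).1 ht.2⟩
  have hT : 0 + c * (T / c) = T := by field_simp; ring
  exact
    { T_pos := div_pos h.T_pos hc
      p_pos := h.p_pos
      chain := h.chain.comp_affine hmaps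
      apply_zero := by simp [h.apply_zero]
      deriv_zero := by simp [h.deriv_zero]
      apply_end := by rw [hT]; simp [h.apply_end]
      deriv_end := by rw [hT]; simp [h.deriv_end]
      nonneg := fun t ht => by simpa using h.nonneg _ (hmaps t ht)
      le := fun t ht => by simpa using h.le _ (hmaps t ht)
      eqn := fun t ht => by
        rw [h.eqn _ (hmaps t ht), ← mul_assoc, hlam]
        simp }

/-- Rescaling the variable turns both equations into `v'''' = f v`, at the price of different
lengths `T / c₁` and `T / c₂`. -/
theorem eq_of_max_eq (hl₁ : 0 < lam₁) (hl₂ : 0 < lam₂)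
    (hv : IsProfile (fun x => lam₁ * f x) p T v) (hw : IsProfile (fun x => lam₂ * f x) p T w)
    (hf : ∀ x ∈ Icc 0 p, 0 < f x) (hmono : MonotoneOn f (Icc 0 p))
    (hlip : LipschitzOnWith K f (Icc 0 p)) (hv3 : v 3 0 = 0) (hw3 : w 3 0 = 0) :
    lam₁ = lam₂ ∧ ∀ t ∈ Icc 0 T, v 0 t = w 0 t := by
  have exists_scale : ∀ l : ℝ, 0 < l → ∃ c : ℝ, 0 < c ∧ c ^ 4 * l = 1 := fun l hl => by
    refine ⟨l⁻¹ ^ ((4 : ℕ) : ℝ)⁻¹, by positivity, ?_⟩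
    rw [Real.rpow_inv_natCast_pow (by positivity) (by simp), inv_mul_cancel₀ hl.ne']
  obtain ⟨c₁, hc₁, e₁⟩ := exists_scale lam₁ hl₁
  obtain ⟨c₂, hc₂, e₂⟩ := exists_scale lam₂ hl₂
  have hv' := hv.rescale hc₁ e₁
  have hw' := hw.rescale hc₂ e₂
  have rescaled_eq : T / c₁ = T / c₂ ∧
      ∀ t ∈ Icc 0 (T / c₁), v 0 (c₁ * t) = w 0 (c₂ * t) := by
    rcases le_total (c₂ ^ 2 * w 2 0) (c₁ ^ 2 * v 2 0) with hle | hle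
    · obtain ⟨hT, heq⟩ := hv'.eq_of_init_le hw' hf hmono hlip (by simpa using hle)
        (by simp [hv3, hw3])
      exact ⟨hT, fun t ht => by simpa using heq 0 (by simp) t ht⟩
    · obtain ⟨hT, heq⟩ := hw'.eq_of_init_le hv' hf hmono hlip (by simpa using hle)
        (by simp [hv3, hw3])
      exact ⟨hT.symm, fun t ht => by simpa using (heq 0 (by simp) t (hT ▸ ht)).symm⟩
  have hc : c₁ = c₂ := by
    simpa [div_eq_mul_inv, hv.T_pos.ne'] using rescaled_eq.1
  subst hc
  refine ⟨mul_left_cancel₀ (pow_pos hc₁ 4).ne' (e₁.trans e₂.symm), fun t ht => ?_⟩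
  have := rescaled_eq.2 (t / c₁) ⟨div_nonneg ht.1 hc₁.le, by gcongr; exact ht.2⟩
  rwa [mul_div_cancel₀ t hc₁.ne'] at this

end IsProfile

/-- A nonnegative solution of `v'''' = f v`, `v(0) = v(1) = v'(0) = v'(1) = 0` on `[0, 1]`. -/
structure IsClampedSolution (f : ℝ → ℝ) (v : ℕ → ℝ → ℝ) : Prop where
  chain : DerivChain 4 0 1 v
  nonneg : ∀ t ∈ Icc 0 1, 0 ≤ v 0 t
  eqn : ∀ t ∈ Icc 0 1, v 4 t = f (v 0 t)
  apply_zero : v 0 0 = 0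
  apply_one : v 0 1 = 0
  deriv_zero : v 1 0 = 0
  deriv_one : v 1 1 = 0

namespace IsClampedSolution

variable {f : ℝ → ℝ} {x : ℝ} {K : NNReal} {v : ℕ → ℝ → ℝ}

lemma mem_Ioo_of_pos (h : IsClampedSolution f v) (hx : x ∈ Icc 0 1) (hpos : 0 < v 0 x) :
    x ∈ Ioo 0 1 :=
  ⟨hx.1.lt_of_ne (by rintro rfl; exact hpos.ne' h.apply_zero),
    hx.2.lt_of_ne (by rintro rfl; exact hpos.ne' h.apply_one)⟩

lemma deriv_eq_zero_of_isMaxOn (h : IsClampedSolution f v) (hx : x ∈ Ioo 0 1)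
    (hmax : IsMaxOn (v 0) (Icc 0 1) x) : v 1 x = 0 :=
  have hnhds : Icc (0 : ℝ) 1 ∈ 𝓝 x := Icc_mem_nhds hx.1 hx.2
  (hmax.isLocalMax hnhds).hasDerivAt_eq_zero
    ((h.chain 0 (by simp) x (Ioo_subset_Icc_self hx)).hasDerivAt hnhds)

lemma isProfile_right (h : IsClampedSolution f v) (hx : x ∈ Ioo 0 1) (hpos : 0 < v 0 x)
    (hmax : IsMaxOn (v 0) (Icc 0 1) x) :
    IsProfile f (v 0 x) (1 - x) (fun i t => 1 ^ i * v i (x + 1 * t)) :=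
  have hmaps : ∀ t ∈ Icc 0 (1 - x), x + 1 * t ∈ Icc (0 : ℝ) 1 := fun t ht =>
    ⟨by linarith [ht.1, hx.1], by linarith [ht.2]⟩
  { T_pos := sub_pos.2 hx.2
    p_pos := hpos
    chain := h.chain.comp_affine hmaps
    apply_zero := by simp
    deriv_zero := by simp [h.deriv_eq_zero_of_isMaxOn hx hmax]
    apply_end := by simp [h.apply_one]
    deriv_end := by simp [h.deriv_one]
    nonneg := fun t ht => by simpa using h.nonneg _ (hmaps t ht)
    le := fun t ht => by simpa using hmax (hmaps t ht)
    eqn := fun t ht => by simpa using h.eqn _ (hmaps t ht) }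

lemma isProfile_left (h : IsClampedSolution f v) (hx : x ∈ Ioo 0 1) (hpos : 0 < v 0 x)
    (hmax : IsMaxOn (v 0) (Icc 0 1) x) :
    IsProfile f (v 0 x) x (fun i t => (-1) ^ i * v i (x + -1 * t)) :=
  have hmaps : ∀ t ∈ Icc 0 x, x + -1 * t ∈ Icc (0 : ℝ) 1 := fun t ht =>
    ⟨by linarith [ht.2], by linarith [ht.1, hx.2]⟩
  { T_pos := hx.1
    p_pos := hpos
    chain := h.chain.comp_affine hmaps
    apply_zero := by simp
    deriv_zero := by simp [h.deriv_eq_zero_of_isMaxOn hx hmax]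
    apply_end := by simp [h.apply_zero]
    deriv_end := by simp [h.deriv_zero]
    nonneg := fun t ht => by simpa using h.nonneg _ (hmaps t ht)
    le := fun t ht => by simpa using hmax (hmaps t ht)
    eqn := fun t ht => by
      rw [Even.neg_one_pow (by decide), one_mul, pow_zero, one_mul]
      exact h.eqn _ (hmaps t ht) }

/-- The two sides of a maximum are profiles with opposite third derivatives at `t = 0`, so their
data are ordered and they coincide. -/
lemma symm_about_max (h : IsClampedSolution f v) (hx : x ∈ Ioo 0 1) (hpos : 0 < v 0 x)
    (hmax : IsMaxOn (v 0) (Icc 0 1) x) (hf : ∀ y ∈ Icc 0 (v 0 x), 0 < f y)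
    (hmono : MonotoneOn f (Icc 0 (v 0 x))) (hlip : LipschitzOnWith K f (Icc 0 (v 0 x))) :
    x = 1 / 2 ∧ ∀ i ≤ 4, ∀ t ∈ Icc 0 x, v i (x + t) = (-1) ^ i * v i (x - t) := by
  have hright := h.isProfile_right hx hpos hmax
  have hleft := h.isProfile_left hx hpos hmax
  rcases le_total 0 (v 3 x) with h3 | h3
  · obtain ⟨hT, heq⟩ := hright.eq_of_init_le hleft hf hmono hlip (by simp) (by norm_num; linarith)
    refine ⟨by linarith, fun i hi t ht => ?_⟩
    simpa [sub_eq_add_neg] using heq i hi t (by rwa [hT])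
  · obtain ⟨hT, heq⟩ := hleft.eq_of_init_le hright hf hmono hlip (by simp) (by norm_num; linarith)
    refine ⟨by linarith, fun i hi t ht => ?_⟩
    simpa [sub_eq_add_neg] using (heq i hi t ht).symm

theorem isProfile_and_symm (h : IsClampedSolution f v) {x : ℝ} (hx : x ∈ Icc 0 1)
    (hpos : 0 < v 0 x) (hmax : IsMaxOn (v 0) (Icc 0 1) x) (hf : ∀ y ∈ Icc 0 (v 0 x), 0 < f y)
    (hmono : MonotoneOn f (Icc 0 (v 0 x))) (hlip : LipschitzOnWith K f (Icc 0 (v 0 x))) :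
    IsProfile f (v 0 (1 / 2)) (1 / 2) (fun i t => v i (1 / 2 + t)) ∧ v 3 (1 / 2) = 0 ∧
      ∀ t ∈ Icc (0 : ℝ) 1, v 0 (1 - t) = v 0 t := by
  have hx' := h.mem_Ioo_of_pos hx hpos
  obtain ⟨rfl, hsymm⟩ := h.symm_about_max hx' hpos hmax hf hmono hlip
  refine ⟨?_, ?_, fun t ht => ?_⟩
  · have := h.isProfile_right hx' hpos hmax
    rw [sub_half] at this
    simpa only [one_pow, one_mul] using this
  · have := hsymm 3 (by simp) 0 (by norm_num)
    simp only [add_zero, sub_zero] at this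
    linarith
  · rcases le_total t (1 / 2) with hle | hle
    · have := hsymm 0 (by simp) (1 / 2 - t) ⟨by linarith, by linarith [ht.1]⟩
      rw [pow_zero, one_mul] at this
      convert this using 2 <;> ring
    · have := hsymm 0 (by simp) (t - 1 / 2) ⟨by linarith, by linarith [ht.2]⟩
      rw [pow_zero, one_mul] at this
      convert this.symm using 2 <;> ring

end IsClampedSolution

/-- The derivatives of `u ∈ C^k[0,1]`, indexed by `ℕ` and extended to the line by constants. -/
noncomputable def CkFun.fn {k : ℕ} (u : CkFun k) (i : ℕ) : ℝ → ℝ :=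
  IccExtend zero_le_one (u.der (Fin.ofNat (k + 1) i))

namespace CkFun

variable {k : ℕ}

lemma fn_val (u : CkFun k) (i : Fin (k + 1)) : u.fn i = IccExtend zero_le_one (u.der i) := by
  rw [fn, Fin.ofNat_eq_cast, Fin.cast_val_eq_self]

lemma fn_coe (u : CkFun k) (i : Fin (k + 1)) (x : unitInterval) : u.fn i x = u.der i x := by
  rw [fn_val, IccExtend_val]

lemma derivChain (u : CkFun k) : DerivChain k 0 1 u.fn := by
  intro i hi x hx
  rw [show u.fn i = _ from u.fn_val (Fin.castSucc ⟨i, hi⟩),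
    show u.fn (i + 1) x = _ from u.fn_coe (Fin.succ ⟨i, hi⟩) ⟨x, hx⟩]
  exact u.2 ⟨i, hi⟩ ⟨x, hx⟩

lemma ext_der_zero {u v : CkFun k} (h : ∀ x, u.der 0 x = v.der 0 x) : u = v := by
  have h0 : ∀ x ∈ Icc (0 : ℝ) 1, u.fn 0 x = v.fn 0 x := fun x hx =>
    (u.fn_coe 0 ⟨x, hx⟩).trans ((h _).trans (v.fn_coe 0 ⟨x, hx⟩).symm)
  refine Subtype.ext (funext fun i => ContinuousMap.ext fun x => ?_)
  have := u.derivChain.eq_of_eq_zero v.derivChain one_pos h0 (Nat.lt_succ_iff.1 i.2) x x.2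
  rwa [fn_coe, fn_coe] at this

end CkFun

/-- `f` is a positive, strictly increasing, strictly convex function on `[0, r)` with derivative
`f'`. -/
structure IsConvexSource (r : ℝ) (f f' : ℝ → ℝ) : Prop where
  pos : ∀ x ∈ Ico 0 r, 0 < f x
  strictMonoOn : StrictMonoOn f (Ico 0 r)
  strictConvexOn : StrictConvexOn ℝ (Ico 0 r) f
  hasDeriv : ∀ x ∈ Ico 0 r, HasDerivWithinAt f (f' x) (Ico 0 r) x

namespace IsConvexSource

variable {r : ℝ} {f f' : ℝ → ℝ}

lemma const_mul (h : IsConvexSource r f f') {c : ℝ} (hc : 0 < c) :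
    IsConvexSource r (fun x => c * f x) (fun x => c * f' x) where
  pos x hx := mul_pos hc (h.pos x hx)
  strictMonoOn := fun x hx y hy hxy => mul_lt_mul_of_pos_left (h.strictMonoOn hx hy hxy) hc
  strictConvexOn := by
    refine ⟨h.strictConvexOn.1, fun x hx y hy hxy a b ha hb hab => ?_⟩
    have := mul_lt_mul_of_pos_left (h.strictConvexOn.2 hx hy hxy ha hb hab) hc
    simp only [smul_eq_mul] at this ⊢
    linarith
  hasDeriv x hx := (h.hasDeriv x hx).const_mul c

lemma continuousOn (h : IsConvexSource r f f') : ContinuousOn f (Ico 0 r) :=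
  fun x hx => (h.hasDeriv x hx).continuousWithinAt

lemma pos_of_mem_Icc (h : IsConvexSource r f f') {p : ℝ} (hp : p < r) :
    ∀ x ∈ Icc 0 p, 0 < f x := fun x hx => h.pos x ⟨hx.1, hx.2.trans_lt hp⟩

lemma deriv_nonneg (h : IsConvexSource r f f') {x : ℝ} (hx : x ∈ Ico 0 r) : 0 ≤ f' x := by
  have huniq := uniqueDiffOn_Ico 0 r x hx
  rw [← (h.hasDeriv x hx).derivWithin huniq]
  exact h.strictMonoOn.monotoneOn.derivWithin_nonneg

lemma sub_le_deriv_mul (h : IsConvexSource r f f') {x y : ℝ} (hx : x ∈ Ico 0 r)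
    (hy : y ∈ Ico 0 r) (hxy : x < y) : f y - f x ≤ f' y * (y - x) := by
  have := h.strictConvexOn.convexOn.slope_le_of_hasDerivWithinAt hx hy hxy (h.hasDeriv y hy)
  rwa [slope_def_field, div_le_iff₀ (sub_pos.2 hxy)] at this

lemma deriv_mul_le_sub (h : IsConvexSource r f f') {x y : ℝ} (hx : x ∈ Ico 0 r)
    (hy : y ∈ Ico 0 r) (hxy : x < y) : f' x * (y - x) ≤ f y - f x := by
  have := h.strictConvexOn.convexOn.le_slope_of_hasDerivWithinAt hx hy hxy (h.hasDeriv x hx)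
  rwa [slope_def_field, le_div_iff₀ (sub_pos.2 hxy)] at this

lemma deriv_le_deriv (h : IsConvexSource r f f') {x y : ℝ} (hx : x ∈ Ico 0 r)
    (hy : y ∈ Ico 0 r) (hxy : x ≤ y) : f' x ≤ f' y := by
  rcases hxy.eq_or_lt with rfl | hlt
  · rfl
  · exact le_of_mul_le_mul_right
      ((h.deriv_mul_le_sub hx hy hlt).trans (h.sub_le_deriv_mul hx hy hlt)) (sub_pos.2 hlt)

lemma lipschitzOnWith (h : IsConvexSource r f f') {p : ℝ} (hp : p ∈ Ico 0 r) :
    LipschitzOnWith (f' p).toNNReal f (Icc 0 p) := by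
  have hsub : Icc 0 p ⊆ Ico 0 r := fun x hx => ⟨hx.1, hx.2.trans_lt hp.2⟩
  refine (convex_Icc 0 p).lipschitzOnWith_of_nnnorm_hasDerivWithin_le
    (fun x hx => (h.hasDeriv x (hsub hx)).mono hsub) fun x hx => ?_
  rw [← Real.toNNReal_eq_nnnorm_of_nonneg (h.deriv_nonneg (hsub hx))]
  exact Real.toNNReal_le_toNNReal (h.deriv_le_deriv (hsub hx) hp hx.2)

lemma cross_le (h : IsConvexSource r f f') {x y z : ℝ} (hx : x ∈ Ico 0 r) (hz : z ∈ Ico 0 r)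
    (hxy : x ≤ y) (hyz : y ≤ z) : (f y - f x) * (z - y) ≤ (y - x) * (f z - f y) := by
  rcases hxy.eq_or_lt with rfl | hxy
  · simp
  rcases hyz.eq_or_lt with rfl | hyz
  · simp
  have := h.strictConvexOn.convexOn.slope_mono_adjacent hx hz hxy hyz
  rwa [div_le_div_iff₀ (sub_pos.2 hxy) (sub_pos.2 hyz), mul_comm (f z - f y)] at this

lemma cross_lt (h : IsConvexSource r f f') {x y z : ℝ} (hx : x ∈ Ico 0 r) (hz : z ∈ Ico 0 r)
    (hxy : x < y) (hyz : y < z) : (f y - f x) * (z - y) < (y - x) * (f z - f y) := by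
  have := h.strictConvexOn.slope_strict_mono_adjacent hx hz hxy hyz
  rwa [div_lt_div_iff₀ (sub_pos.2 hxy) (sub_pos.2 hyz), mul_comm (f z - f y)] at this

end IsConvexSource

/-- The second derivative would be negative somewhere on either side of `m`, hence, being convex, at
`m` itself, where `v 0` has a minimum. -/
lemma DerivChain.ne_zero_of_deriv_neg {v : ℕ → ℝ → ℝ} {T m : ℝ} (h : DerivChain 4 0 T v)
    (h4 : ∀ t ∈ Icc 0 T, 0 ≤ v 4 t) (h0 : ∀ t ∈ Icc 0 T, 0 ≤ v 0 t) (hm : m ∈ Ioo 0 T)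
    (hinit : 0 < v 0 0) (hinit' : 0 ≤ v 1 0) (hend : v 1 T < 0) : v 0 m ≠ 0 := by
  intro hvm
  have left := h.mono le_rfl hm.2.le
  have right := h.mono hm.1.le le_rfl
  have hvm' : v 1 m = 0 := by
    have hnhds : Icc 0 T ∈ 𝓝 m := Icc_mem_nhds hm.1 hm.2
    have hmin : IsMinOn (v 0) (Icc 0 T) m := fun t ht => hvm.trans_le (h0 t ht)
    exact (hmin.isLocalMin hnhds).hasDerivAt_eq_zero
      ((h 0 (by simp) m (Ioo_subset_Icc_self hm)).hasDerivAt hnhds)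
  obtain ⟨ξ, hξ, hξneg⟩ : ∃ ξ ∈ Icc 0 m, v 2 ξ < 0 := by
    by_contra! hnn
    have hle := left.left_le_of_deriv_nonneg (i := 0) (by simp)
      (fun t ht => hinit'.trans (left.left_le_of_deriv_nonneg (by simp) hnn ht))
      (right_mem_Icc.2 hm.1.le)
    exact hle.not_gt (hvm ▸ hinit)
  obtain ⟨ζ, hζ, hζneg⟩ : ∃ ζ ∈ Icc m T, v 2 ζ < 0 := by
    by_contra! hnn
    have hle := right.left_le_of_deriv_nonneg (i := 1) (by simp) hnn (right_mem_Icc.2 hm.2.le)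
    exact hle.not_gt (hvm' ▸ hend)
  have hconv : ConvexOn ℝ (Icc 0 T) (v 2) := h.convexOn (by simp) h4
  have hle : v 2 m ≤ max (v 2 ξ) (v 2 ζ) := hconv.le_max_of_mem_Icc ⟨hξ.1, hξ.2.trans hm.2.le⟩
    ⟨hm.1.le.trans hζ.1, hζ.2⟩ ⟨hξ.2, hζ.1⟩
  have hvm'' : 0 ≤ v 2 m := left.second_deriv_right_nonneg (by simp) hm.1
    (fun t ht => h0 t ⟨ht.1, ht.2.trans hm.2.le⟩) hvm hvm'
  exact (hvm''.trans hle).not_gt (max_lt hξneg hζneg)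

namespace IsProfile

variable {f : ℝ → ℝ} {r p T t : ℝ} {v : ℕ → ℝ → ℝ}

lemma mem_Ico (h : IsProfile f p T v) (hp : p < r) (ht : t ∈ Icc 0 T) : v 0 t ∈ Ico 0 r :=
  ⟨h.nonneg t ht, (h.le t ht).trans_lt hp⟩

lemma third_deriv_nonneg (h : IsProfile f p T v) (hf : ∀ x ∈ Icc 0 p, 0 < f x) (h3 : v 3 0 = 0)
    (ht : t ∈ Icc 0 T) : 0 ≤ v 3 t :=
  h3.ge.trans <| h.chain.left_le_of_deriv_nonneg (i := 3) (by simp)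
    (fun s hs => (h.fourth_deriv_pos hf s hs).le) ht

lemma convexOn_deriv (h : IsProfile f p T v) (hf : ∀ x ∈ Icc 0 p, 0 < f x) (h3 : v 3 0 = 0) :
    ConvexOn ℝ (Icc 0 T) (v 1) :=
  h.chain.convexOn (by simp) fun _ => h.third_deriv_nonneg hf h3

lemma deriv_le (h : IsProfile f p T v) (hf : ∀ x ∈ Icc 0 p, 0 < f x) (h3 : v 3 0 = 0)
    (ht : t ∈ Icc 0 T) : v 1 t ≤ -(p / T ^ 2 * min t (T - t)) := by
  obtain ⟨ξ, hξ, hslope⟩ := exists_hasDerivAt_eq_slope (v 0) (v 1) h.T_pos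
    (h.chain.continuousOn (by simp)) (fun t ht =>
      (h.chain 0 (by simp) t (Ioo_subset_Icc_self ht)).hasDerivAt (Icc_mem_nhds ht.1 ht.2))
  rw [h.apply_end, h.apply_zero, zero_sub, sub_zero, neg_div] at hslope
  have := le_neg_mul_min_of_convexOn_Icc (h.convexOn_deriv hf h3) h.deriv_zero.le h.deriv_end.le hξ
    (div_nonneg h.p_pos.le h.T_pos.le) hslope.le ht
  rwa [sub_zero, sub_zero, div_div, ← sq] at this

lemma deriv_neg (h : IsProfile f p T v) (hf : ∀ x ∈ Icc 0 p, 0 < f x) (h3 : v 3 0 = 0)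
    (ht : t ∈ Ioo 0 T) : v 1 t < 0 := by
  have hp := h.p_pos
  have hT := h.T_pos
  have hmin : 0 < min t (T - t) := lt_min ht.1 (sub_pos.2 ht.2)
  exact (h.deriv_le hf h3 (Ioo_subset_Icc_self ht)).trans_lt (by rw [neg_lt_zero]; positivity)

lemma deriv_nonpos (h : IsProfile f p T v) (hf : ∀ x ∈ Icc 0 p, 0 < f x) (h3 : v 3 0 = 0)
    (ht : t ∈ Icc 0 T) : v 1 t ≤ 0 :=
  nonpos_of_convexOn_Icc (h.convexOn_deriv hf h3) h.deriv_zero.le h.deriv_end.le ht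

lemma second_deriv_end_pos (h : IsProfile f p T v) (hf : ∀ x ∈ Icc 0 p, 0 < f x)
    (h3 : v 3 0 = 0) : 0 < v 2 T := by
  have hhalf : T / 2 ∈ Ioo 0 T := ⟨half_pos h.T_pos, half_lt_self h.T_pos⟩
  have hT := right_mem_Icc.2 h.T_pos.le
  refine lt_of_lt_of_le ?_ ((h.convexOn_deriv hf h3).slope_le_of_hasDerivWithinAt
    (Ioo_subset_Icc_self hhalf) hT hhalf.2 (h.chain 1 (by simp) T hT))
  rw [slope_def_field, h.deriv_end, zero_sub]
  exact div_pos (neg_pos.2 (h.deriv_neg hf h3 hhalf)) (sub_pos.2 hhalf.2)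

lemma second_deriv_init_nonpos (h : IsProfile f p T v) (hf : ∀ x ∈ Icc 0 p, 0 < f x)
    (h3 : v 3 0 = 0) : v 2 0 ≤ 0 := by
  have h0 := left_mem_Icc.2 h.T_pos.le
  have := (h.convexOn_deriv hf h3).le_slope_of_hasDerivWithinAt h0 (right_mem_Icc.2 h.T_pos.le)
    h.T_pos (h.chain 1 (by simp) 0 h0)
  rwa [slope_def_field, h.deriv_end, h.deriv_zero, sub_zero, zero_div] at this

end IsProfile

namespace IsProfile

variable {f f' : ℝ → ℝ} {r p p₁ p₂ p₃ T t k : ℝ} {v w x : ℕ → ℝ → ℝ}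

lemma derivChain_deriv (hf : IsConvexSource r f f') (hp : p < r) (h : IsProfile f p T v) :
    DerivChain 4 0 T
      (Function.update (fun i => v (i + 1)) 4 fun t => f' (v 0 t) * v 1 t) := by
  intro i hi t ht
  rcases (Nat.lt_succ_iff.1 hi).lt_or_eq with hi3 | rfl
  · rw [Function.update_of_ne (by lia), Function.update_of_ne (by lia)]
    exact h.chain (i + 1) (by lia) t ht
  · rw [Function.update_of_ne (by simp), Function.update_self]
    exact ((hf.hasDeriv _ (h.mem_Ico hp ht)).comp t (h.chain 0 (by simp) t ht)
      fun s hs => h.mem_Ico hp hs).congr h.eqn (h.eqn t ht)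

lemma sub_sub_deriv_mul_nonneg (hf : IsConvexSource r f f') (hv : IsProfile f p₁ T v)
    (hw : IsProfile f p₂ T w) (hv3 : v 3 0 = 0) (h₁ : p₁ < r) (h₂ : p₂ < r) (hk : 0 ≤ k)
    (ht : t ∈ Icc 0 T) (hvw : 0 ≤ w 0 t - v 0 t - k * v 1 t) :
    0 ≤ w 4 t - v 4 t - k * (f' (v 0 t) * v 1 t) := by
  have mv := hv.mem_Ico h₁ ht
  have mw := hw.mem_Ico h₂ ht
  have hderiv := hf.deriv_nonneg mv
  rw [hw.eqn t ht, hv.eqn t ht]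
  rcases le_or_gt (v 0 t) (w 0 t) with hle | hlt
  · have := hf.strictMonoOn.monotoneOn mv mw hle
    have hv1 := hv.deriv_nonpos (hf.pos_of_mem_Icc h₁) hv3 ht
    linarith [mul_nonneg hk (mul_nonneg hderiv (neg_nonneg.2 hv1))]
  · linarith [hf.sub_le_deriv_mul mw mv hlt, mul_nonneg hderiv hvw]

lemma exists_touching_deriv (hf : IsConvexSource r f f') (hv : IsProfile f p₁ T v)
    (hw : IsProfile f p₂ T w) (hv3 : v 3 0 = 0) (h₁₂ : p₁ < p₂) (h₁ : p₁ < r)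
    (hneg : ∃ s ∈ Icc 0 T, w 0 s < v 0 s) :
    ∃ k > 0, ∃ m ∈ Ioo 0 T, w 0 m - v 0 m - k * v 1 m = 0 ∧
      ∀ t ∈ Icc 0 T, 0 ≤ w 0 t - v 0 t - k * v 1 t := by
  have hpos := hf.pos_of_mem_Icc h₁
  have h0 := left_mem_Icc.2 hv.T_pos.le
  have hT := right_mem_Icc.2 hv.T_pos.le
  have ch := hw.chain.sub hv.chain
  obtain ⟨s, hs, hsneg⟩ := hneg
  have hs' : s ∈ Ioo 0 T := by
    refine ⟨hs.1.lt_of_ne ?_, hs.2.lt_of_ne ?_⟩ <;> rintro rfl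
    · exact hsneg.not_ge (by rw [hv.apply_zero, hw.apply_zero]; exact h₁₂.le)
    · exact hsneg.ne (by rw [hv.apply_end, hw.apply_end])
  have near_zero : ∀ κ > 0, ∀ᶠ t in 𝓝[>] 0, 0 < w 0 t - v 0 t + κ * -v 1 t := fun κ _ => by
    have hcont := (ch.continuousOn (i := 0) (by simp)).add
      ((hv.chain.continuousOn (i := 1) (by simp)).neg.const_mul κ)
    rw [← nhdsWithin_Ioc_eq_nhdsGT hv.T_pos]
    refine ((hcont 0 h0).mono Ioc_subset_Icc_self).eventually_const_lt ?_
    simpa [hv.apply_zero, hw.apply_zero, hv.deriv_zero] using h₁₂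
  have near_end : ∀ κ > 0, ∀ᶠ t in 𝓝[<] T, 0 < w 0 t - v 0 t + κ * -v 1 t := fun κ hκ => by
    refine eventually_pos_of_hasDerivWithinAt_neg (c := w 1 T - v 1 T + κ * -v 2 T) ?_
      (by simp [hv.apply_end, hw.apply_end, hv.deriv_end]) ?_
    · exact ((ch 0 (by simp) T hT).add
        ((hv.chain.neg 1 (by simp) T hT).const_mul κ)).mono_of_mem_nhdsWithin
          (Icc_mem_nhdsLT hv.T_pos)
    · simpa [hv.deriv_end, hw.deriv_end] using mul_pos hκ (hv.second_deriv_end_pos hpos hv3)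
  obtain ⟨k, hk, m, hm, hmk, hnn⟩ := exists_touching
    ((ch.continuousOn (i := 0) (by simp)).mono Ioo_subset_Icc_self)
    ((hv.chain.neg.continuousOn (i := 1) (by simp)).mono Ioo_subset_Icc_self)
    (fun t ht => neg_pos.2 (hv.deriv_neg hpos hv3 ht)) ⟨s, hs', sub_neg.2 hsneg⟩ near_zero near_end
  refine ⟨k, hk, m, hm, by linarith, fun t ht => ?_⟩
  rcases ht.1.eq_or_lt with rfl | h0t
  · simpa [hv.apply_zero, hw.apply_zero, hv.deriv_zero] using h₁₂.le
  rcases ht.2.eq_or_lt with rfl | htT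
  · simp [hv.apply_end, hw.apply_end, hv.deriv_end]
  · linarith [hnn t ⟨h0t, htT⟩]

/-- Otherwise `w - v - k v'`, with `k` the least number that makes it nonnegative, would contradict
`DerivChain.ne_zero_of_deriv_neg`. -/
theorem le_of_max_lt (hf : IsConvexSource r f f') (hv : IsProfile f p₁ T v)
    (hw : IsProfile f p₂ T w) (hv3 : v 3 0 = 0) (h₁₂ : p₁ < p₂) (h₂ : p₂ < r) :
    ∀ t ∈ Icc 0 T, v 0 t ≤ w 0 t := by
  by_contra! hneg
  have h₁ := h₁₂.trans h₂
  have hpos := hf.pos_of_mem_Icc h₁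
  obtain ⟨k, hk, m, hm, hmk, hnn⟩ := exists_touching_deriv hf hv hw hv3 h₁₂ h₁ hneg
  have ch := (hw.chain.sub hv.chain).sub ((derivChain_deriv hf h₁ hv).const_mul k)
  refine ch.ne_zero_of_deriv_neg (fun t ht => ?_) (fun t ht => ?_) hm ?_ ?_ ?_ ?_ <;>
    simp only [Function.update_self, Function.update_of_ne, ne_eq, OfNat.zero_ne_ofNat,
      OfNat.one_ne_ofNat, not_false_eq_true, zero_add, Nat.reduceAdd]
  · exact hv.sub_sub_deriv_mul_nonneg hf hw hv3 h₁ h₂ hk.le ht (hnn t ht)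
  · exact hnn t ht
  · simpa [hv.apply_zero, hw.apply_zero, hv.deriv_zero] using h₁₂
  · simpa [hv.deriv_zero, hw.deriv_zero] using
      mul_nonpos_of_nonneg_of_nonpos hk.le (hv.second_deriv_init_nonpos hpos hv3)
  · simpa [hv.deriv_end, hw.deriv_end] using mul_pos hk (hv.second_deriv_end_pos hpos hv3)
  · exact hmk

end IsProfile

/-- The bilinear concomitant of `y ↦ y''''`. -/
def concomitant (y z : ℕ → ℝ → ℝ) (t : ℝ) : ℝ :=
  y 3 t * z 0 t - y 2 t * z 1 t + y 1 t * z 2 t - y 0 t * z 3 t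

lemma DerivChain.hasDerivWithinAt_concomitant {a b t : ℝ} {y z : ℕ → ℝ → ℝ}
    (hy : DerivChain 4 a b y) (hz : DerivChain 4 a b z) (ht : t ∈ Icc a b) :
    HasDerivWithinAt (concomitant y z) (y 4 t * z 0 t - y 0 t * z 4 t) (Icc a b) t := by
  have hy' : ∀ i < 4, HasDerivWithinAt (y i) (y (i + 1) t) (Icc a b) t := fun i hi => hy i hi t ht
  have hz' : ∀ i < 4, HasDerivWithinAt (z i) (z (i + 1) t) (Icc a b) t := fun i hi => hz i hi t ht
  refine (((((hy' 3 (by simp)).mul (hz' 0 (by simp))).sub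
    ((hy' 2 (by simp)).mul (hz' 1 (by simp)))).add
    ((hy' 1 (by simp)).mul (hz' 2 (by simp)))).sub
    ((hy' 0 (by simp)).mul (hz' 3 (by simp)))).congr_deriv ?_
  simp only [Nat.reduceAdd]
  ring

namespace IsProfile

variable {f f' : ℝ → ℝ} {r p₁ p₂ p₃ T : ℝ} {v w x : ℕ → ℝ → ℝ}

/-- By convexity of `f`, the concomitant of `w - v` and `x - w` is decreasing, strictly near
`t = 0`. It vanishes at both ends. -/
theorem not_three (hf : IsConvexSource r f f') (hv : IsProfile f p₁ T v)
    (hw : IsProfile f p₂ T w) (hx : IsProfile f p₃ T x) (hv3 : v 3 0 = 0) (hw3 : w 3 0 = 0)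
    (hx3 : x 3 0 = 0) (h₁₂ : p₁ < p₂) (h₂₃ : p₂ < p₃) : ¬p₃ < r := by
  intro h₃
  have h₁ := h₁₂.trans (h₂₃.trans h₃)
  have h0 := left_mem_Icc.2 hv.T_pos.le
  have hT := right_mem_Icc.2 hv.T_pos.le
  set B := concomitant (fun i t => w i t - v i t) (fun i t => x i t - w i t) with hB
  have hBderiv := fun t (ht : t ∈ Icc 0 T) =>
    (hw.chain.sub hv.chain).hasDerivWithinAt_concomitant (hx.chain.sub hw.chain) ht
  have hle : ∀ t ∈ Icc 0 T,
      (w 4 t - v 4 t) * (x 0 t - w 0 t) - (w 0 t - v 0 t) * (x 4 t - w 4 t) ≤ 0 := by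
    intro t ht
    rw [hv.eqn t ht, hw.eqn t ht, hx.eqn t ht, sub_nonpos]
    exact hf.cross_le (hv.mem_Ico h₁ ht) (hx.mem_Ico h₃ ht)
      (le_of_max_lt hf hv hw hv3 h₁₂ (h₂₃.trans h₃) t ht) (le_of_max_lt hf hw hx hw3 h₂₃ h₃ t ht)
  have hanti : AntitoneOn B (Icc 0 T) := antitoneOn_of_hasDerivWithinAt_Icc hBderiv hle
  have hB0 : B 0 = 0 := by
    simp [hB, concomitant, hv.deriv_zero, hw.deriv_zero, hx.deriv_zero, hv3, hw3, hx3]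
  have hBT : B T = 0 := by
    simp [hB, concomitant, hv.deriv_end, hw.deriv_end, hx.deriv_end, hv.apply_end, hw.apply_end,
      hx.apply_end]
  have hBzero : ∀ t ∈ Icc 0 T, B t = 0 := fun t ht =>
    le_antisymm (hB0 ▸ hanti h0 ht ht.1) (hBT ▸ hanti ht hT ht.2)
  have hderiv0 := deriv_eq_zero_of_const_Icc hv.T_pos hBderiv hBzero 0 h0
  rw [hv.eqn 0 h0, hw.eqn 0 h0, hx.eqn 0 h0, hv.apply_zero, hw.apply_zero, hx.apply_zero,
    sub_eq_zero] at hderiv0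
  exact (hf.cross_lt ⟨hv.p_pos.le, h₁⟩ ⟨hx.p_pos.le, h₃⟩ h₁₂ h₂₃).ne hderiv0

end IsProfile

lemma hasDerivWithinAt_IccExtend {g : C(unitInterval, ℝ)} {F : ℝ → ℝ} {d : ℝ} {x : unitInterval}
    (hF : HasDerivWithinAt F d (Icc 0 1) x) (h : ∀ y : unitInterval, g y = F y) :
    HasDerivWithinAt (IccExtend zero_le_one g) d (Icc (0 : ℝ) 1) x :=
  hF.congr (fun y hy => by rw [IccExtend_of_mem _ _ hy]; exact h _)
    (by rw [IccExtend_val]; exact h x)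

/-- The operator `h ↦ ∫₀ˣ h` on `C[0,1]`. -/
noncomputable def primitive : C(unitInterval, ℝ) →L[ℝ] C(unitInterval, ℝ) :=
  LinearMap.mkContinuous
    { toFun := fun h => ⟨fun x => ∫ t in (0 : ℝ)..x, IccExtend zero_le_one h t,
        (intervalIntegral.continuous_primitive
          (fun a b => h.continuous.Icc_extend'.intervalIntegrable a b) 0).comp
          continuous_subtype_val⟩
      map_add' := fun h k => ContinuousMap.ext fun _ =>
        intervalIntegral.integral_add (h.continuous.Icc_extend'.intervalIntegrable _ _)
          (k.continuous.Icc_extend'.intervalIntegrable _ _)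
      map_smul' := fun c h => ContinuousMap.ext fun _ => intervalIntegral.integral_smul c _ }
    1 (fun h => by
      rw [one_mul, ContinuousMap.norm_le _ (norm_nonneg h)]
      intro x
      have := intervalIntegral.norm_integral_le_of_norm_le_const (a := 0) (b := (x : ℝ))
        (f := IccExtend zero_le_one h) (C := ‖h‖) (fun t _ => h.norm_coe_le_norm _)
      rw [sub_zero, abs_of_nonneg x.2.1] at this
      exact this.trans (mul_le_of_le_one_right (norm_nonneg _) x.2.2))

lemma primitive_zero (h : C(unitInterval, ℝ)) : primitive h 0 = 0 :=
  intervalIntegral.integral_same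

lemma hasDerivWithinAt_primitive (h : C(unitInterval, ℝ)) (x : unitInterval) :
    HasDerivWithinAt (IccExtend zero_le_one (primitive h)) (h x) (Icc (0 : ℝ) 1) x := by
  have hc : Continuous (IccExtend zero_le_one h) := h.continuous.Icc_extend'
  have hint := (hc.integral_hasStrictDerivAt 0 (x : ℝ)).hasDerivAt
  rw [IccExtend_val] at hint
  exact hasDerivWithinAt_IccExtend hint.hasDerivWithinAt fun _ => rfl

namespace CkFun

variable {k : ℕ}

/-- The `j`-th derivative as a continuous linear map. -/
noncomputable def derCLM (k : ℕ) (j : Fin (k + 1)) : CkFun k →L[ℝ] C(unitInterval, ℝ) :=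
  ContinuousLinearMap.proj j ∘L (ckSubmodule k).subtypeL

/-- A continuous function as an element of `C^0[0,1]`. -/
noncomputable def ofContinuousMap : C(unitInterval, ℝ) →L[ℝ] CkFun 0 :=
  (ContinuousLinearMap.pi fun _ => ContinuousLinearMap.id ℝ _).codRestrict (ckSubmodule 0)
    fun _ i => i.elim0

/-- The antiderivative that vanishes at `0`, as an operator from `C^k[0,1]` to `C^(k+1)[0,1]`. -/
noncomputable def antideriv (k : ℕ) : CkFun k →L[ℝ] CkFun (k + 1) :=
  (ContinuousLinearMap.pi (Fin.cons (primitive ∘L derCLM k 0) (derCLM k))).codRestrict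
    (ckSubmodule (k + 1)) fun u i x => by
      cases i using Fin.cases with
      | zero => exact hasDerivWithinAt_primitive _ x
      | succ i => exact u.2 i x

/-- The restriction of a polynomial to `[0,1]`. -/
noncomputable def ofPolynomial (k : ℕ) (q : Polynomial ℝ) : CkFun k :=
  ⟨fun j => ⟨fun x => (Polynomial.derivative^[j] q).eval (x : ℝ), by fun_prop⟩, fun i x => by
    refine hasDerivWithinAt_IccExtend
      (F := fun t => (Polynomial.derivative^[(i : ℕ)] q).eval t) ?_ fun _ => rfl
    refine (Polynomial.hasDerivAt _ _).hasDerivWithinAt.congr_deriv ?_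
    exact congrArg (Polynomial.eval (x : ℝ)) (Function.iterate_succ_apply' _ (i : ℕ) q).symm⟩

lemma der_ofPolynomial (q : Polynomial ℝ) (j : Fin (k + 1)) (x : unitInterval) :
    (ofPolynomial k q).der j x = (Polynomial.derivative^[(j : ℕ)] q).eval (x : ℝ) := rfl

/-- The clamped boundary conditions `u(0) = u(1) = u'(0) = u'(1) = 0`. -/
structure Clamped (u : CkFun 4) : Prop where
  left : u.der 0 0 = 0
  right : u.der 0 1 = 0
  left' : u.der 1 0 = 0
  right' : u.der 1 1 = 0

/-- Subtraction of the cubic polynomial `c₂ x² + c₃ x³` with the same value and the same derivative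
at `1`. -/
noncomputable def clampRight : CkFun 4 →L[ℝ] CkFun 4 :=
  let y₀ := ContinuousMap.evalCLM ℝ 1 ∘L derCLM 4 0
  let y₁ := ContinuousMap.evalCLM ℝ 1 ∘L derCLM 4 1
  ContinuousLinearMap.id ℝ _ - (((3 : ℝ) • y₀ - y₁).smulRight (ofPolynomial 4 (.X ^ 2)) +
    (y₁ - (2 : ℝ) • y₀).smulRight (ofPolynomial 4 (.X ^ 3)))

lemma der_clampRight (u : CkFun 4) (j : Fin 5) (x : unitInterval) :
    (clampRight u).der j x = u.der j x -
      ((3 * u.der 0 1 - u.der 1 1) * (ofPolynomial 4 (.X ^ 2)).der j x +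
        (u.der 1 1 - 2 * u.der 0 1) * (ofPolynomial 4 (.X ^ 3)).der j x) := rfl

lemma clamped_clampRight {u : CkFun 4} (h₀ : u.der 0 0 = 0) (h₁ : u.der 1 0 = 0) :
    (clampRight u).Clamped where
  left := by simp [der_clampRight, der_ofPolynomial, h₀]
  left' := by simp [der_clampRight, der_ofPolynomial, h₁]
  right := by simp [der_clampRight, der_ofPolynomial]; ring
  right' := by simp [der_clampRight, der_ofPolynomial]; ring

lemma der_four_clampRight (u : CkFun 4) : (clampRight u).der 4 = u.der 4 :=
  ContinuousMap.ext fun x => by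
    have hpow (n : ℕ) (hn : n < 4) : (ofPolynomial 4 (.X ^ n)).der 4 x = 0 := by
      have : Polynomial.derivative^[4] (.X ^ n : Polynomial ℝ) = 0 :=
        Polynomial.iterate_derivative_eq_zero (by simpa using hn)
      exact (congrArg (Polynomial.eval _) this).trans Polynomial.eval_zero
    rw [der_clampRight, hpow 2 (by norm_num), hpow 3 (by norm_num)]
    simp only [mul_zero, add_zero, sub_zero]

/-- The solution operator of `u'''' = h`, `u(0) = u(1) = u'(0) = u'(1) = 0`. -/
noncomputable def green : C(unitInterval, ℝ) →L[ℝ] CkFun 4 :=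
  clampRight ∘L antideriv 3 ∘L antideriv 2 ∘L antideriv 1 ∘L antideriv 0 ∘L ofContinuousMap

lemma green_clamped (h : C(unitInterval, ℝ)) : (green h).Clamped :=
  clamped_clampRight (primitive_zero _) (primitive_zero _)

lemma green_der_four (h : C(unitInterval, ℝ)) : (green h).der 4 = h := der_four_clampRight _

lemma fn_eq_der {u : CkFun k} {i : ℕ} (hi : i < k + 1) {x : ℝ} (hx : x ∈ Icc (0 : ℝ) 1) :
    u.fn i x = u.der ⟨i, hi⟩ ⟨x, hx⟩ := u.fn_coe ⟨i, hi⟩ ⟨x, hx⟩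

namespace Clamped

variable {u v : CkFun 4}

lemma fn_left (h : u.Clamped) : u.fn 0 0 = 0 := (u.fn_coe 0 0).trans h.left

lemma fn_right (h : u.Clamped) : u.fn 0 1 = 0 := (u.fn_coe 0 1).trans h.right

lemma fn_left' (h : u.Clamped) : u.fn 1 0 = 0 := (u.fn_coe 1 0).trans h.left'

lemma fn_right' (h : u.Clamped) : u.fn 1 1 = 0 := (u.fn_coe 1 1).trans h.right'

lemma ext (hu : u.Clamped) (hv : v.Clamped) (h : u.der 4 = v.der 4) : u = v := by
  set w : ℕ → ℝ → ℝ := fun i t => u.fn i t - v.fn i t with hw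
  have ch : DerivChain 4 0 1 w := u.derivChain.sub v.derivChain
  have w00 : w 0 0 = 0 := by simp only [hw, hu.fn_left, hv.fn_left, sub_zero]
  have w10 : w 1 0 = 0 := by simp only [hw, hu.fn_left', hv.fn_left', sub_zero]
  have w01 : w 0 1 = 0 := by simp only [hw, hu.fn_right, hv.fn_right, sub_zero]
  have w11 : w 1 1 = 0 := by simp only [hw, hu.fn_right', hv.fn_right', sub_zero]
  have w4 : ∀ t ∈ Icc (0 : ℝ) 1, w 4 t = 0 := fun t ht => by
    rw [hw, sub_eq_zero, fn_eq_der (by norm_num) ht, fn_eq_der (by norm_num) ht]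
    exact congrArg (fun g => g ⟨t, ht⟩) h
  -- `B = w w''' - w' w''` has derivative `-(w'')²` and vanishes at both endpoints.
  set B : ℝ → ℝ := fun t => w 0 t * w 3 t - w 1 t * w 2 t with hB
  have hB' : ∀ t ∈ Icc (0 : ℝ) 1, HasDerivWithinAt B (-(w 2 t) ^ 2) (Icc 0 1) t := fun t ht =>
    (((ch 0 (by norm_num) t ht).mul (ch 3 (by norm_num) t ht)).sub
      ((ch 1 (by norm_num) t ht).mul (ch 2 (by norm_num) t ht))).congr_deriv (by
        rw [w4 t ht]; ring)
  have B0 : B 0 = 0 := by simp only [hB, w00, w10, zero_mul, sub_zero]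
  have B1 : B 1 = 0 := by simp only [hB, w01, w11, zero_mul, sub_zero]
  have hanti := antitoneOn_of_hasDerivWithinAt_Icc hB' fun t _ => neg_nonpos.2 (sq_nonneg _)
  have Bz : ∀ t ∈ Icc (0 : ℝ) 1, B t = 0 := fun t ht =>
    le_antisymm (B0 ▸ hanti (left_mem_Icc.2 zero_le_one) ht ht.1)
      (B1 ▸ hanti ht (right_mem_Icc.2 zero_le_one) ht.2)
  have w2 : ∀ t ∈ Icc (0 : ℝ) 1, w 2 t = 0 := fun t ht =>
    sq_eq_zero_iff.1 (neg_eq_zero.1 (deriv_eq_zero_of_const_Icc one_pos hB' Bz t ht))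
  have w1 := eqOn_of_hasDerivWithinAt_Icc (k := fun _ => 0) (ch 1 (by norm_num))
    (fun t ht => (hasDerivWithinAt_const t _ 0).congr_deriv (w2 t ht).symm) w10
  have w0 := eqOn_of_hasDerivWithinAt_Icc (k := fun _ => 0) (ch 0 (by norm_num))
    (fun t ht => (hasDerivWithinAt_const t _ 0).congr_deriv (w1 t ht).symm) w00
  refine ext_der_zero fun x => ?_
  rw [← u.fn_coe, ← v.fn_coe]
  exact sub_eq_zero.1 (w0 x x.2)

end Clamped

/-- The function `x ↦ u (1 - x)`. -/
noncomputable def reflect (u : CkFun k) : CkFun k :=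
  ⟨fun j => (-1 : ℝ) ^ (j : ℕ) •
      (u.der j).comp ⟨unitInterval.symm, unitInterval.continuous_symm⟩, by
    intro i x
    have hsymm : HasDerivWithinAt (fun t : ℝ => 1 - t) (-1) (Icc 0 1) x :=
      (hasDerivWithinAt_id (x : ℝ) _).const_sub 1
    have hmaps : MapsTo (fun t : ℝ => 1 - t) (Icc 0 1) (Icc 0 1) := fun t ht =>
      ⟨by linarith [ht.2], by linarith [ht.1]⟩
    have hder := (HasDerivWithinAt.comp (x : ℝ) (u.2 i (unitInterval.symm x)) hsymm
      hmaps).const_mul ((-1 : ℝ) ^ (i : ℕ))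
    refine hasDerivWithinAt_IccExtend (hder.congr_deriv ?_) (fun y => ?_)
    · change _ = (-1 : ℝ) ^ ((i : ℕ) + 1) * u.1 i.succ (unitInterval.symm x)
      ring
    · change (-1 : ℝ) ^ (i : ℕ) * u.1 i.castSucc (unitInterval.symm y) = (-1 : ℝ) ^ (i : ℕ) *
        IccExtend zero_le_one (u.1 i.castSucc) ((unitInterval.symm y : unitInterval) : ℝ)
      rw [IccExtend_val]⟩

lemma der_reflect (u : CkFun k) (j : Fin (k + 1)) (x : unitInterval) :
    u.reflect.der j x = (-1 : ℝ) ^ (j : ℕ) * u.der j (unitInterval.symm x) := rfl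

lemma der_symm_of_reflect {u : CkFun k} (hu : u.reflect = u) (j : Fin (k + 1))
    (x : unitInterval) : (-1 : ℝ) ^ (j : ℕ) * u.der j (unitInterval.symm x) = u.der j x := by
  rw [← der_reflect, hu]

lemma der_zero_symm {u : CkFun k} (hu : u.reflect = u) (x : unitInterval) :
    u.der 0 (unitInterval.symm x) = u.der 0 x := by
  simpa using der_symm_of_reflect hu 0 x

lemma Clamped.reflect {u : CkFun 4} (hu : u.Clamped) : u.reflect.Clamped where
  left := by simp [der_reflect, hu.right]
  right := by simp [der_reflect, hu.left]
  left' := by simp [der_reflect, hu.right']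
  right' := by simp [der_reflect, hu.left']

lemma Clamped.reflect_eq {u : CkFun 4} (hu : u.Clamped)
    (h : ∀ x, u.der 4 (unitInterval.symm x) = u.der 4 x) : u.reflect = u := by
  refine hu.reflect.ext hu (ContinuousMap.ext fun x => ?_)
  rw [der_reflect, h, show ((4 : Fin 5) : ℕ) = 4 from rfl]
  norm_num

end CkFun

lemma symm_midpt : unitInterval.symm midpt = midpt :=
  Subtype.ext (by rw [unitInterval.coe_symm_eq]; norm_num [midpt])

lemma half_add_mem {t : ℝ} (ht : t ∈ Icc (0 : ℝ) (1 / 2)) : 1 / 2 + t ∈ Icc (0 : ℝ) 1 :=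
  ⟨by linarith [ht.1], by linarith [ht.2]⟩

lemma abs_sub_half_mem (x : unitInterval) : |(x : ℝ) - 1 / 2| ∈ Icc (0 : ℝ) (1 / 2) :=
  ⟨abs_nonneg _, abs_le.2 ⟨by linarith [x.2.1], by linarith [x.2.2]⟩⟩

namespace CkFun

variable {k : ℕ} {u : CkFun k}

/-- The derivatives of `u` on the right half of `[0,1]`, in the variable `t = x - 1/2`. -/
noncomputable def half (u : CkFun k) (i : ℕ) (t : ℝ) : ℝ := u.fn i (1 / 2 + t)

lemma half_chain (u : CkFun k) : DerivChain k 0 (1 / 2) u.half := by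
  have := u.derivChain.comp_affine (a' := 0) (b' := 1 / 2) (x := 1 / 2) (c := 1)
    (fun t ht => by rw [one_mul]; exact half_add_mem ht)
  simp only [one_pow, one_mul] at this
  exact this

lemma half_eq_der {i : ℕ} (hi : i < k + 1) {t : ℝ} (ht : t ∈ Icc (0 : ℝ) (1 / 2)) :
    u.half i t = u.der ⟨i, hi⟩ ⟨1 / 2 + t, half_add_mem ht⟩ := fn_eq_der hi _

lemma half_sub_half (i : Fin (k + 1)) (x : unitInterval) :
    u.half i ((x : ℝ) - 1 / 2) = u.der i x := by
  rw [half, add_sub_cancel]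
  exact u.fn_coe i x

lemma half_zero (i : Fin (k + 1)) : u.half i 0 = u.der i midpt := by
  rw [← half_sub_half, midpt, sub_self]

lemma half_zero_of_odd (hu : u.reflect = u) {i : ℕ} (hi : i < k + 1) (hodd : Odd i) :
    u.half i 0 = 0 := by
  have h := der_symm_of_reflect hu ⟨i, hi⟩ midpt
  rw [symm_midpt, hodd.neg_one_pow] at h
  rw [show u.half i 0 = _ from half_zero ⟨i, hi⟩]
  linarith

lemma der_eq_half_abs (hu : u.reflect = u) (j : Fin (k + 1)) (x : unitInterval) :
    u.der j x = u.half j |(x : ℝ) - 1 / 2| ∨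
      u.der j x = (-1) ^ (j : ℕ) * u.half j |(x : ℝ) - 1 / 2| := by
  rcases le_total (1 / 2) (x : ℝ) with h | h
  · rw [abs_of_nonneg (by linarith), half_sub_half]
    exact .inl rfl
  · rw [abs_of_nonpos (by linarith), ← der_symm_of_reflect hu j x, ← half_sub_half,
      unitInterval.coe_symm_eq, show 1 - (x : ℝ) - 1 / 2 = -(x - 1 / 2) by ring]
    exact .inr rfl

lemma der_eq_half_abs_of_even (hu : u.reflect = u) {j : Fin (k + 1)} (hj : Even (j : ℕ))
    (x : unitInterval) : u.der j x = u.half j |(x : ℝ) - 1 / 2| := by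
  simpa only [hj.neg_one_pow, one_mul, or_self] using der_eq_half_abs hu j x

lemma der_zero_eq_half_abs (hu : u.reflect = u) (x : unitInterval) :
    u.der 0 x = u.half 0 |(x : ℝ) - 1 / 2| := der_eq_half_abs_of_even hu (by simp) x

lemma abs_der_eq_abs_half (hu : u.reflect = u) (j : Fin (k + 1)) (x : unitInterval) :
    |u.der j x| = |u.half j (|(x : ℝ) - 1 / 2|)| := by
  rcases der_eq_half_abs hu j x with h | h
  · rw [h]
  · rw [h, abs_mul, abs_neg_one_pow, one_mul]

lemma Clamped.half_end {u : CkFun 4} (hu : u.Clamped) : u.half 0 (1 / 2) = 0 := by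
  rw [half, add_halves, hu.fn_right]

lemma Clamped.half_deriv_end {u : CkFun 4} (hu : u.Clamped) : u.half 1 (1 / 2) = 0 := by
  rw [half, add_halves, hu.fn_right']

end CkFun

/-- The folding map `x ↦ max x (1 - x)` of `[0,1]` onto its right half. -/
noncomputable def foldMap : C(unitInterval, unitInterval) :=
  ⟨fun x => max x (unitInterval.symm x), continuous_id.max unitInterval.continuous_symm⟩

lemma foldMap_symm (x : unitInterval) : foldMap (unitInterval.symm x) = foldMap x := by
  change max (unitInterval.symm x) (unitInterval.symm (unitInterval.symm x)) = _
  rw [unitInterval.symm_symm, max_comm]; rfl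

lemma foldMap_of_le {x : unitInterval} (h : (1 / 2 : ℝ) ≤ x) : foldMap x = x :=
  max_eq_left (Subtype.coe_le_coe.1 (by rw [unitInterval.coe_symm_eq]; linarith))

lemma CkFun.der_zero_foldMap {k : ℕ} {u : CkFun k} (hu : u.reflect = u) (x : unitInterval) :
    u.der 0 (foldMap x) = u.der 0 x := by
  rcases max_choice x (unitInterval.symm x) with h | h
  · exact congrArg _ h
  · exact (congrArg _ h).trans (der_zero_symm hu x)

/-- The Green operator applied to the even extension about `1/2` of the right half of the
right-hand side; its values are symmetric whatever the right-hand side is. -/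
noncomputable def symGreen : C(unitInterval, ℝ) →L[ℝ] CkFun 4 :=
  CkFun.green ∘L
    { toLinearMap := (ContinuousMap.compRightAlgHom ℝ ℝ foldMap).toLinearMap
      cont := ContinuousMap.continuous_precomp foldMap }

section SymGreen

variable {h : C(unitInterval, ℝ)}

lemma symGreen_clamped (h : C(unitInterval, ℝ)) : (symGreen h).Clamped := CkFun.green_clamped _

lemma symGreen_der_four (h : C(unitInterval, ℝ)) (x : unitInterval) :
    (symGreen h).der 4 x = h (foldMap x) :=
  congrArg (fun g : C(unitInterval, ℝ) => g x) (CkFun.green_der_four (h.comp foldMap))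

lemma symGreen_reflect (h : C(unitInterval, ℝ)) : (symGreen h).reflect = symGreen h :=
  (symGreen_clamped h).reflect_eq fun x => by
    rw [symGreen_der_four, symGreen_der_four, foldMap_symm]

lemma symGreen_half_four {t : ℝ} (ht : t ∈ Icc (0 : ℝ) (1 / 2)) :
    (symGreen h).half 4 t = h ⟨1 / 2 + t, half_add_mem ht⟩ := by
  have hfold := symGreen_der_four h ⟨1 / 2 + t, half_add_mem ht⟩
  rw [foldMap_of_le (le_add_of_nonneg_right ht.1)] at hfold
  exact (CkFun.half_eq_der (by norm_num) ht).trans hfold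

lemma symGreen_half_antitoneOn (h0 : ∀ x : unitInterval, (1 / 2 : ℝ) ≤ x → 0 ≤ h x) :
    AntitoneOn ((symGreen h).half 0) (Icc 0 (1 / 2)) := by
  have ch := (symGreen h).half_chain
  have hr := symGreen_reflect h
  have h4 : ∀ t ∈ Icc (0 : ℝ) (1 / 2), 0 ≤ (symGreen h).half 4 t := fun t ht => by
    rw [symGreen_half_four ht]
    exact h0 _ (le_add_of_nonneg_right ht.1)
  have h3 : ∀ t ∈ Icc (0 : ℝ) (1 / 2), 0 ≤ (symGreen h).half 3 t := fun t ht =>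
    (CkFun.half_zero_of_odd hr (by norm_num) (by decide)).symm.le.trans
      (ch.left_le_of_deriv_nonneg (i := 3) (by norm_num) h4 ht)
  have h1 : ∀ t ∈ Icc (0 : ℝ) (1 / 2), (symGreen h).half 1 t ≤ 0 := fun t ht =>
    nonpos_of_convexOn_Icc (ch.convexOn (i := 1) (by norm_num) h3)
      (CkFun.half_zero_of_odd hr (by norm_num) odd_one).le (symGreen_clamped h).half_deriv_end.le ht
  exact ch.antitoneOn (i := 0) (by norm_num) h1

lemma symGreen_nonneg (h0 : ∀ x : unitInterval, (1 / 2 : ℝ) ≤ x → 0 ≤ h x) (x : unitInterval) :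
    0 ≤ (symGreen h).der 0 x := by
  have hm := abs_sub_half_mem x
  rw [CkFun.der_zero_eq_half_abs (symGreen_reflect h) x, ← (symGreen_clamped h).half_end]
  exact symGreen_half_antitoneOn h0 hm (right_mem_Icc.2 (by norm_num)) hm.2

lemma symGreen_le_midpt (h0 : ∀ x : unitInterval, (1 / 2 : ℝ) ≤ x → 0 ≤ h x) (x : unitInterval) :
    (symGreen h).der 0 x ≤ (symGreen h).der 0 midpt := by
  have hm := abs_sub_half_mem x
  rw [CkFun.der_zero_eq_half_abs (symGreen_reflect h) x, ← CkFun.half_zero]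
  exact symGreen_half_antitoneOn h0 (left_mem_Icc.2 (by norm_num)) hm hm.1

lemma symGreen_midpt_pos (h0 : ∀ x : unitInterval, (1 / 2 : ℝ) ≤ x → 0 ≤ h x) (hp : 0 < h midpt) :
    0 < (symGreen h).der 0 midpt := by
  refine lt_of_le_of_ne (symGreen_nonneg h0 midpt) fun hz => ?_
  have hu : symGreen h = 0 := CkFun.ext_der_zero fun x =>
    le_antisymm ((symGreen_le_midpt h0 x).trans hz.symm.le) (symGreen_nonneg h0 x)
  have h4 := symGreen_der_four h midpt
  rw [hu, foldMap_of_le le_rfl] at h4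
  exact hp.ne h4

end SymGreen

namespace CkFun

variable {k : ℕ}

lemma norm_der_le (u : CkFun k) (j : Fin (k + 1)) : ‖u.der j‖ ≤ ‖u‖ := norm_le_pi_norm u.1 j

lemma lipschitzWith_der (u : CkFun k) (i : Fin k) {K : NNReal}
    (hK : ∀ x, |u.der i.succ x| ≤ K) : LipschitzWith K (u.der i.castSucc) := by
  refine LipschitzWith.of_dist_le_mul fun x y => ?_
  have := Convex.norm_image_sub_le_of_norm_hasDerivWithin_le (u.derivChain i i.2)
    (fun t ht => by rw [fn_eq_der (Nat.succ_lt_succ i.2) ht]; exact hK ⟨t, ht⟩)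
    (convex_Icc 0 1) y.2 x.2
  rw [fn_eq_der (i.2.trans k.lt_succ_self) x.2, fn_eq_der (i.2.trans k.lt_succ_self) y.2] at this
  exact this

lemma isCompactOperator_derCLM (i : Fin k) : IsCompactOperator (derCLM k i.castSucc) := by
  refine (isCompactOperator_iff_exists_mem_nhds_image_subset_compact _).2
    ⟨Metric.closedBall 0 1, Metric.closedBall_mem_nhds 0 one_pos, ?_⟩
  let e := ContinuousMap.isometryEquivBoundedOfCompact unitInterval ℝ
  let A : Set (BoundedContinuousFunction unitInterval ℝ) :=
    {g | LipschitzWith 1 g ∧ ∀ x, g x ∈ Icc (-1 : ℝ) 1}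
  have hA : IsCompact (closure A) :=
    BoundedContinuousFunction.arzela_ascoli (Icc (-1) 1) isCompact_Icc A (fun g x hg => hg.2 x)
      (LipschitzWith.uniformEquicontinuous _ 1 (fun g => g.2.1)).equicontinuous
  refine ⟨e.symm '' closure A, hA.image e.symm.continuous, ?_⟩
  rintro _ ⟨u, hu, rfl⟩
  have hbound : ∀ j x, |u.der j x| ≤ 1 := fun j x =>
    ((u.der j).norm_coe_le_norm x).trans ((u.norm_der_le j).trans (mem_closedBall_zero_iff.1 hu))
  exact ⟨e (u.der i.castSucc),
    subset_closure ⟨u.lipschitzWith_der i (hbound i.succ), fun x => abs_le.1 (hbound _ x)⟩,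
    e.symm_apply_apply _⟩

end CkFun

section Superposition

variable {K : Type*} [TopologicalSpace K] [CompactSpace K]

lemma hasFDerivAt_comp_continuousMap {g g' : C(ℝ, ℝ)} (hg : ∀ x, HasDerivAt g (g' x) x)
    (u : C(K, ℝ)) : HasFDerivAt (fun u : C(K, ℝ) => g.comp u)
      (ContinuousLinearMap.mul ℝ C(K, ℝ) (g'.comp u)) u := by
  refine .of_isLittleO (Asymptotics.isLittleO_iff.2 fun c hc => ?_)
  have hunif := (isCompact_range u.continuous).uniformContinuousAt_of_continuousAt g'
    (fun a _ => g'.continuous.continuousAt) (Metric.dist_mem_uniformity hc)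
  obtain ⟨δ, hδ, hunifδ⟩ := Metric.mem_uniformity_dist.1 hunif
  filter_upwards [Metric.ball_mem_nhds u hδ] with v hv
  rw [ContinuousMap.norm_le _ (by positivity)]
  intro x
  have hvx : ‖v x - u x‖ ≤ ‖v - u‖ := (v - u).norm_coe_le_norm x
  have hlt : ‖v - u‖ < δ := by rwa [← dist_eq_norm]
  have hmvt := (convex_closedBall (u x) ‖v x - u x‖).norm_image_sub_le_of_norm_hasDerivWithin_le
    (f := fun y => g y - g' (u x) * y) (f' := fun y => g' y - g' (u x) * 1) (C := c)
    (x := u x) (y := v x)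
    (fun y _ => ((hg y).sub ((hasDerivAt_id y).const_mul _)).hasDerivWithinAt)
    (fun y hy => by
      rw [mul_one, ← dist_eq_norm, dist_comm]
      refine le_of_lt (hunifδ ?_ (mem_range_self x))
      rw [dist_comm]
      exact (Metric.mem_closedBall.1 hy).trans_lt (hvx.trans_lt hlt))
    (Metric.mem_closedBall_self (norm_nonneg _)) (by simp [dist_eq_norm])
  calc ‖(g.comp v - g.comp u - ContinuousLinearMap.mul ℝ C(K, ℝ) (g'.comp u) (v - u)) x‖
      = ‖g (v x) - g' (u x) * v x - (g (u x) - g' (u x) * u x)‖ := by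
        congr 1
        change g (v x) - g (u x) - g' (u x) * (v x - u x) = _
        ring
    _ ≤ c * ‖v x - u x‖ := hmvt
    _ ≤ c * ‖v - u‖ := mul_le_mul_of_nonneg_left hvx hc.le

lemma contDiff_comp_continuousMap (n : ℕ) :
    ∀ g : C(ℝ, ℝ), ContDiff ℝ n g → ContDiff ℝ n (fun u : C(K, ℝ) => g.comp u) := by
  induction n with
  | zero => exact fun g _ => contDiff_zero.2 (ContinuousMap.continuous_postcomp g)
  | succ n ih =>
    intro g hg
    push_cast at hg ⊢
    obtain ⟨hd, -, hc⟩ := contDiff_succ_iff_deriv.1 hg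
    set g' : C(ℝ, ℝ) := ⟨deriv g, hc.continuous⟩
    have hmul : ContDiff ℝ n (fun w : C(K, ℝ) => ContinuousLinearMap.mul ℝ C(K, ℝ) w) :=
      ContinuousLinearMap.contDiff (E := C(K, ℝ)) (F := C(K, ℝ) →L[ℝ] C(K, ℝ)) _
    exact contDiff_succ_iff_hasFDerivAt.2
      ⟨fun u => ContinuousLinearMap.mul ℝ C(K, ℝ) (g'.comp u), hmul.comp (ih g' hc),
        hasFDerivAt_comp_continuousMap fun x => (hd x).hasDerivAt⟩

end Superposition

lemma contDiff_two_of_hasDerivAt {F F₁ F₂ : ℝ → ℝ} (h1 : ∀ x, HasDerivAt F (F₁ x) x)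
    (h2 : ∀ x, HasDerivAt F₁ (F₂ x) x) (hc : Continuous F₂) : ContDiff ℝ 2 F := by
  have e1 : deriv F = F₁ := funext fun x => (h1 x).deriv
  have e2 : deriv F₁ = F₂ := funext fun x => (h2 x).deriv
  rw [show (2 : WithTop ℕ∞) = 1 + 1 from rfl, contDiff_succ_iff_deriv, e1,
    contDiff_one_iff_deriv, e2]
  exact ⟨fun x => (h1 x).differentiableAt, by simp, fun x => (h2 x).differentiableAt, hc⟩

lemma exists_contDiff_two_extension {f : ℝ → ℝ} {a b : ℝ} (hab : a < b)
    (hf : ContDiffOn ℝ 2 f (Icc a b)) :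
    ∃ F : ℝ → ℝ, ContDiff ℝ 2 F ∧ EqOn F f (Icc a b) := by
  have hu := uniqueDiffOn_Icc hab
  obtain ⟨hd, -, hf1⟩ := (contDiffOn_succ_iff_derivWithin (n := 1) hu).1 hf
  obtain ⟨hd1, -, hf2⟩ := (contDiffOn_succ_iff_derivWithin (n := 0) hu).1 hf1
  set f₁ := derivWithin f (Icc a b)
  set f₂ := derivWithin f₁ (Icc a b)
  set e : ℝ → ℝ := IccExtend hab.le ((Icc a b).domRestrict f₂) with he
  have hec : Continuous e :=
    (continuousOn_iff_continuous_domRestrict.1 hf2.continuousOn).Icc_extend'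
  set F₁ : ℝ → ℝ := fun x => f₁ a + ∫ t in a..x, e t with hF₁
  have h2 : ∀ x, HasDerivAt F₁ (e x) x := fun x =>
    ((hec.integral_hasStrictDerivAt a x).hasDerivAt).const_add _
  have hF₁c : Continuous F₁ := continuous_iff_continuousAt.2 fun x => (h2 x).continuousAt
  set F : ℝ → ℝ := fun x => f a + ∫ t in a..x, F₁ t with hF
  have h1 : ∀ x, HasDerivAt F (F₁ x) x := fun x =>
    ((hF₁c.integral_hasStrictDerivAt a x).hasDerivAt).const_add _
  refine ⟨F, contDiff_two_of_hasDerivAt h1 h2 hec, ?_⟩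
  have e1 : ∀ t ∈ Icc a b, F₁ t = f₁ t := eqOn_of_hasDerivWithinAt_Icc
    (fun t _ => (h2 t).hasDerivWithinAt)
    (fun t ht => by
      rw [he, IccExtend_of_mem _ _ ht]
      exact (hd1 t ht).hasDerivWithinAt) (by simp [hF₁])
  exact eqOn_of_hasDerivWithinAt_Icc (fun t _ => (h1 t).hasDerivWithinAt)
    (fun t ht => by
      rw [e1 t ht]
      exact (hd t ht).hasDerivWithinAt) (by simp [hF])

lemma isConvexSource_of_contDiffOn {f : ℝ → ℝ} {r : ℝ}
    (hf : ContDiffOn ℝ 2 f (Ico 0 r)) (hpos : ∀ u ∈ Ico 0 r, 0 < f u)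
    (hinc : ∀ u ∈ Ioo 0 r, 0 < deriv f u) (hconv : ∀ u ∈ Ioo 0 r, 0 < deriv (deriv f) u) :
    IsConvexSource r f (derivWithin f (Ico 0 r)) where
  pos := hpos
  strictMonoOn :=
    strictMonoOn_of_deriv_pos (convex_Ico 0 r) hf.continuousOn (by rwa [interior_Ico])
  strictConvexOn :=
    strictConvexOn_of_deriv2_pos (convex_Ico 0 r) hf.continuousOn (by rwa [interior_Ico])
  hasDeriv x hx := (hf.differentiableOn (by norm_num) x hx).hasDerivWithinAt

namespace DerivChain

variable {n k : ℕ} {a b T L : ℝ} {v w : ℕ → ℝ → ℝ} {q : ℝ → ℝ}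

lemma nonneg_of_linear (h : DerivChain n 0 T w) (hn : 0 < n) (hL : 0 ≤ L)
    (hq : ∀ t ∈ Icc 0 T, q t ∈ Icc 0 L) (hode : ∀ t ∈ Icc 0 T, w n t = q t * w 0 t)
    (h0 : ∀ i < n, 0 ≤ w i 0) : ∀ t ∈ Icc 0 T, 0 ≤ w 0 t := by
  refine h.nonneg_of_ivp hn hL h0 fun t ht => ?_
  rw [hode t ht]
  rcases le_total 0 (w 0 t) with hw | hw
  · rw [min_eq_right hw, mul_zero]
    exact mul_nonneg (hq t ht).1 hw
  · rw [min_eq_left hw]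
    exact mul_le_mul_of_nonpos_right (hq t ht).2 hw

lemma eq_zero_of_linear (h : DerivChain n 0 T w) (hT : 0 < T) (hL : 0 ≤ L)
    (hq : ∀ t ∈ Icc 0 T, q t ∈ Icc 0 L) (hode : ∀ t ∈ Icc 0 T, w n t = q t * w 0 t)
    (hk : k ∈ Ico 1 n) (h0 : ∀ i < n, i ≠ k → w i 0 = 0) (hend : w 0 T = 0) :
    ∀ t ∈ Icc 0 T, w 0 t = 0 := by
  have hn : 0 < n := k.zero_le.trans_lt hk.2
  have hode' : ∀ t ∈ Icc 0 T, -w n t = q t * -w 0 t := fun t ht => by rw [hode t ht, mul_neg]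
  have hk0 : w k 0 = 0 := by
    wlog hwk : 0 ≤ w k 0 generalizing w
    · simpa using this h.neg (by simpa using hode') (by simpa using h0) (by simpa using hend)
        (by simpa using hode) (by simpa using (not_le.1 hwk).le)
    have hinit : ∀ i < n, 0 ≤ w i 0 := fun i hi => by
      rcases eq_or_ne i k with rfl | hik
      exacts [hwk, (h0 i hi hik).ge]
    have hw0 := h.nonneg_of_linear hn hL hq hode hinit
    by_contra hne
    have hlt := (h.lt_and_deriv_pos_of_init hT
      (fun t ht => (hode t ht).symm ▸ mul_nonneg (hq t ht).1 (hw0 t ht))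
      (fun i hi => hinit i hi.2) ⟨k, hk, hne⟩).1
    exact (hw0 0 (left_mem_Icc.2 hT.le)).not_gt (hend ▸ hlt)
  have hinit : ∀ i < n, w i 0 = 0 := fun i hi => by
    rcases eq_or_ne i k with rfl | hik
    exacts [hk0, h0 i hi hik]
  exact fun t ht => le_antisymm
    (neg_nonneg.1 (h.neg.nonneg_of_linear hn hL hq hode'
      (by simpa using fun i hi => (hinit i hi).le) t ht))
    (h.nonneg_of_linear hn hL hq hode (fun i hi => (hinit i hi).ge) t ht)

lemma update (h : DerivChain n a b v)
    (hq : ∀ t ∈ Icc a b, HasDerivWithinAt (v n) (q t) (Icc a b) t) :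
    DerivChain (n + 1) a b (Function.update v (n + 1) q) := fun i hi t ht => by
  rw [Function.update_of_ne (by omega)]
  rcases (Nat.lt_succ_iff.1 hi).eq_or_lt with rfl | hin
  · simpa using hq t ht
  · rw [Function.update_of_ne (by omega)]
    exact h i hin t ht

-- The derivative at `c = 1` of the dilations `c ^ i * v i (c * t)`.
lemma dilation (h : DerivChain (n + 1) a b v) :
    DerivChain n a b (fun i t => t * v (i + 1) t + i * v i t) := fun i hi t ht => by
  refine (((hasDerivWithinAt_id t (Icc a b)).mul (h (i + 1) (by omega) t ht)).add
    ((h i (by omega) t ht).const_mul (i : ℝ))).congr_deriv ?_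
  simp only [id, Nat.cast_add, Nat.cast_one]
  ring

end DerivChain

lemma IsProfile.linearized_eq_zero {f f' : ℝ → ℝ} {p T L η : ℝ} {v Z : ℕ → ℝ → ℝ}
    (hv : IsProfile f p T v) (hf : ∀ x ∈ Icc 0 p, 0 < f x)
    (hd : ∀ x ∈ Icc 0 p, HasDerivWithinAt f (f' x) (Icc 0 p) x)
    (hf' : ∀ x ∈ Icc 0 p, f' x ∈ Icc 0 L) (hv3 : v 3 0 = 0) (hZ : DerivChain 4 0 T Z)
    (hode : ∀ t ∈ Icc 0 T, Z 4 t = f' (v 0 t) * Z 0 t - η * f (v 0 t))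
    (z0 : Z 0 0 = 0) (z1 : Z 1 0 = 0) (z3 : Z 3 0 = 0) (zT : Z 0 T = 0) (zT' : Z 1 T = 0) :
    ∀ t ∈ Icc 0 T, Z 0 t = 0 := by
  have hvm : MapsTo (v 0) (Icc 0 T) (Icc 0 p) := fun t ht => ⟨hv.nonneg t ht, hv.le t ht⟩
  -- The dilation direction `S` solves the linearized equation with right-hand side `4 f(v)`, so
  -- that `Z + (η / 4) S` solves the homogeneous one.
  have hS := (hv.chain.update (q := fun t => f' (v 0 t) * v 1 t) fun t ht =>
    ((hd _ (hvm ht)).comp t (hv.chain 0 (by norm_num) t ht) hvm).congr hv.eqn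
      (hv.eqn t ht)).dilation
  set y : ℕ → ℝ → ℝ := fun i t => Z i t + η / 4 *
    (t * Function.update v 5 (fun t => f' (v 0 t) * v 1 t) (i + 1) t +
      i * Function.update v 5 (fun t => f' (v 0 t) * v 1 t) i t) with hy
  have hy_chain : DerivChain 4 0 T y := hZ.add (hS.const_mul (η / 4))
  have hy_ode : ∀ t ∈ Icc 0 T, y 4 t = f' (v 0 t) * y 0 t := fun t ht => by
    simp only [hy, Function.update_apply, Nat.reduceEqDiff, hode t ht, ↓reduceIte, Nat.cast_ofNat,
      hv.eqn t ht, OfNat.zero_ne_ofNat, zero_add, CharP.cast_eq_zero, zero_mul, add_zero]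
    ring
  have hy_zero : ∀ t ∈ Icc 0 T, y 0 t = 0 := by
    refine hy_chain.eq_zero_of_linear (k := 2) hv.T_pos
      ((hf' p (right_mem_Icc.2 hv.p_pos.le)).1.trans (hf' p (right_mem_Icc.2 hv.p_pos.le)).2)
      (fun t ht => hf' _ (hvm ht)) hy_ode (by simp) (fun i hi hi2 => ?_) ?_
    · interval_cases i <;>
        simp_all [Function.update_apply, hv.deriv_zero]
    · simp [hy, Function.update_apply, zT, hv.deriv_end]
  have hη : η = 0 := by
    have h1 := hy_chain.deriv_eq_zero_of_const hv.T_pos (by norm_num) hy_zero T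
      (right_mem_Icc.2 hv.T_pos.le)
    simpa [hy, Function.update_apply, zT', hv.deriv_end, hv.T_pos.ne',
      (hv.second_deriv_end_pos hf hv3).ne'] using h1
  exact fun t ht => by simpa [hy, hη] using hy_zero t ht

/-- The symmetrized Green operator on continuous functions. -/
noncomputable def greenOp : C(unitInterval, ℝ) →L[ℝ] C(unitInterval, ℝ) :=
  CkFun.derCLM 4 0 ∘L symGreen

lemma greenOp_apply (h : C(unitInterval, ℝ)) : greenOp h = (symGreen h).der 0 := rfl

lemma isCompactOperator_greenOp : IsCompactOperator greenOp :=
  (CkFun.isCompactOperator_derCLM 0).comp_clm symGreen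

/-- The value at the midpoint of the symmetrized solution of `w'''' = F ∘ u`. -/
noncomputable def midGreen (F : C(ℝ, ℝ)) (u : C(unitInterval, ℝ)) : ℝ := greenOp (F.comp u) midpt

/-- The map whose zeros `(p, u)` with `midGreen F u ≠ 0` are the solutions `u` of
`u = lam • greenOp (F ∘ u)`, `u(1/2) = p`, the parameter `lam` having been eliminated by evaluating
at the midpoint. -/
noncomputable def branchEq (F : C(ℝ, ℝ)) (q : ℝ × C(unitInterval, ℝ)) : C(unitInterval, ℝ) :=
  midGreen F q.2 • q.2 - q.1 • greenOp (F.comp q.2)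

/-- `u` solves the symmetrized boundary value problem, for some parameter, with maximum `p`. -/
structure IsBranchPoint (F : C(ℝ, ℝ)) (p : ℝ) (u : C(unitInterval, ℝ)) : Prop where
  nonneg : ∀ x, 0 ≤ u x
  le : ∀ x, u x ≤ p
  eqn : branchEq F (p, u) = 0

/-- The parameter of a branch point. -/
noncomputable def branchParam (F : C(ℝ, ℝ)) (p : ℝ) (u : C(unitInterval, ℝ)) : ℝ := p / midGreen F u

/-- The branch point `u` as an element of `C^4[0,1]`. -/
noncomputable def branchSol (F : C(ℝ, ℝ)) (p : ℝ) (u : C(unitInterval, ℝ)) : CkFun 4 :=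
  symGreen (branchParam F p u • F.comp u)

/-- A nonlinearity on the whole line that is admissible on `[0, R]`. -/
structure IsGlobalSource (R : ℝ) (F : C(ℝ, ℝ)) : Prop where
  R_pos : 0 < R
  contDiff : ContDiff ℝ 2 F
  pos : ∀ x ∈ Icc 0 R, 0 < F x
  monotoneOn : MonotoneOn F (Icc 0 R)

section Branch

variable {F F' : C(ℝ, ℝ)} {p R : ℝ} {u : C(unitInterval, ℝ)}

lemma contDiff_midGreen (hF : ContDiff ℝ 2 F) : ContDiff ℝ 2 (midGreen F) :=
  ((ContinuousMap.evalCLM ℝ midpt) ∘L greenOp).contDiff.comp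
    (contDiff_comp_continuousMap 2 F hF)

lemma contDiff_branchEq (hF : ContDiff ℝ 2 F) : ContDiff ℝ 2 (branchEq F) :=
  (((contDiff_midGreen hF).comp contDiff_snd).smul contDiff_snd).sub
    (contDiff_fst.smul (greenOp.contDiff.comp
      ((contDiff_comp_continuousMap 2 F hF).comp contDiff_snd)))

lemma midGreen_pos_of_comp_pos (h : ∀ x, 0 < F (u x)) : 0 < midGreen F u :=
  symGreen_midpt_pos (fun x _ => (h x).le) (h midpt)

lemma eq_smul_of_branchEq (h : branchEq F (p, u) = 0) (h0 : midGreen F u ≠ 0) :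
    u = branchParam F p u • greenOp (F.comp u) := by
  have h1 : midGreen F u • u = p • greenOp (F.comp u) := sub_eq_zero.1 h
  rw [branchParam, div_eq_inv_mul, mul_smul, ← h1, smul_smul, inv_mul_cancel₀ h0, one_smul]

lemma isBranchPoint_of_branchEq (hp : 0 ≤ p) (hpos : ∀ x, 0 < F (u x))
    (h : branchEq F (p, u) = 0) : IsBranchPoint F p u := by
  have hm := midGreen_pos_of_comp_pos hpos
  have hu : ∀ x, u x = branchParam F p u * greenOp (F.comp u) x :=
    fun x => DFunLike.congr_fun (eq_smul_of_branchEq h hm.ne') x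
  have hl : 0 ≤ branchParam F p u := div_nonneg hp hm.le
  refine ⟨fun x => ?_, fun x => ?_, h⟩
  · rw [hu]
    exact mul_nonneg hl (symGreen_nonneg (fun x _ => (hpos x).le) x)
  · calc u x = branchParam F p u * greenOp (F.comp u) x := hu x
      _ ≤ branchParam F p u * midGreen F u :=
          mul_le_mul_of_nonneg_left (symGreen_le_midpt (fun x _ => (hpos x).le) x) hl
      _ = p := div_mul_cancel₀ _ hm.ne'

lemma isBranchPoint_zero (F : C(ℝ, ℝ)) : IsBranchPoint F 0 0 :=
  ⟨fun _ => le_rfl, fun _ => le_rfl, by simp [branchEq]⟩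

lemma isClosed_setOf_isBranchPoint (hF : ContDiff ℝ 2 F) :
    IsClosed {q : ℝ × C(unitInterval, ℝ) | IsBranchPoint F q.1 q.2} := by
  have heq : {q : ℝ × C(unitInterval, ℝ) | IsBranchPoint F q.1 q.2} =
      (⋂ x : unitInterval, {q : ℝ × C(unitInterval, ℝ) | 0 ≤ q.2 x ∧ q.2 x ≤ q.1}) ∩
        {q | branchEq F q = 0} := by
    ext q
    simp only [mem_ofPred_eq, mem_inter_iff, mem_iInter]
    exact ⟨fun h => ⟨fun x => ⟨h.nonneg x, h.le x⟩, h.eqn⟩,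
      fun h => ⟨fun x => (h.1 x).1, fun x => (h.1 x).2, h.2⟩⟩
  have hev : ∀ x : unitInterval, Continuous fun q : ℝ × C(unitInterval, ℝ) => q.2 x := fun x =>
    (ContinuousMap.evalCLM ℝ x).continuous.comp continuous_snd
  rw [heq]
  refine (isClosed_iInter fun x => ?_).inter
    (isClosed_eq (contDiff_branchEq hF).continuous continuous_const)
  exact (isClosed_le continuous_const (hev x)).inter (isClosed_le (hev x) continuous_fst)

lemma IsGlobalSource.deriv_nonneg (hF : IsGlobalSource R F) (hd : ∀ x, HasDerivAt F (F' x) x)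
    {x : ℝ} (hx : x ∈ Icc 0 R) : 0 ≤ F' x := by
  rw [← (hd x).hasDerivWithinAt.derivWithin (uniqueDiffOn_Icc hF.R_pos x hx)]
  exact hF.monotoneOn.derivWithin_nonneg

lemma IsGlobalSource.exists_hasDerivAt (hF : IsGlobalSource R F) :
    ∃ F' : C(ℝ, ℝ), ∀ x, HasDerivAt F (F' x) x :=
  ⟨⟨deriv F, hF.contDiff.continuous_deriv one_le_two⟩, fun x =>
    (hF.contDiff.differentiable two_ne_zero x).hasDerivAt⟩

namespace IsBranchPoint

lemma mem_Icc (h : IsBranchPoint F p u) (hp : p ≤ R) (x : unitInterval) : u x ∈ Icc 0 R :=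
  ⟨h.nonneg x, (h.le x).trans hp⟩

lemma midGreen_pos (hF : IsGlobalSource R F) (h : IsBranchPoint F p u) (hp : p ≤ R) :
    0 < midGreen F u :=
  midGreen_pos_of_comp_pos fun x => hF.pos _ (h.mem_Icc hp x)

lemma p_nonneg (h : IsBranchPoint F p u) : 0 ≤ p := (h.nonneg 0).trans (h.le 0)

lemma der_zero_branchSol (hF : IsGlobalSource R F) (h : IsBranchPoint F p u) (hp : p ≤ R) :
    (branchSol F p u).der 0 = u := by
  conv_rhs => rw [eq_smul_of_branchEq h.eqn (h.midGreen_pos hF hp).ne', ← map_smul]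
  rfl

lemma midpt_eq (hF : IsGlobalSource R F) (h : IsBranchPoint F p u) (hp : p ≤ R) :
    u midpt = p := by
  have hm := (h.midGreen_pos hF hp).ne'
  have h1 : u midpt = p / midGreen F u * midGreen F u :=
    DFunLike.congr_fun (eq_smul_of_branchEq h.eqn hm) midpt
  rwa [div_mul_cancel₀ _ hm] at h1

lemma branchSol_half_zero (hF : IsGlobalSource R F) (h : IsBranchPoint F p u) (hp : p ≤ R) {t : ℝ}
    (ht : t ∈ Icc (0 : ℝ) (1 / 2)) :
    (branchSol F p u).half 0 t = u ⟨1 / 2 + t, half_add_mem ht⟩ := by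
  rw [CkFun.half_eq_der (by norm_num) ht]
  exact DFunLike.congr_fun (h.der_zero_branchSol hF hp) _

lemma branchSol_half_three (F : C(ℝ, ℝ)) (p : ℝ) (u : C(unitInterval, ℝ)) :
    (branchSol F p u).half 3 0 = 0 :=
  CkFun.half_zero_of_odd (symGreen_reflect _) (by norm_num) (by decide)

lemma isProfile (hF : IsGlobalSource R F) (h : IsBranchPoint F p u) (hp : p ≤ R) (hp0 : 0 < p) :
    IsProfile (fun x => branchParam F p u * F x) p (1 / 2) (branchSol F p u).half where
  T_pos := by norm_num
  p_pos := hp0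
  chain := CkFun.half_chain _
  apply_zero := (CkFun.half_zero 0).trans
    ((DFunLike.congr_fun (h.der_zero_branchSol hF hp) midpt).trans (h.midpt_eq hF hp))
  deriv_zero := CkFun.half_zero_of_odd (symGreen_reflect _) (by norm_num) (by decide)
  apply_end := (symGreen_clamped _).half_end
  deriv_end := (symGreen_clamped _).half_deriv_end
  nonneg t ht := by
    rw [h.branchSol_half_zero hF hp ht]
    exact h.nonneg _
  le t ht := by
    rw [h.branchSol_half_zero hF hp ht]
    exact h.le _
  eqn t ht := by
    rw [h.branchSol_half_zero hF hp ht, branchSol, symGreen_half_four ht]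
    rfl

end IsBranchPoint

end Branch

section Linearization

variable {F F' : C(ℝ, ℝ)} {p R : ℝ} {u z : C(unitInterval, ℝ)}

/-- The operator `z ↦ greenOp (F'(u) z)`. -/
noncomputable def linGreenOp (F' : C(ℝ, ℝ)) (u : C(unitInterval, ℝ)) :
    C(unitInterval, ℝ) →L[ℝ] C(unitInterval, ℝ) :=
  greenOp ∘L ContinuousLinearMap.mul ℝ C(unitInterval, ℝ) (F'.comp u)

lemma linGreenOp_apply : linGreenOp F' u z = greenOp (F'.comp u * z) := rfl

lemma isCompactOperator_linGreenOp : IsCompactOperator (linGreenOp F' u) :=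
  isCompactOperator_greenOp.comp_clm _

/-- The compact part of the derivative of `branchEq F` in `u`. -/
noncomputable def branchDerivCompact (F' : C(ℝ, ℝ)) (p : ℝ) (u : C(unitInterval, ℝ)) :
    C(unitInterval, ℝ) →L[ℝ] C(unitInterval, ℝ) :=
  p • linGreenOp F' u - (ContinuousMap.evalCLM ℝ midpt ∘L linGreenOp F' u).smulRight u

lemma branchDerivCompact_apply :
    branchDerivCompact F' p u z = p • linGreenOp F' u z - linGreenOp F' u z midpt • u := rfl

lemma isCompactOperator_branchDerivCompact : IsCompactOperator (branchDerivCompact F' p u) :=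
  (isCompactOperator_linGreenOp.smul p).sub
    ((isCompactOperator_linGreenOp.clm_comp (ContinuousMap.evalCLM ℝ midpt)).clm_comp
      ((ContinuousLinearMap.id ℝ ℝ).smulRight u))

/-- The derivative of `branchEq F` in `u`. -/
noncomputable def branchDeriv (F F' : C(ℝ, ℝ)) (p : ℝ) (u : C(unitInterval, ℝ)) :
    C(unitInterval, ℝ) →L[ℝ] C(unitInterval, ℝ) :=
  midGreen F u • ContinuousLinearMap.id ℝ C(unitInterval, ℝ) - branchDerivCompact F' p u

lemma branchDeriv_apply :
    branchDeriv F F' p u z = midGreen F u • z - branchDerivCompact F' p u z := rfl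

lemma fderiv_branchEq_comp_inr (hF : ContDiff ℝ 2 F) (hd : ∀ x, HasDerivAt F (F' x) x) (p : ℝ)
    (u : C(unitInterval, ℝ)) :
    fderiv ℝ (branchEq F) (p, u) ∘L .inr ℝ ℝ C(unitInterval, ℝ) = branchDeriv F F' p u := by
  have hN := hasFDerivAt_comp_continuousMap hd u
  have hG : HasFDerivAt (fun u => greenOp (F.comp u)) (linGreenOp F' u) u :=
    greenOp.hasFDerivAt.comp u hN
  have hM : HasFDerivAt (midGreen F) (ContinuousMap.evalCLM ℝ midpt ∘L linGreenOp F' u) u :=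
    (ContinuousMap.evalCLM ℝ midpt ∘L greenOp).hasFDerivAt.comp u hN
  have h1 : HasFDerivAt (fun w => branchEq F (p, w)) (branchDeriv F F' p u) u := by
    refine ((hM.smul (hasFDerivAt_id u)).sub (hG.const_smul p)).congr_fderiv ?_
    rw [branchDeriv, branchDerivCompact, id]
    abel
  have h2 : HasFDerivAt (branchEq F) (fderiv ℝ (branchEq F) (p, u)) (p, u) :=
    ((contDiff_branchEq hF).differentiable two_ne_zero _).hasFDerivAt
  exact (h2.comp u (hasFDerivAt_prodMk_right p u)).unique h1

lemma IsBranchPoint.exists_eq_symGreen_of_branchDeriv_eq_zero (hF : IsGlobalSource R F)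
    (h : IsBranchPoint F p u) (hp : p ≤ R) (hz : branchDeriv F F' p u z = 0) :
    ∃ η : ℝ, z = (symGreen (branchParam F p u • (F'.comp u * z) -
      η • (branchParam F p u • F.comp u))).der 0 := by
  have hm := (h.midGreen_pos hF hp).ne'
  have hz' : midGreen F u • z = p • linGreenOp F' u z - linGreenOp F' u z midpt • u :=
    sub_eq_zero.1 hz
  refine ⟨linGreenOp F' u z midpt / midGreen F u, ?_⟩
  have hu : greenOp (branchParam F p u • F.comp u) = u := h.der_zero_branchSol hF hp
  rw [← greenOp_apply, map_sub, map_smul, map_smul, hu, ← linGreenOp_apply, branchParam,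
    div_eq_inv_mul, div_eq_inv_mul, mul_smul, mul_smul, ← smul_sub, ← hz', smul_smul,
    inv_mul_cancel₀ hm, one_smul]

lemma IsBranchPoint.apply_midpt_of_branchDeriv_eq_zero (hF : IsGlobalSource R F)
    (h : IsBranchPoint F p u) (hp : p ≤ R) (hz : branchDeriv F F' p u z = 0) : z midpt = 0 := by
  have hz' : midGreen F u * z midpt =
      p * linGreenOp F' u z midpt - linGreenOp F' u z midpt * u midpt :=
    DFunLike.congr_fun (sub_eq_zero.1 hz) midpt
  rw [h.midpt_eq hF hp, mul_comm p, sub_self] at hz'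
  exact (mul_eq_zero.1 hz').resolve_left (h.midGreen_pos hF hp).ne'

lemma branchDeriv_injective (hF : IsGlobalSource R F) (hd : ∀ x, HasDerivAt F (F' x) x)
    (h : IsBranchPoint F p u) (hp : p ≤ R) (hz : branchDeriv F F' p u z = 0) : z = 0 := by
  rcases h.p_nonneg.eq_or_lt with rfl | hp0
  · have hu : u = 0 := ContinuousMap.ext fun x => le_antisymm (h.le x) (h.nonneg x)
    rw [branchDeriv_apply, branchDerivCompact_apply, hu] at hz
    simpa [hu ▸ (h.midGreen_pos hF hp).ne'] using hz
  obtain ⟨η, hzZ⟩ := h.exists_eq_symGreen_of_branchDeriv_eq_zero hF hp hz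
  have hz0 := h.apply_midpt_of_branchDeriv_eq_zero hF hp hz
  set l := branchParam F p u
  set Z := symGreen (l • (F'.comp u * z) - η • (l • F.comp u)) with hZ
  have hlp : 0 < l := div_pos hp0 (h.midGreen_pos hF hp)
  have hpR : Icc 0 p ⊆ Icc 0 R := Icc_subset_Icc_right hp
  obtain ⟨L, hL⟩ := isCompact_Icc.bddAbove_image (K := Icc 0 p)
    (F'.continuous.const_mul l).continuousOn
  have hZ_ode : ∀ t ∈ Icc (0 : ℝ) (1 / 2), Z.half 4 t =
      l * F' ((branchSol F p u).half 0 t) * Z.half 0 t -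
        η * (l * F ((branchSol F p u).half 0 t)) := fun t ht => by
    rw [h.branchSol_half_zero hF hp ht, CkFun.half_eq_der (i := 0) (by norm_num) ht, Fin.mk_zero',
      ← hzZ, hZ, symGreen_half_four ht]
    change l * (F' (u _) * z _) - η * (l * F (u _)) = _
    ring
  have hzero := (h.isProfile hF hp hp0).linearized_eq_zero (f' := fun x => l * F' x)
    (fun x hx => mul_pos hlp (hF.pos x (hpR hx)))
    (fun x _ => ((hd x).const_mul l).hasDerivWithinAt)
    (fun x hx => ⟨mul_nonneg hlp.le (hF.deriv_nonneg hd (hpR hx)), hL (mem_image_of_mem _ hx)⟩)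
    (IsBranchPoint.branchSol_half_three F p u) Z.half_chain hZ_ode
    ((CkFun.half_zero 0).trans (by rw [← hzZ, hz0]))
    (CkFun.half_zero_of_odd (symGreen_reflect _) (by norm_num) (by decide))
    (CkFun.half_zero_of_odd (symGreen_reflect _) (by norm_num) (by decide))
    (symGreen_clamped _).half_end (symGreen_clamped _).half_deriv_end
  rw [hzZ]
  ext x
  rw [CkFun.der_zero_eq_half_abs (symGreen_reflect _) x]
  exact hzero _ (abs_sub_half_mem x)

-- `branchDeriv` is a nonzero multiple of the identity minus a compact operator, so the Fredholm
-- alternative applies.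
lemma branchDeriv_isInvertible (hF : IsGlobalSource R F) (hd : ∀ x, HasDerivAt F (F' x) x)
    (h : IsBranchPoint F p u) (hp : p ≤ R) : (branchDeriv F F' p u).IsInvertible := by
  have hm := (h.midGreen_pos hF hp).ne'
  rcases isCompactOperator_branchDerivCompact.hasEigenvalue_or_mem_resolventSet hm with he | he
  · obtain ⟨z, hz⟩ := he.exists_hasEigenvector
    exact (hz.2 (branchDeriv_injective hF hd h hp (sub_eq_zero.2 hz.apply_eq_smul.symm))).elim
  · obtain ⟨e, he⟩ : IsUnit (branchDeriv F F' p u) := by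
      rwa [spectrum.mem_resolventSet_iff, Algebra.algebraMap_eq_smul_one] at he
    exact ⟨ContinuousLinearEquiv.ofUnit e, he⟩

end Linearization

section Continuation

variable {F : C(ℝ, ℝ)} {R : ℝ}

lemma exists_local_branch {p₀ : ℝ} {u₀ : C(unitInterval, ℝ)}
    (hF : IsGlobalSource R F) (h : IsBranchPoint F p₀ u₀) (hp : p₀ ≤ R) :
    ∃ φ : ℝ → C(unitInterval, ℝ), ContDiffAt ℝ 2 φ p₀ ∧ φ p₀ = u₀ ∧
      ∀ᶠ p in 𝓝 p₀, 0 ≤ p → IsBranchPoint F p (φ p) := by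
  obtain ⟨F', hd⟩ := hF.exists_hasDerivAt
  have cdf : ContDiffAt ℝ 2 (branchEq F) (p₀, u₀) := (contDiff_branchEq hF.contDiff).contDiffAt
  have inv : (fderiv ℝ (branchEq F) (p₀, u₀) ∘L .inr ℝ ℝ C(unitInterval, ℝ)).IsInvertible := by
    rw [fderiv_branchEq_comp_inr hF.contDiff hd]
    exact branchDeriv_isInvertible hF hd h hp
  set φ := cdf.implicitFunction two_ne_zero inv
  have hφ0 : φ p₀ = u₀ := cdf.implicitFunction_apply_self two_ne_zero inv
  have hφc : ContDiffAt ℝ 2 φ p₀ := cdf.contDiffAt_implicitFunction two_ne_zero inv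
  have h0R := left_mem_Icc.2 hF.R_pos.le
  have heqn : ∀ᶠ p in 𝓝 p₀, branchEq F (p, φ p) = branchEq F (p₀, u₀) :=
    cdf.eventually_apply_implicitFunction two_ne_zero inv
  have hnear : ∀ᶠ p in 𝓝 p₀, dist (F.comp (φ p)) (F.comp (φ p₀)) < F 0 :=
    ((ContinuousMap.continuous_postcomp F).continuousAt.comp hφc.continuousAt)
      (Metric.ball_mem_nhds _ (hF.pos 0 h0R))
  refine ⟨φ, hφc, hφ0, ?_⟩
  filter_upwards [heqn, hnear] with p hp_eqn hp_near hp0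
  refine isBranchPoint_of_branchEq hp0 (fun x => ?_) (hp_eqn.trans h.eqn)
  have hdist : dist (F (φ p x)) (F (u₀ x)) < F 0 := by
    rw [hφ0] at hp_near
    exact (ContinuousMap.dist_apply_le_dist x).trans_lt hp_near
  have hle : F 0 ≤ F (u₀ x) := hF.monotoneOn h0R (h.mem_Icc hp x) (h.nonneg x)
  rw [Real.dist_eq, abs_lt] at hdist
  linarith [hdist.1]

lemma IsBranchPoint.exists_compact (hF : IsGlobalSource R F) :
    ∃ K : Set C(unitInterval, ℝ), IsCompact K ∧
      ∀ p u, p ≤ R → IsBranchPoint F p u → u ∈ K := by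
  have h0R := left_mem_Icc.2 hF.R_pos.le
  have hRR := right_mem_Icc.2 hF.R_pos.le
  set c := greenOp (ContinuousMap.const unitInterval (F 0)) midpt
  have hcp : 0 < c := symGreen_midpt_pos (fun _ _ => (hF.pos 0 h0R).le) (hF.pos 0 h0R)
  obtain ⟨K, hK, hsub⟩ := isCompactOperator_greenOp.image_closedBall_subset_compact
    (f := greenOp.toLinearMap) (R / c * F R)
  refine ⟨K, hK, fun p u hp h => hsub ⟨branchParam F p u • F.comp u, ?_,
    h.der_zero_branchSol hF hp⟩⟩
  have hcm : c ≤ midGreen F u := by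
    have := symGreen_nonneg (h := F.comp u - ContinuousMap.const unitInterval (F 0))
      (fun x _ => sub_nonneg.2 (hF.monotoneOn h0R (h.mem_Icc hp x) (h.nonneg x))) midpt
    rw [← greenOp_apply, map_sub] at this
    exact sub_nonneg.1 this
  have hparam : ‖branchParam F p u‖ ≤ R / c := by
    rw [branchParam, Real.norm_of_nonneg (div_nonneg h.p_nonneg (hcp.trans_le hcm).le)]
    exact div_le_div₀ hF.R_pos.le hp hcp hcm
  have hcomp : ‖F.comp u‖ ≤ F R := by
    refine (ContinuousMap.norm_le _ (hF.pos R hRR).le).2 fun x => ?_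
    rw [ContinuousMap.comp_apply, Real.norm_of_nonneg (hF.pos _ (h.mem_Icc hp x)).le]
    exact hF.monotoneOn (h.mem_Icc hp x) hRR (h.mem_Icc hp x).2
  rw [Metric.mem_closedBall, dist_zero_right, norm_smul]
  exact mul_le_mul hparam hcomp (norm_nonneg _) (div_nonneg hF.R_pos.le hcp.le)

lemma isClosed_setOf_exists_isBranchPoint (hF : IsGlobalSource R F) :
    IsClosed ({p | ∃ u, IsBranchPoint F p u} ∩ Icc 0 R) := by
  obtain ⟨K, hK, hsub⟩ := IsBranchPoint.exists_compact hF
  have hcompact := ((isCompact_Icc (a := (0 : ℝ)) (b := R)).prod hK).inter_right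
    (isClosed_setOf_isBranchPoint hF.contDiff)
  convert (hcompact.image continuous_fst).isClosed using 1
  ext p
  constructor
  · rintro ⟨⟨u, hu⟩, hp⟩
    exact ⟨(p, u), ⟨⟨hp, hsub p u hp.2 hu⟩, hu⟩, rfl⟩
  · rintro ⟨⟨p, u⟩, ⟨⟨hp, -⟩, hu⟩, rfl⟩
    exact ⟨⟨u, hu⟩, hp⟩

-- The set of all `p` with a branch point is closed by compactness and open by the implicit
-- function theorem.
lemma exists_isBranchPoint (hF : IsGlobalSource R F) {p : ℝ} (hp : p ∈ Icc 0 R) :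
    ∃ u, IsBranchPoint F p u := by
  refine (isClosed_setOf_exists_isBranchPoint hF).Icc_subset_of_forall_mem_nhdsWithin
    ⟨0, isBranchPoint_zero F⟩ ?_ hp
  rintro p ⟨⟨u, hu⟩, hp0, hpR⟩
  obtain ⟨φ, -, -, hev⟩ := exists_local_branch hF hu hpR.le
  filter_upwards [hev.filter_mono nhdsWithin_le_nhds, self_mem_nhdsWithin] with q hφq hpq
  exact ⟨φ q, hφq (hp0.trans (le_of_lt hpq))⟩

end Continuation

lemma CkFun.continuous_fn {k : ℕ} (u : CkFun k) (i : ℕ) : Continuous (u.fn i) :=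
  (u.der _).continuous.Icc_extend'

namespace IsPositiveSolution

variable {f f' : ℝ → ℝ} {r lam lam₁ lam₂ : ℝ} {u u₁ u₂ u₃ : CkFun 4}

lemma clamped (h : IsPositiveSolution f r lam u) : u.Clamped := ⟨h.left, h.right, h.left', h.right'⟩

lemma fn_mem_Ico (h : IsPositiveSolution f r lam u) {t : ℝ} (ht : t ∈ Icc (0 : ℝ) 1) :
    u.fn 0 t ∈ Ico 0 r := by
  rw [CkFun.fn_eq_der (by norm_num) ht]
  exact ⟨h.nonneg _, h.lt _⟩

lemma fn_eqn (hf : ContinuousOn f (Ico 0 r)) (h : IsPositiveSolution f r lam u) :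
    EqOn (u.fn 4) (fun t => lam * f (u.fn 0 t)) (Icc 0 1) := by
  have hIoo : EqOn (u.fn 4) (fun t => lam * f (u.fn 0 t)) (Ioo 0 1) := fun t ht => by
    have ht' := Ioo_subset_Icc_self ht
    beta_reduce
    rw [CkFun.fn_eq_der (by norm_num) ht', CkFun.fn_eq_der (by norm_num) ht']
    exact h.eqn ⟨t, ht'⟩ ht.1 ht.2
  exact hIoo.of_subset_closure (u.continuous_fn 4).continuousOn
    ((hf.comp (u.continuous_fn 0).continuousOn fun t ht => h.fn_mem_Ico ht).const_mul lam)
    Ioo_subset_Icc_self (by rw [closure_Ioo zero_ne_one])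

lemma isClampedSolution (hf : ContinuousOn f (Ico 0 r)) (h : IsPositiveSolution f r lam u) :
    IsClampedSolution (fun x => lam * f x) u.fn where
  chain := u.derivChain
  nonneg _ ht := (h.fn_mem_Ico ht).1
  eqn := h.fn_eqn hf
  apply_zero := h.clamped.fn_left
  apply_one := h.clamped.fn_right
  deriv_zero := h.clamped.fn_left'
  deriv_one := h.clamped.fn_right'

lemma exists_isMaxOn_fn (h : IsPositiveSolution f r lam u) :
    ∃ x ∈ Icc (0 : ℝ) 1, 0 < u.fn 0 x ∧ IsMaxOn (u.fn 0) (Icc 0 1) x := by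
  obtain ⟨x, hx, hmax⟩ := isCompact_Icc.exists_isMaxOn (nonempty_Icc.2 zero_le_one)
    (u.continuous_fn 0).continuousOn
  obtain ⟨y, hy⟩ := h.nontrivial
  have hpos : 0 < u.fn 0 y := by
    rw [CkFun.fn_eq_der (by norm_num) y.2]
    exact (h.nonneg y).lt_of_ne hy.symm
  exact ⟨x, hx, hpos.trans_le (hmax y.2), hmax⟩

variable (hs : IsConvexSource r f f')

include hs

lemma isProfile_and_symm (hl : 0 < lam) (h : IsPositiveSolution f r lam u) :
    IsProfile (fun x => lam * f x) (u.der 0 midpt) (1 / 2) u.half ∧ u.half 3 0 = 0 ∧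
      ∀ x, u.der 0 (unitInterval.symm x) = u.der 0 x := by
  obtain ⟨x, hx, hpos, hmax⟩ := h.exists_isMaxOn_fn
  have hxr := (h.fn_mem_Ico hx).2
  have hsub : Icc 0 (u.fn 0 x) ⊆ Ico 0 r := Icc_subset_Ico_right hxr
  have hsl := hs.const_mul hl
  obtain ⟨hprofile, hthree, hsymm⟩ := (h.isClampedSolution hs.continuousOn).isProfile_and_symm
    hx hpos hmax (fun y hy => hsl.pos y (hsub hy)) (hsl.strictMonoOn.monotoneOn.mono hsub)
    (hsl.lipschitzOnWith ⟨hpos.le, hxr⟩)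
  refine ⟨?_, by rwa [CkFun.half, add_zero], fun x => ?_⟩
  · rwa [show u.fn 0 (1 / 2) = u.der 0 midpt from u.fn_coe 0 midpt] at hprofile
  · exact (u.fn_coe 0 _).symm.trans ((hsymm x x.2).trans (u.fn_coe 0 x))

lemma isProfile (hl : 0 < lam) (h : IsPositiveSolution f r lam u) :
    IsProfile (fun x => lam * f x) (u.der 0 midpt) (1 / 2) u.half := (h.isProfile_and_symm hs hl).1

lemma half_three (hl : 0 < lam) (h : IsPositiveSolution f r lam u) : u.half 3 0 = 0 :=
  (h.isProfile_and_symm hs hl).2.1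

lemma reflect_eq (hl : 0 < lam) (h : IsPositiveSolution f r lam u) : u.reflect = u :=
  CkFun.ext_der_zero fun x => by
    rw [CkFun.der_reflect, (h.isProfile_and_symm hs hl).2.2, Fin.val_zero, pow_zero, one_mul]

lemma midpt_mem (hl : 0 < lam) (h : IsPositiveSolution f r lam u) :
    u.der 0 midpt ∈ Ioo 0 r := ⟨(h.isProfile hs hl).p_pos, h.lt _⟩

lemma le_midpt (hl : 0 < lam) (h : IsPositiveSolution f r lam u) (x : unitInterval) :
    u.der 0 x ≤ u.der 0 midpt := by
  rw [CkFun.der_zero_eq_half_abs (h.reflect_eq hs hl)]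
  exact (h.isProfile hs hl).le _ (abs_sub_half_mem x)

lemma eq_of_midpt_eq (hl₁ : 0 < lam₁) (hl₂ : 0 < lam₂)
    (h₁ : IsPositiveSolution f r lam₁ u₁) (h₂ : IsPositiveSolution f r lam₂ u₂)
    (hp : u₁.der 0 midpt = u₂.der 0 midpt) : lam₁ = lam₂ ∧ u₁ = u₂ := by
  have hmem := h₁.midpt_mem hs hl₁
  have hsub : Icc 0 (u₁.der 0 midpt) ⊆ Ico 0 r := Icc_subset_Ico_right hmem.2
  obtain ⟨hlam, heq⟩ := IsProfile.eq_of_max_eq hl₁ hl₂ (h₁.isProfile hs hl₁)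
    (hp ▸ h₂.isProfile hs hl₂) (fun x hx => hs.pos x (hsub hx))
    (hs.strictMonoOn.monotoneOn.mono hsub) (hs.lipschitzOnWith ⟨hmem.1.le, hmem.2⟩)
    (h₁.half_three hs hl₁) (h₂.half_three hs hl₂)
  refine ⟨hlam, CkFun.ext_der_zero fun x => ?_⟩
  rw [CkFun.der_zero_eq_half_abs (h₁.reflect_eq hs hl₁),
    CkFun.der_zero_eq_half_abs (h₂.reflect_eq hs hl₂)]
  exact heq _ (abs_sub_half_mem x)

lemma not_three (hl : 0 < lam)
    (h₁ : IsPositiveSolution f r lam u₁) (h₂ : IsPositiveSolution f r lam u₂)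
    (h₃ : IsPositiveSolution f r lam u₃) (h₁₂ : u₁.der 0 midpt < u₂.der 0 midpt) :
    ¬u₂.der 0 midpt < u₃.der 0 midpt := fun h₂₃ =>
  IsProfile.not_three (hs.const_mul hl) (h₁.isProfile hs hl) (h₂.isProfile hs hl)
    (h₃.isProfile hs hl) (h₁.half_three hs hl) (h₂.half_three hs hl) (h₃.half_three hs hl)
    h₁₂ h₂₃ (h₃.midpt_mem hs hl).2

end IsPositiveSolution

lemma IsConvexSource.exists_isGlobalSource {f f' : ℝ → ℝ} {r R : ℝ} (hs : IsConvexSource r f f')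
    (hf : ContDiffOn ℝ 2 f (Ico 0 r)) (hR : 0 < R) (hRr : R < r) :
    ∃ F : C(ℝ, ℝ), IsGlobalSource R F ∧ EqOn F f (Icc 0 R) := by
  have hsub : Icc 0 R ⊆ Ico 0 r := Icc_subset_Ico_right hRr
  obtain ⟨F, hF, heq⟩ := exists_contDiff_two_extension hR (hf.mono hsub)
  refine ⟨⟨F, hF.continuous⟩, ⟨hR, hF, fun x hx => ?_,
    (hs.strictMonoOn.monotoneOn.mono hsub).congr heq.symm⟩, heq⟩
  rw [ContinuousMap.coe_mk, heq hx]
  exact hs.pos x (hsub hx)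

namespace IsBranchPoint

variable {F : C(ℝ, ℝ)} {R p : ℝ} {u : C(unitInterval, ℝ)}

lemma midpt_branchSol (hF : IsGlobalSource R F) (h : IsBranchPoint F p u) (hp : p ≤ R) :
    (branchSol F p u).der 0 midpt = p := by
  rw [h.der_zero_branchSol hF hp, h.midpt_eq hF hp]

lemma mem_solutionSet {f : ℝ → ℝ} {r : ℝ} (hF : IsGlobalSource R F) (heq : EqOn F f (Icc 0 R))
    (hRr : R < r) (h : IsBranchPoint F p u) (hp : p ≤ R) (hp0 : 0 < p) :
    (branchParam F p u, branchSol F p u) ∈ solutionSet f r := by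
  have hu := h.der_zero_branchSol hF hp
  have hc : (branchSol F p u).Clamped := symGreen_clamped _
  have hfold : ∀ x, u (foldMap x) = u x := by
    rw [← hu]
    exact CkFun.der_zero_foldMap (symGreen_reflect _)
  exact ⟨div_pos hp0 (h.midGreen_pos hF hp),
  { nonneg := fun x => by rw [hu]; exact h.nonneg x
    lt := fun x => by rw [hu]; exact (h.le x).trans_lt (hp.trans_lt hRr)
    nontrivial := ⟨midpt, by rw [h.midpt_branchSol hF hp]; exact hp0.ne'⟩
    eqn := fun x _ _ => by
      rw [hu, branchSol, symGreen_der_four, ← heq (h.mem_Icc hp x)]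
      exact congrArg (fun y => _ * F y) (hfold x)
    left := hc.left
    right := hc.right
    left' := hc.left'
    right' := hc.right' }⟩

lemma contDiffAt_branchParam (hF : IsGlobalSource R F) (h : IsBranchPoint F p u) (hp : p ≤ R)
    {φ : ℝ → C(unitInterval, ℝ)} (hφ : ContDiffAt ℝ 2 φ p) (hφp : φ p = u) :
    ContDiffAt ℝ 2 (fun q => branchParam F q (φ q)) p := by
  subst hφp
  exact contDiffAt_id.div ((contDiff_midGreen hF.contDiff).contDiffAt.comp p hφ)
    (h.midGreen_pos hF hp).ne'

lemma contDiffAt_branchSol (hF : IsGlobalSource R F) (h : IsBranchPoint F p u) (hp : p ≤ R)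
    {φ : ℝ → C(unitInterval, ℝ)} (hφ : ContDiffAt ℝ 2 φ p) (hφp : φ p = u) :
    ContDiffAt ℝ 2 (fun q => branchSol F q (φ q)) p := by
  have hN : ContDiffAt ℝ 2 (fun q => branchParam F q (φ q) • F.comp (φ q)) p :=
    (h.contDiffAt_branchParam hF hp hφ hφp).smul
      ((contDiff_comp_continuousMap 2 F hF.contDiff).contDiffAt.comp p hφ)
  have hG : ContDiff ℝ 2 (fun h => symGreen h) := by fun_prop
  exact hG.contDiffAt.comp p hN

end IsBranchPoint

open Classical in
/-- The positive solution with maximum `p` together with its parameter, and `(0, 0)` if there is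
none (in particular for `p = 0`). -/
noncomputable def solutionCurve (f : ℝ → ℝ) (r p : ℝ) : ℝ × CkFun 4 :=
  if h : ∃ q ∈ solutionSet f r, q.2.der 0 midpt = p then h.choose else 0

section Curve

variable {f f' : ℝ → ℝ} {r p : ℝ} (hs : IsConvexSource r f f')

include hs

lemma solutionCurve_of_mem {q : ℝ × CkFun 4} (hq : q ∈ solutionSet f r) :
    solutionCurve f r (q.2.der 0 midpt) = q := by
  have h : ∃ q' ∈ solutionSet f r, q'.2.der 0 midpt = q.2.der 0 midpt := ⟨q, hq, rfl⟩
  rw [solutionCurve, dif_pos h]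
  obtain ⟨hmem, hmid⟩ := h.choose_spec
  obtain ⟨hlam, hu⟩ := hmem.2.eq_of_midpt_eq hs hmem.1 hq.1 hq.2 hmid
  exact Prod.ext hlam hu

lemma solutionCurve_zero : solutionCurve f r 0 = 0 := by
  rw [solutionCurve, dif_neg]
  rintro ⟨q, hq, h0⟩
  exact (hq.2.midpt_mem hs hq.1).1.ne' h0

lemma IsBranchPoint.solutionCurve_eq {F : C(ℝ, ℝ)} {R : ℝ} {u : C(unitInterval, ℝ)}
    (hF : IsGlobalSource R F) (heq : EqOn F f (Icc 0 R)) (hRr : R < r) (h : IsBranchPoint F p u)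
    (hp : p ≤ R) : solutionCurve f r p = (branchParam F p u, branchSol F p u) := by
  rcases h.p_nonneg.eq_or_lt with rfl | hp0
  · rw [solutionCurve_zero hs, branchSol, branchParam, zero_div, zero_smul, map_zero]
    rfl
  · simpa only [h.midpt_branchSol hF hp] using
      solutionCurve_of_mem hs (h.mem_solutionSet hF heq hRr hp hp0)

variable (hf : ContDiffOn ℝ 2 f (Ico 0 r))

include hf

lemma solutionCurve_mem_and_midpt (hp : p ∈ Ioo 0 r) :
    solutionCurve f r p ∈ solutionSet f r ∧ (solutionCurve f r p).2.der 0 midpt = p := by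
  obtain ⟨F, hF, heq⟩ := hs.exists_isGlobalSource hf hp.1 hp.2
  obtain ⟨u, hu⟩ := exists_isBranchPoint hF ⟨hp.1.le, le_rfl⟩
  rw [hu.solutionCurve_eq hs hF heq hp.2 le_rfl]
  exact ⟨hu.mem_solutionSet hF heq hp.2 le_rfl hp.1, hu.midpt_branchSol hF le_rfl⟩

lemma solutionCurve_mem (hp : p ∈ Ioo 0 r) : solutionCurve f r p ∈ solutionSet f r :=
  (solutionCurve_mem_and_midpt hs hf hp).1

lemma solutionCurve_midpt (hp : p ∈ Ico 0 r) : (solutionCurve f r p).2.der 0 midpt = p := by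
  rcases hp.1.eq_or_lt with rfl | hp0
  · rw [solutionCurve_zero hs]
    rfl
  · exact (solutionCurve_mem_and_midpt hs hf ⟨hp0, hp.2⟩).2

lemma solutionSet_eq_image : solutionSet f r = solutionCurve f r '' Ioo 0 r := by
  ext q
  constructor
  · exact fun hq => ⟨_, hq.2.midpt_mem hs hq.1, solutionCurve_of_mem hs hq⟩
  · rintro ⟨p, hp, rfl⟩
    exact solutionCurve_mem hs hf hp

theorem contDiffOn_solutionCurve : ContDiffOn ℝ 2 (solutionCurve f r) (Ico 0 r) := by
  intro p₀ hp₀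
  obtain ⟨R, hR, hRr⟩ := exists_between hp₀.2
  obtain ⟨F, hF, heq⟩ := hs.exists_isGlobalSource hf (hp₀.1.trans_lt hR) hRr
  obtain ⟨u, hu⟩ := exists_isBranchPoint hF ⟨hp₀.1, hR.le⟩
  obtain ⟨φ, hφ, hφ0, hev⟩ := exists_local_branch hF hu hR.le
  have hB : ContDiffAt ℝ 2 (fun p => (branchParam F p (φ p), branchSol F p (φ p))) p₀ :=
    (hu.contDiffAt_branchParam hF hR.le hφ hφ0).prodMk (hu.contDiffAt_branchSol hF hR.le hφ hφ0)
  refine hB.contDiffWithinAt.congr_of_eventuallyEq ?_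
    ((hev.self_of_nhds hp₀.1).solutionCurve_eq hs hF heq hRr hR.le)
  filter_upwards [hev.filter_mono nhdsWithin_le_nhds, self_mem_nhdsWithin,
    nhdsWithin_le_nhds (Iio_mem_nhds hR)] with p hbranch hp hpR
  exact (hbranch hp.1).solutionCurve_eq hs hF heq hRr (le_of_lt hpR)

end Curve

/-- The function `g` takes no value three times on `s`. -/
def AtMostTwiceOn (g : ℝ → ℝ) (s : Set ℝ) : Prop :=
  ∀ ⦃x y z⦄, x ∈ s → y ∈ s → z ∈ s → x < y → y < z → g x = g y → g y ≠ g z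

section Unimodal

variable {g : ℝ → ℝ} {a b c : ℝ}

/-- A dip at `y` would make `g` take some value three times, the missing value being supplied by the
passage to the boundary value `c`. -/
lemma AtMostTwiceOn.min_lt (h3 : AtMostTwiceOn g (Ioo a b)) (hg : ContinuousOn g (Icc a b))
    (ha : g a = c) (hb : g b = c) (hpos : ∀ x ∈ Ioo a b, c < g x) {x y z : ℝ}
    (hx : x ∈ Icc a b) (hz : z ∈ Icc a b) (hxy : x < y) (hyz : y < z) :
    min (g x) (g z) < g y := by
  by_contra! hle
  obtain ⟨hyx, hyz'⟩ := le_min_iff.1 hle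
  have hy : y ∈ Ioo a b := ⟨hx.1.trans_lt hxy, hyz.trans_le hz.2⟩
  have hcy := hpos y hy
  have hax : a < x := hx.1.lt_of_ne (by rintro rfl; exact hcy.not_ge (ha ▸ hyx))
  have hzb : z < b := hz.2.lt_of_ne (by rintro rfl; exact hcy.not_ge (hb ▸ hyz'))
  have cross {s t l : ℝ} (hs : a ≤ s) (hst : s ≤ t) (ht : t ≤ b) (h₁ : g s < l) (h₂ : l < g t) :
      ∃ m ∈ Ioo s t, g m = l :=
    intermediate_value_Ioo hst (hg.mono (Icc_subset_Icc hs ht)) ⟨h₁, h₂⟩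
  have cross' {s t l : ℝ} (hs : a ≤ s) (hst : s ≤ t) (ht : t ≤ b) (h₁ : l < g s) (h₂ : g t < l) :
      ∃ m ∈ Ioo s t, g m = l :=
    intermediate_value_Ioo' hst (hg.mono (Icc_subset_Icc hs ht)) ⟨h₂, h₁⟩
  have hxI : x ∈ Ioo a b := ⟨hax, hxy.trans hy.2⟩
  have hzI : z ∈ Ioo a b := ⟨hy.1.trans hyz, hzb⟩
  rcases hyx.eq_or_lt with hyx | hyx <;> rcases hyz'.eq_or_lt with hyz' | hyz'
  · exact h3 hxI hy hzI hxy hyz hyx.symm hyz'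
  · obtain ⟨m, hm, hgm⟩ := cross' hzI.1.le hzb.le le_rfl hyz' (hb ▸ hcy)
    exact h3 hxI hy ⟨hzI.1.trans hm.1, hm.2⟩ hxy (hyz.trans hm.1) hyx.symm hgm.symm
  · obtain ⟨m, hm, hgm⟩ := cross le_rfl hax.le hxI.2.le (ha ▸ hcy) hyx
    exact h3 ⟨hm.1, hm.2.trans hxI.2⟩ hy hzI (hm.2.trans hxy) hyz hgm hyz'
  · obtain ⟨l, hyl, hl⟩ := exists_between (lt_min hyx hyz')
    obtain ⟨hlx, hlz⟩ := lt_min_iff.1 hl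
    obtain ⟨m₁, hm₁, h₁⟩ := cross le_rfl hax.le hxI.2.le (ha ▸ hcy.trans hyl) hlx
    obtain ⟨m₂, hm₂, h₂⟩ := cross' hax.le hxy.le hy.2.le hlx hyl
    obtain ⟨m₃, hm₃, h₃⟩ := cross hy.1.le hyz.le hzb.le hyl hlz
    exact h3 ⟨hm₁.1, hm₁.2.trans hxI.2⟩ ⟨hax.trans hm₂.1, hm₂.2.trans hy.2⟩
      ⟨hy.1.trans hm₃.1, hm₃.2.trans hzb⟩ (hm₁.2.trans hm₂.1) (hm₂.2.trans hm₃.1)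
      (h₁.trans h₂.symm) (h₂.trans h₃.symm)

lemma strictMonoOn_strictAntiOn_of_min_lt {p : ℝ} (hp : p ∈ Icc a b)
    (hmax : IsMaxOn g (Icc a b) p)
    (hmin : ∀ ⦃x y z⦄, x ∈ Icc a b → z ∈ Icc a b → x < y → y < z → min (g x) (g z) < g y) :
    StrictMonoOn g (Icc a p) ∧ StrictAntiOn g (Icc p b) := by
  have hleft {x y : ℝ} (hx : a ≤ x) (hxy : x < y) (hyp : y < p) : g x < g y := by
    have hxI : x ∈ Icc a b := ⟨hx, (hxy.trans hyp).le.trans hp.2⟩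
    simpa only [min_eq_left (show g x ≤ g p from hmax hxI)] using hmin hxI hp hxy hyp
  have hright {x y : ℝ} (hy : y ≤ b) (hxy : x < y) (hpx : p < x) : g y < g x := by
    have hyI : y ∈ Icc a b := ⟨hp.1.trans (hpx.trans hxy).le, hy⟩
    simpa only [min_eq_right (show g y ≤ g p from hmax hyI)] using hmin hp hyI hpx hxy
  constructor
  · intro x hx y hy hxy
    obtain ⟨z, hxz, hzy⟩ := exists_between hxy
    rcases hy.2.eq_or_lt with rfl | hyp
    · exact (hleft hx.1 hxz hzy).trans_le (hmax ⟨hx.1.trans hxz.le, hzy.le.trans hp.2⟩)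
    · exact hleft hx.1 hxy hyp
  · intro x hx y hy hxy
    obtain ⟨z, hxz, hzy⟩ := exists_between hxy
    rcases hx.1.eq_or_lt with rfl | hpx
    · exact (hright hy.2 hzy hxz).trans_le (hmax ⟨hp.1.trans hxz.le, hzy.le.trans hy.2⟩)
    · exact hright hy.2 hxy hpx

lemma AtMostTwiceOn.exists_unimodal_Icc (h3 : AtMostTwiceOn g (Ioo a b)) (hab : a < b)
    (hg : ContinuousOn g (Icc a b)) (ha : g a = c) (hb : g b = c) (hpos : ∀ x ∈ Ioo a b, c < g x) :
    ∃ p ∈ Ioo a b, StrictMonoOn g (Icc a p) ∧ StrictAntiOn g (Icc p b) := by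
  obtain ⟨p, hp, hmax⟩ := isCompact_Icc.exists_isMaxOn (nonempty_Icc.2 hab.le) hg
  obtain ⟨m, hm⟩ := nonempty_Ioo.2 hab
  have hcp : c < g p := (hpos m hm).trans_le (hmax (Ioo_subset_Icc_self hm))
  refine ⟨p, ⟨hp.1.lt_of_ne ?_, hp.2.lt_of_ne ?_⟩, strictMonoOn_strictAntiOn_of_min_lt hp hmax
    fun x y z => h3.min_lt hg ha hb hpos⟩
  · rintro rfl; exact hcp.ne' ha
  · rintro rfl; exact hcp.ne' hb

lemma AtMostTwiceOn.exists_unimodal (h3 : AtMostTwiceOn g (Ioo a b)) (hab : a < b)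
    (hg : ContinuousOn g (Ico a b)) (ha : g a = c) (hpos : ∀ x ∈ Ioo a b, c < g x)
    (hlim : Tendsto g (𝓝[<] b) (𝓝 c)) :
    ∃ p ∈ Ioo a b, StrictMonoOn g (Icc a p) ∧ StrictAntiOn g (Ico p b) := by
  classical
  have heq : EqOn g (Function.update g b c) (Ico a b) := fun x hx =>
    (Function.update_of_ne hx.2.ne c g).symm
  have heq' : EqOn g (Function.update g b c) (Ioo a b) := heq.mono Ioo_subset_Ico_self
  have h3' : AtMostTwiceOn (Function.update g b c) (Ioo a b) := fun x y z hx hy hz => by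
    rw [← heq' hx, ← heq' hy, ← heq' hz]
    exact h3 hx hy hz
  have hcont : ContinuousOn (Function.update g b c) (Icc a b) := by
    rw [continuousOn_update_iff, Icc_sdiff_right]
    exact ⟨hg, fun _ => hlim.mono_left (nhdsWithin_mono _ Ico_subset_Iio_self)⟩
  obtain ⟨p, hp, hmono, hanti⟩ := h3'.exists_unimodal_Icc hab hcont
    ((heq (left_mem_Ico.2 hab)).symm.trans ha) (Function.update_self _ _ _)
    fun x hx => (hpos x hx).trans_eq (heq' hx)
  exact ⟨p, hp, hmono.congr (heq.mono (Icc_subset_Ico_right hp.2)).symm,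
    (hanti.mono Ico_subset_Icc_self).congr (heq.mono (Ico_subset_Ico_left hp.1.le)).symm⟩

variable {p₀ y : ℝ}

lemma lt_of_unimodal (hp₀ : p₀ ∈ Ioo a b) (hmono : StrictMonoOn g (Icc a p₀))
    (hanti : StrictAntiOn g (Ico p₀ b)) {p : ℝ} (hp : p ∈ Ioo a b) (hne : p ≠ p₀) : g p < g p₀ := by
  rcases hne.lt_or_gt with h | h
  · exact hmono ⟨hp.1.le, h.le⟩ (right_mem_Icc.2 hp₀.1.le) h
  · exact hanti (left_mem_Ico.2 hp₀.2) ⟨h.le, hp.2⟩ h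

lemma level_eq_singleton_of_unimodal (hp₀ : p₀ ∈ Ioo a b) (hmono : StrictMonoOn g (Icc a p₀))
    (hanti : StrictAntiOn g (Ico p₀ b)) : {p ∈ Ioo a b | g p = g p₀} = {p₀} :=
  eq_singleton_iff_unique_mem.2 ⟨⟨hp₀, rfl⟩, fun _ hp =>
    by_contra fun hne => (lt_of_unimodal hp₀ hmono hanti hp.1 hne).ne hp.2⟩

lemma level_eq_empty_of_unimodal (hp₀ : p₀ ∈ Ioo a b) (hmono : StrictMonoOn g (Icc a p₀))
    (hanti : StrictAntiOn g (Ico p₀ b)) (hy : g p₀ < y) : {p ∈ Ioo a b | g p = y} = ∅ := by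
  refine eq_empty_iff_forall_notMem.2 ?_
  rintro p ⟨hp, rfl⟩
  rcases eq_or_ne p p₀ with rfl | hne
  · exact hy.false
  · exact hy.not_gt (lt_of_unimodal hp₀ hmono hanti hp hne)

lemma encard_level_of_unimodal (hp₀ : p₀ ∈ Ioo a b) (hg : ContinuousOn g (Ico a b))
    (hmono : StrictMonoOn g (Icc a p₀)) (hanti : StrictAntiOn g (Ico p₀ b)) (hy : y < g p₀)
    (ha : g a < y) (hb : ∃ᶠ x in 𝓝[<] b, g x < y) : {p ∈ Ioo a b | g p = y}.encard = 2 := by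
  obtain ⟨s, hs, hgs⟩ := intermediate_value_Ioo hp₀.1.le
    (hg.mono (Icc_subset_Ico_right hp₀.2)) ⟨ha, hy⟩
  obtain ⟨q, hqy, hq⟩ := (hb.and_eventually (Ioo_mem_nhdsLT hp₀.2)).exists
  obtain ⟨t, ht, hgt⟩ := intermediate_value_Ioo' hq.1.le
    (hg.mono fun x hx => ⟨hp₀.1.le.trans hx.1, hx.2.trans_lt hq.2⟩) ⟨hqy, hy⟩
  have htb : t < b := ht.2.trans hq.2
  suffices hset : {p ∈ Ioo a b | g p = y} = {s, t} by
    rw [hset]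
    exact encard_pair (hs.2.trans ht.1).ne
  ext p
  constructor
  · rintro ⟨hp, hgp⟩
    rcases le_total p p₀ with h | h
    · exact Or.inl (hmono.injOn ⟨hp.1.le, h⟩ (Ioo_subset_Icc_self hs) (hgp.trans hgs.symm))
    · exact Or.inr (hanti.injOn ⟨h, hp.2⟩ ⟨ht.1.le, htb⟩ (hgp.trans hgt.symm))
  · rintro (rfl | rfl)
    · exact ⟨⟨hs.1, hs.2.trans hp₀.2⟩, hgs⟩
    · exact ⟨⟨hp₀.1.trans ht.1, htb⟩, hgt⟩

end Unimodal

namespace DerivChain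

variable {v : ℕ → ℝ → ℝ} {n i : ℕ} {a b x y C : ℝ}

lemma polynomial (q : Polynomial ℝ) :
    DerivChain n a b (fun i t => (Polynomial.derivative^[i] q).eval t) := fun i _ t _ => by
  simpa only [Function.iterate_succ_apply'] using
    (Polynomial.hasDerivAt (Polynomial.derivative^[i] q) t).hasDerivWithinAt

lemma sub_le_mul (h : DerivChain n a b v) (hi : i < n) (hx : a ≤ x) (hxy : x ≤ y) (hy : y ≤ b)
    (hC : ∀ t ∈ Icc x y, v (i + 1) t ≤ C) : v i y - v i x ≤ C * (y - x) := by
  have hanti := antitoneOn_of_hasDerivWithinAt_Icc (g := fun t => v i t - C * t)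
    (fun t ht => (h.mono hx hy i hi t ht).sub ((hasDerivWithinAt_id t _).const_mul C))
    (fun t ht => by linarith [hC t ht]) (left_mem_Icc.2 hxy) (right_mem_Icc.2 hxy) hxy
  dsimp only at hanti
  linarith

lemma mul_le_sub (h : DerivChain n a b v) (hi : i < n) (hx : a ≤ x) (hxy : x ≤ y) (hy : y ≤ b)
    (hC : ∀ t ∈ Icc x y, C ≤ v (i + 1) t) : C * (y - x) ≤ v i y - v i x := by
  have := h.neg.sub_le_mul hi hx hxy hy (C := -C) fun t ht => neg_le_neg (hC t ht)
  linarith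

lemma antitoneOn_of_clamped (h : DerivChain n a b v) (hn : 3 < n) (ha : v 1 a = 0) (hb : v 1 b = 0)
    (h3 : 0 ≤ v 3 a) (h4 : ∀ t ∈ Icc a b, 0 ≤ v 4 t) : AntitoneOn (v 0) (Icc a b) :=
  h.antitoneOn (by lia) fun _ ht => nonpos_of_convexOn_Icc
    (h.convexOn (by lia) fun _ hs => h3.trans (h.left_le_of_deriv_nonneg hn h4 hs)) ha.le hb.le ht

lemma nonpos_and_nonneg_of_end (h : DerivChain n a b v) (hn : 1 < n) (h0 : v 0 b = 0)
    (h1 : v 1 b = 0) (h2 : ∀ t ∈ Icc a b, 0 ≤ v 2 t) {t : ℝ} (ht : t ∈ Icc a b) :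
    v 1 t ≤ 0 ∧ 0 ≤ v 0 t := by
  have hb := right_mem_Icc.2 (ht.1.trans ht.2)
  have hnonpos (s : ℝ) (hs : s ∈ Icc a b) : v 1 s ≤ 0 := h1 ▸ h.monotoneOn hn h2 hs hb hs.2
  exact ⟨hnonpos t ht, h0 ▸ h.antitoneOn (by lia) hnonpos ht hb ht.2⟩

end DerivChain

/-- The cubic polynomial with a double zero, second derivative `A` and third derivative `m`
at `T`. -/
noncomputable def terminalCubic (T A m : ℝ) : Polynomial ℝ :=
  .C (A / 2) * (.X - .C T) ^ 2 + .C (m / 6) * (.X - .C T) ^ 3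

section NearCubic

variable {v : ℕ → ℝ → ℝ} {n : ℕ} {T A m ε ω η t : ℝ}

lemma terminalCubic_eval :
    (terminalCubic T A m).eval t = A / 2 * (t - T) ^ 2 + m / 6 * (t - T) ^ 3 := by
  simp [terminalCubic]

lemma terminalCubic_deriv :
    (Polynomial.derivative^[1] (terminalCubic T A m)).eval t =
      A * (t - T) + m / 2 * (t - T) ^ 2 := by
  simp [terminalCubic, Polynomial.derivative_X_sub_C_pow]
  ring

lemma terminalCubic_second_deriv :
    (Polynomial.derivative^[2] (terminalCubic T A m)).eval t = A + m * (t - T) := by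
  simp [terminalCubic, Polynomial.derivative_X_sub_C_pow]
  ring

lemma second_deriv_sub_mem_of_monotoneOn (hv : DerivChain n 0 T v) (hn : 2 < n)
    (h3 : ∀ t ∈ Icc 0 T, 0 ≤ v 3 t) (hmono : MonotoneOn (v 3) (Icc 0 T)) (hη : η ∈ Icc 0 T)
    (hε : v 3 T - v 3 η ≤ ε) (ht : t ∈ Icc 0 T) :
    v 2 t - (v 2 T + v 3 T * (t - T)) ∈ Icc 0 (v 3 T * η + ε * T) := by
  have hT : T ∈ Icc 0 T := ⟨ht.1.trans ht.2, le_rfl⟩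
  have hε0 : 0 ≤ ε := (sub_nonneg.2 (hmono hη hT hη.2)).trans hε
  have hlower := hv.sub_le_mul hn ht.1 ht.2 le_rfl
    (fun s hs => hmono ⟨ht.1.trans hs.1, hs.2⟩ hT hs.2)
  have hfar (s : ℝ) (hs : s ∈ Icc η T) : v 2 s - (v 2 T + v 3 T * (s - T)) ≤ ε * T := by
    have hle := hv.mul_le_sub hn (hη.1.trans hs.1) hs.2 le_rfl (C := v 3 T - ε) fun x hx => by
      linarith [hmono hη ⟨hη.1.trans (hs.1.trans hx.1), hx.2⟩ (hs.1.trans hx.1)]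
    linarith [mul_nonneg hε0 (hη.1.trans hs.1)]
  refine ⟨by linarith, ?_⟩
  have hm := h3 T hT
  rcases le_total η t with hηt | htη
  · linarith [hfar t ⟨hηt, ht.2⟩, mul_nonneg hm hη.1]
  · have hle := hv.mul_le_sub hn ht.1 htη hη.2 (C := 0) fun s hs =>
      h3 s ⟨ht.1.trans hs.1, hs.2.trans hη.2⟩
    linarith [hfar η ⟨le_rfl, hη.2⟩, mul_nonneg hm ht.1]

lemma abs_sub_le_of_second_deriv_sub_mem (hv : DerivChain n 0 T v) (hn : 1 < n) (hT : 0 < T)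
    (hinit : v 1 0 = 0) (h0 : v 0 T = 0) (h1 : v 1 T = 0)
    (hω : ∀ t ∈ Icc 0 T, v 2 t - (A + m * (t - T)) ∈ Icc 0 ω) :
    |A - m * T / 2| ≤ ω ∧ |v 0 0 - m * T ^ 3 / 12| ≤ ω * T ^ 2 / 2 := by
  have hzero : (0 : ℝ) ∈ Icc 0 T := left_mem_Icc.2 hT.le
  obtain ⟨hlower', hlower⟩ :=
    (hv.sub (.polynomial (terminalCubic T A m))).nonpos_and_nonneg_of_end hn
      (by simp [h0, terminalCubic_eval]) (by rw [terminalCubic_deriv, h1]; ring)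
      (fun t ht => by rw [terminalCubic_second_deriv]; exact (hω t ht).1) hzero
  obtain ⟨hupper', hupper⟩ :=
    ((DerivChain.polynomial (terminalCubic T (A + ω) m)).sub hv).nonpos_and_nonneg_of_end hn
      (by simp [h0, terminalCubic_eval]) (by rw [terminalCubic_deriv, h1]; ring)
      (fun t ht => by rw [terminalCubic_second_deriv]; linarith [(hω t ht).2]) hzero
  simp only [terminalCubic_deriv, Function.iterate_zero_apply, terminalCubic_eval, hinit] at *
  have hA : A ≤ m * T / 2 := le_of_mul_le_mul_right (by linarith) hT
  have hA' : m * T / 2 ≤ A + ω := le_of_mul_le_mul_right (by linarith) hT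
  have hAT := mul_le_mul_of_nonneg_right hA (sq_nonneg T)
  have hAT' := mul_le_mul_of_nonneg_right hA' (sq_nonneg T)
  exact ⟨abs_le.2 ⟨by linarith, by linarith⟩, abs_le.2 ⟨by linarith, by linarith⟩⟩

lemma abs_second_deriv_sub_le (hv : DerivChain n 0 T v) (hn : 1 < n) (hT : 0 < T)
    (hinit : v 1 0 = 0) (h0 : v 0 T = 0) (h1 : v 1 T = 0)
    (hω : ∀ t ∈ Icc 0 T, v 2 t - (A + m * (t - T)) ∈ Icc 0 ω) (ht : t ∈ Icc 0 T) :
    |v 2 t - v 0 0 * (6 / T ^ 2 + 12 / T ^ 3 * (t - T))| ≤ 5 * ω := by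
  obtain ⟨hA, hm⟩ := abs_sub_le_of_second_deriv_sub_mem hv hn hT hinit h0 h1 hω
  have hlever : |12 / T ^ 3 * (t - T / 2)| ≤ 6 / T ^ 2 := by
    rw [abs_mul, abs_of_pos (by positivity)]
    calc 12 / T ^ 3 * |t - T / 2| ≤ 12 / T ^ 3 * (T / 2) := by
          gcongr
          exact abs_le.2 ⟨by linarith [ht.1], by linarith [ht.2]⟩
      _ = 6 / T ^ 2 := by field_simp; norm_num
  have hω0 : 0 ≤ ω := (abs_nonneg _).trans hA
  calc |v 2 t - v 0 0 * (6 / T ^ 2 + 12 / T ^ 3 * (t - T))|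
      = |(v 2 t - (A + m * (t - T))) + (A - m * T / 2)
          - (v 0 0 - m * T ^ 3 / 12) * (12 / T ^ 3 * (t - T / 2))| := by
        congr 1
        field_simp
        ring
    _ ≤ |v 2 t - (A + m * (t - T))| + |A - m * T / 2|
          + |v 0 0 - m * T ^ 3 / 12| * |12 / T ^ 3 * (t - T / 2)| := by
        rw [← abs_mul]
        exact (abs_sub _ _).trans (add_le_add_left (abs_add_le _ _) _)
    _ ≤ ω + ω + ω * T ^ 2 / 2 * (6 / T ^ 2) := by
        gcongr
        exact abs_le.2 ⟨by linarith [(hω t ht).1], (hω t ht).2⟩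
    _ = 5 * ω := by field_simp; ring

end NearCubic

namespace IsProfile

variable {f F F' : ℝ → ℝ} {r p T M c η t : ℝ} {v : ℕ → ℝ → ℝ}

lemma mul_length_pow_le (h : IsProfile f p T v) (h3 : v 3 0 = 0) {m : ℝ}
    (hm : ∀ x ∈ Icc 0 p, m ≤ f x) : m * T ^ 4 ≤ 24 * p := by
  have h0 : (0 : ℝ) ∈ Icc 0 T := left_mem_Icc.2 h.T_pos.le
  have hT : T ∈ Icc 0 T := right_mem_Icc.2 h.T_pos.le
  -- Up to an additive constant, `q` is the solution of `q'''' = m` with `q' = 0` at `0` and `T`.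
  obtain ⟨B, hB⟩ : ∃ B, B = 2 * T ^ 2 := ⟨_, rfl⟩
  let q : Polynomial ℝ := .C (m / 24) * (.X ^ 4 - .C B * .X ^ 2)
  have hq (t : ℝ) : q.eval t = m / 24 * (t ^ 4 - B * t ^ 2) := by simp [q]
  have hder (k : ℕ) (t : ℝ) : (Polynomial.derivative^[k] q).eval t =
      m / 24 *
        (Nat.descFactorial 4 k * t ^ (4 - k) - B * (Nat.descFactorial 2 k * t ^ (2 - k))) := by
    simp only [q, Polynomial.iterate_derivative_C_mul, Polynomial.iterate_derivative_sub,
      Polynomial.iterate_derivative_X_pow_eq_smul, Polynomial.eval_mul, Polynomial.eval_C,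
      Polynomial.eval_sub, Polynomial.eval_smul, Polynomial.eval_pow, Polynomial.eval_X,
      smul_eq_mul]
  have hq1 (t : ℝ) : (Polynomial.derivative^[1] q).eval t = m / 24 * (4 * t ^ 3 - 2 * B * t) := by
    rw [hder]
    norm_num [Nat.descFactorial, -mul_eq_mul_left_iff]
    ring
  have hq3 (t : ℝ) : (Polynomial.derivative^[3] q).eval t = m * t := by
    rw [hder]
    norm_num [Nat.descFactorial]
    ring
  have hq4 (t : ℝ) : (Polynomial.derivative^[4] q).eval t = m := by
    rw [hder]
    norm_num [Nat.descFactorial]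
  have hanti := (h.chain.sub (.polynomial q)).antitoneOn_of_clamped (by simp)
    (by rw [h.deriv_zero, hq1]; ring) (by rw [h.deriv_end, hq1, hB]; ring) (by rw [h3, hq3]; simp)
    (fun t ht => by rw [h.eqn t ht, hq4]; exact sub_nonneg.2 (hm _ (h.mem_Icc ht)))
    h0 hT h.T_pos.le
  simp only [Function.iterate_zero_apply, hq, h.apply_zero, h.apply_end, hB] at hanti
  linarith

lemma antitoneOn (h : IsProfile f p T v) (hf : ∀ x ∈ Icc 0 p, 0 < f x) (h3 : v 3 0 = 0) :
    AntitoneOn (v 0) (Icc 0 T) :=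
  h.chain.antitoneOn (by simp) fun _ ht => h.deriv_nonpos hf h3 ht

lemma monotoneOn_third_deriv (h : IsProfile f p T v) (hf : ∀ x ∈ Icc 0 p, 0 < f x) :
    MonotoneOn (v 3) (Icc 0 T) :=
  h.chain.monotoneOn (by simp) fun t ht => (h.fourth_deriv_pos hf t ht).le

lemma le_mul_one_sub_sq (h : IsProfile f p T v) (hf : ∀ x ∈ Icc 0 p, 0 < f x) (h3 : v 3 0 = 0)
    (hη : η ∈ Icc 0 (T / 2)) (ht : t ∈ Icc η T) : v 0 t ≤ p * (1 - η ^ 2 / (2 * T ^ 2)) := by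
  have hT := h.T_pos
  have hηT : η ≤ T := by linarith [hη.2]
  have hdiff (s : ℝ) (hs : s ∈ Icc 0 η) : HasDerivWithinAt (fun s => v 0 s + p / T ^ 2 / 2 * s ^ 2)
      (v 1 s + p / T ^ 2 * s) (Icc 0 η) s :=
    ((h.chain.mono le_rfl hηT 0 (by simp) s hs).add
      (((hasDerivAt_id' s).pow 2).const_mul _).hasDerivWithinAt).congr_deriv (by push_cast; ring)
  have hanti := antitoneOn_of_hasDerivWithinAt_Icc hdiff (fun s hs => by
    have hd := h.deriv_le hf h3 ⟨hs.1, hs.2.trans hηT⟩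
    rw [min_eq_left (by linarith [hs.2, hη.2])] at hd
    linarith) (left_mem_Icc.2 hη.1) (right_mem_Icc.2 hη.1) hη.1
  calc v 0 t ≤ v 0 η := h.antitoneOn hf h3 ⟨hη.1, hηT⟩ ⟨hη.1.trans ht.1, ht.2⟩ ht.1
    _ ≤ v 0 0 - p / T ^ 2 / 2 * η ^ 2 := by linarith
    _ = p * (1 - η ^ 2 / (2 * T ^ 2)) := by rw [h.apply_zero]; ring

lemma third_deriv_sub_le (h : IsProfile F p T v) (hF : IsConvexSource r F F') (hp : p < r)
    (h3 : v 3 0 = 0) (hη0 : 0 < η) (hη : η ≤ T / 2) :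
    v 3 T - v 3 η ≤ F (r * (1 - η ^ 2 / (2 * T ^ 2))) * T := by
  have hT := h.T_pos
  have hr := h.p_pos.trans hp
  have hfrac : 0 < η ^ 2 / (2 * T ^ 2) := by positivity
  have hfrac' : η ^ 2 / (2 * T ^ 2) < 1 := by
    rw [div_lt_one (by positivity)]
    nlinarith
  have hq : r * (1 - η ^ 2 / (2 * T ^ 2)) ∈ Ico 0 r :=
    ⟨mul_nonneg hr.le (by linarith), mul_lt_of_lt_one_right hr (by linarith)⟩
  have hle (t : ℝ) (ht : t ∈ Icc η T) : v 4 t ≤ F (r * (1 - η ^ 2 / (2 * T ^ 2))) := by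
    have ht' : t ∈ Icc 0 T := ⟨hη0.le.trans ht.1, ht.2⟩
    rw [h.eqn t ht']
    refine hF.strictMonoOn.monotoneOn (h.mem_Ico hp ht') hq
      ((h.le_mul_one_sub_sq (hF.pos_of_mem_Icc hp) h3 ⟨hη0.le, hη⟩ ht).trans ?_)
    gcongr
  refine (h.chain.sub_le_mul (i := 3) (by simp) hη0.le (by linarith) le_rfl hle).trans ?_
  gcongr
  exacts [(hF.pos _ hq).le, by linarith]

lemma second_deriv_sub_mem (h : IsProfile F p T v) (hF : IsConvexSource r F F') (hp : p < r)
    (h3 : v 3 0 = 0) (hη0 : 0 < η) (hη : η ≤ T / 2) (ht : t ∈ Icc 0 T) :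
    v 2 t - (v 2 T + v 3 T * (t - T)) ∈
      Icc 0 (v 3 T * η + F (r * (1 - η ^ 2 / (2 * T ^ 2))) * T * T) :=
  have hpos := hF.pos_of_mem_Icc hp
  second_deriv_sub_mem_of_monotoneOn h.chain (by simp) (fun _ => h.third_deriv_nonneg hpos h3)
    (h.monotoneOn_third_deriv hpos) ⟨hη0.le, by linarith [h.T_pos]⟩
    (h.third_deriv_sub_le hF hp h3 hη0 hη) ht

lemma third_deriv_end_le (h : IsProfile F p T v) (hF : IsConvexSource r F F') (hp : p < r)
    (h3 : v 3 0 = 0) : v 3 T ≤ 24 * p / T ^ 3 + 12 * (F (r * (287 / 288)) * T) := by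
  have hT := h.T_pos
  have hm := (abs_le.1 (abs_sub_le_of_second_deriv_sub_mem h.chain (by simp) hT h.deriv_zero
    h.apply_end h.deriv_end fun t ht => h.second_deriv_sub_mem hF hp h3 (η := T / 12)
      (by positivity) (by linarith) ht).2).1
  rw [h.apply_zero, show 1 - (T / 12) ^ 2 / (2 * T ^ 2) = 287 / 288 by field_simp; norm_num] at hm
  refine le_of_mul_le_mul_right ?_ (pow_pos hT 3)
  rw [add_mul, div_mul_cancel₀ _ (by positivity)]
  linarith

lemma exists_third_deriv_bound {f' : ℝ → ℝ} (hs : IsConvexSource r f f') (hr : 0 < r) (hT : 0 < T) :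
    ∃ M > 0, ∀ (p lam : ℝ) (v : ℕ → ℝ → ℝ), 0 < lam → p < r →
      IsProfile (fun x => lam * f x) p T v → v 3 0 = 0 → v 3 T ≤ M := by
  set Q := f (r * (287 / 288))
  have h0 : (0 : ℝ) ∈ Ico 0 r := ⟨le_rfl, hr⟩
  have hf0 : 0 < f 0 := hs.pos 0 h0
  have hQ : 0 < Q := hs.pos _ ⟨by positivity, by linarith⟩
  refine ⟨24 * r / T ^ 3 + 12 * (24 * r / (f 0 * T ^ 4) * Q * T), by positivity,
    fun p lam v hl hp h h3 => ?_⟩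
  have hlam : lam ≤ 24 * r / (f 0 * T ^ 4) := by
    rw [le_div_iff₀ (by positivity)]
    have := h.mul_length_pow_le h3 (m := lam * f 0) fun x hx => mul_le_mul_of_nonneg_left
      (hs.strictMonoOn.monotoneOn h0 ⟨hx.1, hx.2.trans_lt hp⟩ hx.1) hl.le
    linarith
  refine (h.third_deriv_end_le (hs.const_mul hl) hp h3).trans ?_
  gcongr

lemma sub_mul_sq_le (h : IsProfile f p T v) (hf : ∀ x ∈ Icc 0 p, 0 < f x) (h3 : v 3 0 = 0)
    (hM : v 3 T ≤ M) (ht : t ∈ Icc 0 T) : p - M * T * t ^ 2 ≤ v 0 t := by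
  have hT := right_mem_Icc.2 h.T_pos.le
  have hM0 : 0 ≤ M := (h.third_deriv_nonneg hf h3 hT).trans hM
  have hsecond (s : ℝ) (hs : s ∈ Icc 0 T) : -(M * T) ≤ v 2 s := by
    have := h.chain.sub_le_mul (i := 2) (by simp) hs.1 hs.2 le_rfl fun x hx =>
      (h.monotoneOn_third_deriv hf ⟨hs.1.trans hx.1, hx.2⟩ hT hx.2).trans hM
    linarith [h.second_deriv_end_nonneg, mul_nonneg hM0 hs.1]
  have hderiv (s : ℝ) (hs : s ∈ Icc 0 t) : -(M * T * t) ≤ v 1 s := by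
    have := h.chain.mul_le_sub (i := 1) (by simp) le_rfl hs.1 (hs.2.trans ht.2) fun x hx =>
      hsecond x ⟨hx.1, hx.2.trans (hs.2.trans ht.2)⟩
    rw [h.deriv_zero] at this
    linarith [mul_le_mul_of_nonneg_left hs.2 (mul_nonneg hM0 h.T_pos.le)]
  have := h.chain.mul_le_sub (i := 0) (by simp) le_rfl ht.1 ht.2 hderiv
  rw [h.apply_zero] at this
  linarith

lemma le_mul_sqrt_of_le_sub_mul (h : IsProfile f p T v) (hf : ∀ x ∈ Icc 0 p, 0 < f x)
    (h3 : v 3 0 = 0) (hM : v 3 T ≤ M) (hp : p < r) (hpT : r - p ≤ T ^ 2)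
    (hc : ∀ x ∈ Icc 0 p, c ≤ (r - x) * f x) : c ≤ M * (1 + M * T) * √(r - p) := by
  have hT := h.T_pos
  have hTI := right_mem_Icc.2 hT.le
  have hM0 : 0 ≤ M := (h.third_deriv_nonneg hf h3 hTI).trans hM
  have hδ : 0 < r - p := sub_pos.2 hp
  -- On `[0, √(r - p)]` the profile stays within a multiple of `r - p` of the singular value.
  set s := √(r - p)
  have hs : 0 < s := Real.sqrt_pos.2 hδ
  have hsq : s ^ 2 = r - p := Real.sq_sqrt hδ.le
  have hsT : s ≤ T := (Real.sqrt_le_left hT.le).2 hpT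
  have hD : 0 < (1 + M * T) * s ^ 2 := by positivity
  have hfourth (t : ℝ) (ht : t ∈ Icc 0 s) : c / ((1 + M * T) * s ^ 2) ≤ v 4 t := by
    have htT : t ∈ Icc 0 T := ⟨ht.1, ht.2.trans hsT⟩
    have hmem := h.mem_Icc htT
    have hgap : r - v 0 t ≤ (1 + M * T) * s ^ 2 := by
      have hsq_le : M * T * t ^ 2 ≤ M * T * s ^ 2 := by gcongr; exacts [ht.1, ht.2]
      linarith [h.sub_mul_sq_le hf h3 hM htT]
    rw [h.eqn t htT, div_le_iff₀ hD]
    linarith [hc _ hmem, mul_le_mul_of_nonneg_right hgap (hf _ hmem).le]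
  have hthird := h.chain.mul_le_sub (i := 3) (by simp) le_rfl hs.le hsT hfourth
  have hle : c / ((1 + M * T) * s ^ 2) * s ≤ M := by
    linarith [(h.monotoneOn_third_deriv hf ⟨hs.le, hsT⟩ hTI hsT).trans hM]
  rw [div_mul_eq_mul_div, div_le_iff₀ hD] at hle
  exact le_of_mul_le_mul_right (by linarith) hs

lemma abs_second_deriv_sub_le (h : IsProfile F p T v) (hF : IsConvexSource r F F') (hp : p < r)
    (h3 : v 3 0 = 0) (hM : v 3 T ≤ M) (hη0 : 0 < η) (hη : η ≤ T / 2) (ht : t ∈ Icc 0 T) :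
    |v 2 t - r * (6 / T ^ 2 + 12 / T ^ 3 * (t - T))| ≤
      5 * (M * η + F (r * (1 - η ^ 2 / (2 * T ^ 2))) * T * T) + 6 / T ^ 2 * (r - p) := by
  have hT := h.T_pos
  have hcubic := _root_.abs_second_deriv_sub_le h.chain (by simp) hT h.deriv_zero h.apply_end
    h.deriv_end (fun s hs => h.second_deriv_sub_mem hF hp h3 hη0 hη hs) ht
  rw [h.apply_zero] at hcubic
  have hshape : |6 / T ^ 2 + 12 / T ^ 3 * (t - T)| ≤ 6 / T ^ 2 := by
    have hlow : 0 ≤ 12 / T ^ 3 * t := mul_nonneg (by positivity) ht.1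
    have hhigh : 0 ≤ 12 / T ^ 3 * (T - t) := mul_nonneg (by positivity) (sub_nonneg.2 ht.2)
    have hTT : 12 / T ^ 3 * T = 6 / T ^ 2 + 6 / T ^ 2 := by field_simp; norm_num
    exact abs_le.2 ⟨by linarith, by linarith⟩
  calc |v 2 t - r * (6 / T ^ 2 + 12 / T ^ 3 * (t - T))|
      = |(v 2 t - p * (6 / T ^ 2 + 12 / T ^ 3 * (t - T)))
          - (6 / T ^ 2 + 12 / T ^ 3 * (t - T)) * (r - p)| := by congr 1; ring
    _ ≤ _ := (abs_sub _ _).trans (add_le_add (hcubic.trans ?_) ?_)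
  · gcongr
  · rw [abs_mul, abs_of_pos (sub_pos.2 hp)]
    exact mul_le_mul_of_nonneg_right hshape (sub_pos.2 hp).le

end IsProfile

lemma hasDerivAt_mul_abs (t : ℝ) : HasDerivAt (fun t : ℝ => t * |t|) (2 * |t|) t := by
  rcases eq_or_ne t 0 with rfl | ht
  · simp only [hasDerivAt_iff_tendsto_slope_zero, abs_zero, mul_zero]
    have hlim : Tendsto (fun t : ℝ => |t|) (𝓝[≠] 0) (𝓝 0) :=
      tendsto_nhdsWithin_of_tendsto_nhds (continuous_abs.tendsto' 0 0 abs_zero)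
    refine hlim.congr' ?_
    filter_upwards [self_mem_nhdsWithin] with t ht
    simp [show t ≠ 0 from ht]
  · refine ((hasDerivAt_id' t).mul (hasDerivAt_abs ht)).congr_deriv ?_
    rw [self_mul_sign]
    ring

lemma hasDerivAt_sq_mul_abs (t : ℝ) :
    HasDerivAt (fun t : ℝ => t ^ 2 * |t|) (3 * (t * |t|)) t :=
  (((hasDerivAt_id' t).mul (hasDerivAt_mul_abs t)).congr_deriv (by ring)).congr_of_eventuallyEq
    (.of_forall fun t => by simp only [Pi.mul_apply]; ring)

lemma not_differentiableAt_abs_sub (a : ℝ) : ¬DifferentiableAt ℝ (fun x : ℝ => |x - a|) a := by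
  rw [differentiableAt_comp_sub_const (f := fun t : ℝ => |t|), sub_self]
  exact not_differentiableAt_abs_zero

/-- The limit profile `w` (for `i = 0`) and its derivatives `w'`, `w''` (for `i = 1` and `i ≥ 2`),
written as functions of `x - 1/2` so that they need no case distinction. -/
noncomputable def limitDer (r : ℝ) : ℕ → ℝ → ℝ
  | 0, x => r * (1 - 12 * (x - 1 / 2) ^ 2 + 16 * ((x - 1 / 2) ^ 2 * |x - 1 / 2|))
  | 1, x => r * (-24 * (x - 1 / 2) + 48 * ((x - 1 / 2) * |x - 1 / 2|))
  | _, x => r * (-24 + 96 * |x - 1 / 2|)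

lemma hasDerivAt_limitDer (r x : ℝ) {i : ℕ} (hi : i < 2) :
    HasDerivAt (limitDer r i) (limitDer r (i + 1) x) x := by
  have hsub : HasDerivAt (fun x : ℝ => x - 1 / 2) 1 x := (hasDerivAt_id x).sub_const _
  have hlin := (hasDerivAt_mul_abs (x - 1 / 2)).comp x hsub
  have hsq := (hasDerivAt_sq_mul_abs (x - 1 / 2)).comp x hsub
  interval_cases i
  · refine (((((hsub.pow 2).const_mul 12).const_sub 1).add
      (hsq.const_mul 16)).const_mul r).congr_deriv ?_
    simp only [limitDer]
    push_cast
    ring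
  · refine (((hsub.const_mul (-24)).add (hlin.const_mul 48)).const_mul r).congr_deriv ?_
    simp only [limitDer]
    ring

lemma continuous_limitDer (r : ℝ) : ∀ i, Continuous (limitDer r i)
  | 0 => by unfold limitDer; fun_prop
  | 1 => by unfold limitDer; fun_prop
  | _ + 2 => by unfold limitDer; fun_prop

lemma limitDer_zero (r x : ℝ) : limitDer r 0 x = limitProfile r x := by
  rw [limitDer, limitProfile]
  split_ifs with h
  · rw [abs_of_nonpos (by linarith)]; ring
  · rw [abs_of_pos (by linarith)]; ring

/-- The limit profile `w` as an element of `C^2[0,1]`. -/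
noncomputable def limitFun (r : ℝ) : CkFun 2 :=
  ⟨fun j => ⟨fun x => limitDer r j x, (continuous_limitDer r j).comp continuous_subtype_val⟩,
    fun i x => hasDerivWithinAt_IccExtend (hasDerivAt_limitDer r x i.2).hasDerivWithinAt
      fun _ => rfl⟩

section LimitFun

variable {r : ℝ}

lemma limitFun_der_zero (r : ℝ) (x : unitInterval) :
    (limitFun r).der 0 x =
      r * (1 - 12 * ((x : ℝ) - 1 / 2) ^ 2 + 16 * (((x : ℝ) - 1 / 2) ^ 2 * |(x : ℝ) - 1 / 2|)) := rfl

lemma limitFun_der_two (r : ℝ) (x : unitInterval) :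
    (limitFun r).der 2 x = r * (-24 + 96 * |(x : ℝ) - 1 / 2|) := rfl

lemma limitFun_symm (r : ℝ) (x : unitInterval) :
    (limitFun r).der 0 (unitInterval.symm x) = (limitFun r).der 0 x := by
  rw [limitFun_der_zero, limitFun_der_zero, unitInterval.coe_symm_eq,
    show 1 - (x : ℝ) - 1 / 2 = -((x : ℝ) - 1 / 2) by ring, abs_neg, neg_sq]

lemma limitFun_midpt (r : ℝ) : (limitFun r).der 0 midpt = r := by
  simp [limitFun_der_zero, midpt]

lemma limitFun_le (hr : 0 ≤ r) (x : unitInterval) : (limitFun r).der 0 x ≤ r := by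
  have := mul_le_mul_of_nonneg_left (abs_sub_half_mem x).2 (sq_nonneg ((x : ℝ) - 1 / 2))
  exact mul_le_of_le_one_right hr (by linarith [sq_nonneg ((x : ℝ) - 1 / 2)])

lemma limitFun_left (r : ℝ) : (limitFun r).der 0 0 = 0 := by
  rw [limitFun_der_zero]
  norm_num [abs_of_nonneg]

lemma limitFun_left' (r : ℝ) : (limitFun r).der 1 0 = 0 := by
  change limitDer r 1 0 = 0
  norm_num [limitDer, abs_of_nonneg]

lemma lipschitzWith_limitFun_der_two (hr : 0 ≤ r) :
    LipschitzWith (Real.toNNReal (96 * r)) ((limitFun r).der 2) := by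
  refine LipschitzWith.of_dist_le_mul fun x y => ?_
  calc dist ((limitFun r).der 2 x) ((limitFun r).der 2 y)
      = 96 * r * |(|(x : ℝ) - 1 / 2| - |(y : ℝ) - 1 / 2|)| := by
        rw [limitFun_der_two, limitFun_der_two, Real.dist_eq, ← mul_sub, add_sub_add_left_eq_sub,
          ← mul_sub, abs_mul, abs_mul, abs_of_nonneg hr, abs_of_pos (by norm_num : (0 : ℝ) < 96)]
        ring
    _ ≤ 96 * r * |(x : ℝ) - 1 / 2 - ((y : ℝ) - 1 / 2)| := by
        exact mul_le_mul_of_nonneg_left (abs_abs_sub_abs_le_abs_sub _ _) (by positivity)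
    _ = Real.toNNReal (96 * r) * dist x y := by
        rw [Real.coe_toNNReal _ (by positivity), sub_sub_sub_cancel_right, Subtype.dist_eq,
          Real.dist_eq]

lemma holderNorm_limitFun_lt_top (hr : 0 ≤ r) {α : NNReal} (hα : α ≤ 1) :
    holderNorm α (limitFun r) < ⊤ :=
  have hlip : MemHolder 1 ((limitFun r).der 2) :=
    ⟨_, (lipschitzWith_limitFun_der_two hr).holderWith⟩
  ENNReal.add_lt_top.2 ⟨enorm_lt_top, (hlip.of_le hα).eHolderNorm_lt_top⟩

lemma limitFun_not_three (hr : r ≠ 0) : ¬∃ v : CkFun 3, v.der 0 = (limitFun r).der 0 := by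
  rintro ⟨v, hv⟩
  have hincl : CkFun.incl (by norm_num) v = limitFun r :=
    CkFun.ext_der_zero fun x => DFunLike.congr_fun hv x
  have hmem : Icc (0 : ℝ) 1 ∈ 𝓝 (1 / 2) := Icc_mem_nhds (by norm_num) (by norm_num)
  have heq : ∀ x ∈ Icc (0 : ℝ) 1, v.fn 2 x = r * (-24 + 96 * |x - 1 / 2|) := fun x hx => by
    rw [CkFun.fn_eq_der (by norm_num) hx, ← limitFun_der_two r ⟨x, hx⟩, ← hincl]
    rfl
  have hdiff : DifferentiableAt ℝ (v.fn 2) (1 / 2) :=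
    ((v.derivChain 2 (by norm_num) _ (mem_of_mem_nhds hmem)).hasDerivAt hmem).differentiableAt
  refine not_differentiableAt_abs_sub (1 / 2)
    ((((hdiff.div_const r).add_const 24).div_const 96).congr_of_eventuallyEq ?_)
  filter_upwards [hmem] with x hx
  rw [heq x hx, mul_div_cancel_left₀ _ hr]
  ring

lemma contDiffOn_limitProfile (n : WithTop ℕ∞) (r : ℝ) (s : Set ℝ) :
    ContDiffOn ℝ n (limitProfile r) (s \ {1 / 2}) := by
  intro x hx
  refine ContDiffAt.contDiffWithinAt ?_
  rcases lt_or_gt_of_ne (show x ≠ 1 / 2 from hx.2) with h | h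
  · refine ContDiffAt.congr_of_eventuallyEq
      (f := fun x => -16 * r * x ^ 3 + 12 * r * x ^ 2) (by fun_prop) ?_
    filter_upwards [Iio_mem_nhds h] with y hy
    exact if_pos (le_of_lt hy)
  · refine ContDiffAt.congr_of_eventuallyEq
      (f := fun x => -16 * r * (1 - x) ^ 3 + 12 * r * (1 - x) ^ 2) (by fun_prop) ?_
    filter_upwards [Ioi_mem_nhds h] with y hy
    exact if_neg (not_le_of_gt hy)

end LimitFun

section HolderNorm

lemma CkFun.abs_der_le_of_succ {k : ℕ} (u : CkFun k) (i : Fin k) (h₀ : u.der i.castSucc 0 = 0)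
    {ε : ℝ} (h : ∀ x, |u.der i.succ x| ≤ ε) (x : unitInterval) : |u.der i.castSucc x| ≤ ε := by
  lift ε to NNReal using (abs_nonneg _).trans (h 0)
  have hlip := (u.lipschitzWith_der i h).dist_le_mul x 0
  rw [h₀, dist_zero_right, Subtype.dist_eq, Real.dist_eq, Icc.coe_zero, sub_zero,
    abs_of_nonneg x.2.1] at hlip
  exact hlip.trans (mul_le_of_le_one_right ε.2 x.2.2)

variable {e : CkFun 2}

lemma CkFun.norm_le_of_der_two (h₀ : e.der 0 0 = 0) (h₁ : e.der 1 0 = 0) {ε : ℝ}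
    (h : ∀ x, |e.der 2 x| ≤ ε) : ‖e‖ ≤ ε := by
  have hε : 0 ≤ ε := (abs_nonneg _).trans (h 0)
  have hder : ∀ x, |e.der 1 x| ≤ ε := e.abs_der_le_of_succ 1 h₁ h
  refine (pi_norm_le_iff_of_nonneg hε).2 fun j => (ContinuousMap.norm_le _ hε).2 fun x => ?_
  fin_cases j
  exacts [e.abs_der_le_of_succ 0 h₀ hder x, hder x, h x]

lemma holderNorm_le (h₀ : e.der 0 0 = 0) (h₁ : e.der 1 0 = 0) {ε K α : NNReal}
    (h : ∀ x, |e.der 2 x| ≤ ε) (hK : LipschitzWith K (e.der 2)) (hα : α ≤ 1) :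
    holderNorm α e ≤ ((ε + (2 * ε) ^ (1 - α : ℝ) * K ^ (α : ℝ) : NNReal) : ENNReal) := by
  have hosc : HolderWith (2 * ε) 0 (e.der 2) := fun x y => by
    rw [NNReal.coe_zero, ENNReal.rpow_zero, mul_one, edist_nndist, ENNReal.coe_le_coe,
      ← NNReal.coe_le_coe, coe_nndist, Real.dist_eq]
    push_cast
    linarith [abs_sub (e.der 2 x) (e.der 2 y), h x, h y]
  have hhol := hosc.interpolate hK.holderWith (t₁ := 1 - α) (t₂ := α) (tsub_add_cancel_of_le hα)
  rw [zero_mul, one_mul, zero_add, NNReal.coe_sub hα, NNReal.coe_one] at hhol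
  rw [ENNReal.coe_add]
  exact add_le_add (enorm_le_coe.2 (CkFun.norm_le_of_der_two h₀ h₁ h)) hhol.eHolderNorm_le

lemma tendsto_interpolation_zero {α : NNReal} (hα : α < 1) (K : NNReal) :
    Tendsto (fun ε : NNReal => ((ε + (2 * ε) ^ (1 - α : ℝ) * K ^ (α : ℝ) : NNReal) : ENNReal))
      (𝓝 0) (𝓝 0) := by
  have hα' : (0 : ℝ) < 1 - α := sub_pos.2 (NNReal.coe_lt_one.2 hα)
  have hcont : Continuous fun ε : NNReal => ε + (2 * ε) ^ (1 - α : ℝ) * K ^ (α : ℝ) :=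
    continuous_id.add (((NNReal.continuous_rpow_const hα'.le).comp
      (continuous_const.mul continuous_id)).mul continuous_const)
  exact ENNReal.tendsto_coe.2 (hcont.tendsto' 0 0 (by simp [NNReal.zero_rpow hα'.ne']))

lemma tendsto_holderNorm_zero {ι : Type*} {l : Filter ι} {e : ι → CkFun 2} {K α : NNReal}
    (hα : α < 1) (h₀ : ∀ᶠ i in l, (e i).der 0 0 = 0) (h₁ : ∀ᶠ i in l, (e i).der 1 0 = 0)
    (hK : ∀ᶠ i in l, LipschitzWith K ((e i).der 2))
    (h : ∀ ε : NNReal, 0 < ε → ∀ᶠ i in l, ∀ x, |(e i).der 2 x| ≤ ε) :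
    Tendsto (fun i => holderNorm α (e i)) l (𝓝 0) := by
  refine ENNReal.tendsto_nhds_zero.2 fun δ hδ => ?_
  have hsmall := ENNReal.tendsto_nhds_zero.1
    ((tendsto_interpolation_zero hα K).mono_left (nhdsWithin_le_nhds (s := Ioi 0))) δ hδ
  obtain ⟨ε, hεδ, hε⟩ := (hsmall.and self_mem_nhdsWithin).exists
  filter_upwards [h₀, h₁, hK, h ε hε] with i hi₀ hi₁ hiK hi
  exact (holderNorm_le hi₀ hi₁ hi hiK hα.le).trans hεδ

end HolderNorm

lemma IsPositiveSolution.lipschitzWith_der_two {f f' : ℝ → ℝ} {r lam : ℝ} {u : CkFun 4}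
    {M : NNReal} (hs : IsConvexSource r f f') (hl : 0 < lam) (h : IsPositiveSolution f r lam u)
    (hM : u.half 3 (1 / 2) ≤ M) : LipschitzWith M (u.der 2) := by
  have hprofile := h.isProfile hs hl
  have hpos := (hs.const_mul hl).pos_of_mem_Icc (h.midpt_mem hs hl).2
  refine u.lipschitzWith_der 2 fun x => ?_
  have hx := abs_sub_half_mem x
  calc |u.der 3 x| = |u.half 3 (|(x : ℝ) - 1 / 2|)| :=
        CkFun.abs_der_eq_abs_half (h.reflect_eq hs hl) 3 x
    _ = u.half 3 |(x : ℝ) - 1 / 2| :=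
        abs_of_nonneg (hprofile.third_deriv_nonneg hpos (h.half_three hs hl) hx)
    _ ≤ u.half 3 (1 / 2) :=
        hprofile.monotoneOn_third_deriv hpos hx (right_mem_Icc.2 hprofile.T_pos.le) hx.2
    _ ≤ M := hM

/-- A positive lower bound for `(r - u) f(u)` near `r` extends to all of `[0, r)`, because `f` is
increasing. -/
lemma IsConvexSource.exists_le_sub_mul {f f' : ℝ → ℝ} {r : ℝ} (hs : IsConvexSource r f f')
    (hr : 0 < r) (hsing : 0 < liminf (fun u : ℝ => (((r - u) * f u : ℝ) : EReal)) (𝓝[<] r)) :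
    ∃ c > 0, ∀ x ∈ Ico 0 r, c ≤ (r - x) * f x := by
  obtain ⟨c, hc0, hc⟩ := EReal.lt_iff_exists_real_btwn.1 hsing
  obtain ⟨a, ha, hnear⟩ := (mem_nhdsLT_iff_exists_mem_Ico_Ioo_subset hr).1
    (eventually_lt_of_lt_liminf hc)
  have h0 : (0 : ℝ) ∈ Ico 0 r := left_mem_Ico.2 hr
  have hf0 := hs.pos 0 h0
  refine ⟨min c ((r - a) * f 0), lt_min (EReal.coe_pos.1 hc0) (mul_pos (sub_pos.2 ha.2) hf0),
    fun x hx => ?_⟩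
  rcases lt_or_ge a x with h | h
  · exact (min_le_left _ _).trans (EReal.coe_lt_coe_iff.1 (hnear ⟨h, hx.2⟩)).le
  · refine (min_le_right _ _).trans (mul_le_mul (by linarith) ?_ hf0.le (sub_nonneg.2 hx.2.le))
    exact hs.strictMonoOn.monotoneOn h0 hx hx.1

section Limit

variable {f f' : ℝ → ℝ} {r p : ℝ} (hs : IsConvexSource r f f') (hf : ContDiffOn ℝ 2 f (Ico 0 r))

include hs hf

lemma isProfile_solutionCurve (hp : p ∈ Ioo 0 r) :
    IsProfile (fun x => (solutionCurve f r p).1 * f x) p (1 / 2) (solutionCurve f r p).2.half := by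
  have hmem := solutionCurve_mem hs hf hp
  simpa only [solutionCurve_midpt hs hf ⟨hp.1.le, hp.2⟩] using hmem.2.isProfile hs hmem.1

lemma half_three_solutionCurve (hp : p ∈ Ioo 0 r) : (solutionCurve f r p).2.half 3 0 = 0 :=
  (solutionCurve_mem hs hf hp).2.half_three hs (solutionCurve_mem hs hf hp).1

lemma exists_third_deriv_solutionCurve_bound (hr : 0 < r) :
    ∃ M : NNReal, 0 < M ∧ ∀ p ∈ Ioo 0 r, (solutionCurve f r p).2.half 3 (1 / 2) ≤ M := by
  obtain ⟨M, hM0, hM⟩ := IsProfile.exists_third_deriv_bound hs hr one_half_pos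
  lift M to NNReal using hM0.le
  exact ⟨M, hM0, fun p hp => hM p _ _ (solutionCurve_mem hs hf hp).1 hp.2
    (isProfile_solutionCurve hs hf hp) (half_three_solutionCurve hs hf hp)⟩

variable (hr : 0 < r)
  (hsing : 0 < liminf (fun u : ℝ => (((r - u) * f u : ℝ) : EReal)) (𝓝[<] r))

include hr hsing

lemma tendsto_solutionCurve_fst :
    Tendsto (fun p => (solutionCurve f r p).1) (𝓝[<] r) (𝓝 0) := by
  obtain ⟨c, hc0, hc⟩ := hs.exists_le_sub_mul hr hsing
  obtain ⟨M, -, hM⟩ := exists_third_deriv_solutionCurve_bound hs hf hr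
  have hlim : Tendsto (fun p => M * (1 + M * (1 / 2)) * √(r - p) / c) (𝓝[<] r) (𝓝 0) :=
    tendsto_nhdsWithin_of_tendsto_nhds (Continuous.tendsto' (by fun_prop) _ _ (by simp))
  refine squeeze_zero' ?_ ?_ hlim
  · filter_upwards [Ioo_mem_nhdsLT hr] with p hp
    exact (solutionCurve_mem hs hf hp).1.le
  · filter_upwards [Ioo_mem_nhdsLT hr, Ioo_mem_nhdsLT (show r - 1 / 4 < r by linarith)]
      with p hp hp4
    have hl := (solutionCurve_mem hs hf hp).1
    rw [le_div_iff₀ hc0]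
    refine (isProfile_solutionCurve hs hf hp).le_mul_sqrt_of_le_sub_mul
      ((hs.const_mul hl).pos_of_mem_Icc hp.2) (half_three_solutionCurve hs hf hp) (hM p hp) hp.2
      (by linarith [hp4.1]) fun x hx => ?_
    rw [mul_left_comm]
    exact mul_le_mul_of_nonneg_left (hc x ⟨hx.1, hx.2.trans_lt hp.2⟩) hl.le

lemma eventually_abs_der_two_sub_le {ε : ℝ} (hε : 0 < ε) :
    ∀ᶠ p in 𝓝[<] r, ∀ x, |(solutionCurve f r p).2.der 2 x - (limitFun r).der 2 x| ≤ ε := by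
  obtain ⟨M, hM0, hM⟩ := exists_third_deriv_solutionCurve_bound hs hf hr
  obtain ⟨η, hη0, hη⟩ : ∃ η : ℝ, 0 < η ∧ η < min (1 / 2 / 2) (ε / (10 * M)) :=
    exists_between (lt_min (by norm_num) (by positivity))
  obtain ⟨hη4, hηε⟩ := lt_min_iff.1 hη
  rw [lt_div_iff₀ (by positivity)] at hηε
  set Q := f (r * (1 - η ^ 2 / (2 * (1 / 2) ^ 2)))
  have hlim : Tendsto (fun p => 5 * ((solutionCurve f r p).1 * Q * (1 / 2) * (1 / 2)) +
      6 / (1 / 2) ^ 2 * (r - p)) (𝓝[<] r) (𝓝 0) := by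
    have hgap : Tendsto (fun p => r - p) (𝓝[<] r) (𝓝 0) :=
      tendsto_nhdsWithin_of_tendsto_nhds (Continuous.tendsto' (by fun_prop) _ _ (sub_self r))
    have hparam := (((tendsto_solutionCurve_fst hs hf hr hsing).mul_const Q).mul_const
      (1 / 2)).mul_const (1 / 2)
    simpa only [zero_mul, mul_zero, add_zero] using
      (hparam.const_mul 5).add (hgap.const_mul (6 / (1 / 2) ^ 2))
  filter_upwards [Ioo_mem_nhdsLT hr, hlim.eventually_lt_const (half_pos hε)] with p hp hsmall x
  obtain ⟨hl, hsol⟩ := solutionCurve_mem hs hf hp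
  have hdist := (isProfile_solutionCurve hs hf hp).abs_second_deriv_sub_le (hs.const_mul hl) hp.2
    (half_three_solutionCurve hs hf hp) (hM p hp) hη0 hη4.le (abs_sub_half_mem x)
  rw [CkFun.der_eq_half_abs_of_even (hsol.reflect_eq hs hl) (j := 2) (by decide), limitFun_der_two,
    show -24 + 96 * |(x : ℝ) - 1 / 2| =
      6 / (1 / 2) ^ 2 + 12 / (1 / 2) ^ 3 * (|(x : ℝ) - 1 / 2| - 1 / 2) by ring]
  refine hdist.trans (?_ : 5 * (M * η + (solutionCurve f r p).1 * Q * (1 / 2) * (1 / 2)) +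
    6 / (1 / 2) ^ 2 * (r - p) ≤ ε)
  linarith

lemma tendsto_holderNorm_solutionCurve {α : NNReal} (hα : α < 1) :
    Tendsto (fun p => holderNorm α (CkFun.incl (by norm_num) (solutionCurve f r p).2 - limitFun r))
      (𝓝[<] r) (𝓝 0) := by
  obtain ⟨M, -, hM⟩ := exists_third_deriv_solutionCurve_bound hs hf hr
  have hIoo := Ioo_mem_nhdsLT hr
  refine tendsto_holderNorm_zero (K := M + Real.toNNReal (96 * r)) hα ?_ ?_ ?_ fun ε hε =>
    eventually_abs_der_two_sub_le hs hf hr hsing (NNReal.coe_pos.2 hε)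
  · filter_upwards [hIoo] with p hp
    exact sub_eq_zero.2 ((solutionCurve_mem hs hf hp).2.left.trans (limitFun_left r).symm)
  · filter_upwards [hIoo] with p hp
    exact sub_eq_zero.2 ((solutionCurve_mem hs hf hp).2.left'.trans (limitFun_left' r).symm)
  · filter_upwards [hIoo] with p hp
    obtain ⟨hl, hsol⟩ := solutionCurve_mem hs hf hp
    exact (hsol.lipschitzWith_der_two hs hl (hM p hp)).sub (lipschitzWith_limitFun_der_two hr.le)

end Limit

section Multiplicity

variable {f f' : ℝ → ℝ} {r lam : ℝ} (hs : IsConvexSource r f f') (hf : ContDiffOn ℝ 2 f (Ico 0 r))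

include hs hf

lemma atMostTwiceOn_solutionCurve :
    AtMostTwiceOn (fun p => (solutionCurve f r p).1) (Ioo 0 r) := by
  intro a b c ha hb hc hab hbc h₁₂ h₂₃
  have hmid (p : ℝ) (hp : p ∈ Ioo 0 r) : (solutionCurve f r p).2.der 0 midpt = p :=
    solutionCurve_midpt hs hf ⟨hp.1.le, hp.2⟩
  obtain ⟨hl, hsa⟩ := solutionCurve_mem hs hf ha
  have hsb := (solutionCurve_mem hs hf hb).2
  have hsc := (solutionCurve_mem hs hf hc).2
  beta_reduce at h₁₂ h₂₃
  rw [← h₁₂] at hsb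
  rw [← h₂₃, ← h₁₂] at hsc
  exact hsa.not_three hs hl hsb hsc (by rwa [hmid a ha, hmid b hb]) (by rwa [hmid b hb, hmid c hc])

lemma setOf_isPositiveSolution_eq (hl : 0 < lam) :
    {u | IsPositiveSolution f r lam u} =
      (fun p => (solutionCurve f r p).2) '' {p ∈ Ioo 0 r | (solutionCurve f r p).1 = lam} := by
  ext u
  constructor
  · intro (h : IsPositiveSolution f r lam u)
    have heq := solutionCurve_of_mem hs (q := (lam, u)) ⟨hl, h⟩
    exact ⟨u.der 0 midpt, ⟨h.midpt_mem hs hl, congrArg Prod.fst heq⟩, congrArg Prod.snd heq⟩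
  · rintro ⟨p, ⟨hp, rfl⟩, rfl⟩
    exact (solutionCurve_mem hs hf hp).2

lemma encard_setOf_isPositiveSolution (hl : 0 < lam) :
    {u | IsPositiveSolution f r lam u}.encard =
      {p ∈ Ioo 0 r | (solutionCurve f r p).1 = lam}.encard := by
  rw [setOf_isPositiveSolution_eq hs hf hl]
  refine InjOn.encard_image fun a ha b hb hab => ?_
  rw [← solutionCurve_midpt hs hf ⟨ha.1.1.le, ha.1.2⟩,
    ← solutionCurve_midpt hs hf ⟨hb.1.1.le, hb.1.2⟩]
  exact congrArg (fun u : CkFun 4 => u.der 0 midpt) hab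

end Multiplicity

theorem theorem1p2 (r : ℝ) (hr : 0 < r) (f : ℝ → ℝ)
    (hf : ContDiffOn ℝ 2 f (Set.Ico 0 r))
    (hpos : ∀ u ∈ Set.Ico 0 r, 0 < f u)
    (hinc : ∀ u ∈ Set.Ioo 0 r, 0 < deriv f u)
    (hconv : ∀ u ∈ Set.Ioo 0 r, 0 < deriv (deriv f) u)
    (hsing : 0 < Filter.liminf (fun u : ℝ => (((r - u) * f u : ℝ) : EReal))
      (nhdsWithin r (Set.Iio r))) :
    -- the solution curve `Γ`, with the maximum value `p = u(1/2)` as its parameter,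
    -- its turning point `Γ p₀ = (lam₀, u₀)`, and its end point `w`
    ∃ (Γ : ℝ → ℝ × CkFun 4) (p₀ lam₀ : ℝ) (w : CkFun 2),
      -- all positive solutions lie on one smooth curve, which starts at `(0,0)`
      ContDiffOn ℝ 2 Γ (Set.Ico 0 r) ∧
      Γ 0 = 0 ∧
      solutionSet f r = Γ '' Set.Ioo 0 r ∧
      -- `u(1/2)` is strictly monotone along the curve
      (∀ p ∈ Set.Ico 0 r, (Γ p).2.der 0 midpt = p) ∧
      -- the curve turns exactly once, at `lam₀`
      p₀ ∈ Set.Ioo 0 r ∧ (Γ p₀).1 = lam₀ ∧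
      StrictMonoOn (fun p => (Γ p).1) (Set.Icc 0 p₀) ∧
      StrictAntiOn (fun p => (Γ p).1) (Set.Ico p₀ r) ∧
      -- exact multiplicity
      (∀ lam : ℝ, 0 < lam → lam < lam₀ → {u | IsPositiveSolution f r lam u}.encard = 2) ∧
      {u | IsPositiveSolution f r lam₀ u}.encard = 1 ∧
      (∀ lam : ℝ, lam₀ < lam → {u | IsPositiveSolution f r lam u} = ∅) ∧
      -- symmetry, and `u(1/2)` is the maximum value
      (∀ q ∈ solutionSet f r, ∀ x : unitInterval,
        q.2.der 0 (unitInterval.symm x) = q.2.der 0 x ∧ q.2.der 0 x ≤ q.2.der 0 midpt) ∧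
      -- the end of the upper branch: `lam` tends to `0` and `u` to `w` in every `C^{2+α}[0,1]`
      Filter.Tendsto (fun p => (Γ p).1) (nhdsWithin r (Set.Iio r)) (nhds 0) ∧
      (∀ α : NNReal, 0 < α → α < 1 →
        Filter.Tendsto (fun p => holderNorm α (CkFun.incl (by norm_num) (Γ p).2 - w))
          (nhdsWithin r (Set.Iio r)) (nhds 0)) ∧
      -- the function `w`
      (∀ x : unitInterval, w.der 0 x = limitProfile r x) ∧
      (∀ x : unitInterval, w.der 0 (unitInterval.symm x) = w.der 0 x) ∧
      w.der 0 midpt = r ∧ (∀ x : unitInterval, w.der 0 x ≤ r) ∧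
      (∀ α : NNReal, 0 < α → α < 1 → holderNorm α w < ⊤) ∧
      (¬ ∃ v : CkFun 3, v.der 0 = w.der 0) ∧
      ContDiffOn ℝ 4 (limitProfile r) (Set.Icc 0 1 \ {1 / 2}) := by
  have hs := isConvexSource_of_contDiffOn hf hpos hinc hconv
  have hsmooth := contDiffOn_solutionCurve hs hf
  have hcont : ContinuousOn (fun p => (solutionCurve f r p).1) (Ico 0 r) :=
    continuous_fst.comp_continuousOn hsmooth.continuousOn
  have hzero : (solutionCurve f r 0).1 = 0 := congrArg Prod.fst (solutionCurve_zero hs)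
  have hlam : ∀ p ∈ Ioo 0 r, 0 < (solutionCurve f r p).1 := fun p hp =>
    (solutionCurve_mem hs hf hp).1
  have hlim := tendsto_solutionCurve_fst hs hf hr hsing
  obtain ⟨p₀, hp₀, hmono, hanti⟩ :=
    (atMostTwiceOn_solutionCurve hs hf).exists_unimodal hr hcont hzero hlam hlim
  refine ⟨solutionCurve f r, p₀, (solutionCurve f r p₀).1, limitFun r, hsmooth,
    solutionCurve_zero hs, solutionSet_eq_image hs hf, fun p hp => solutionCurve_midpt hs hf hp,
    hp₀, rfl, hmono, hanti, fun lam hl hlt => ?_, ?_, fun lam hlt => ?_,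
    fun q hq x => ⟨CkFun.der_zero_symm (hq.2.reflect_eq hs hq.1) x, hq.2.le_midpt hs hq.1 x⟩, hlim,
    fun α _ hα => tendsto_holderNorm_solutionCurve hs hf hr hsing hα,
    fun x => limitDer_zero r x, limitFun_symm r, limitFun_midpt r, limitFun_le hr.le,
    fun α _ hα => holderNorm_limitFun_lt_top hr.le hα.le, limitFun_not_three hr.ne',
    contDiffOn_limitProfile 4 r _⟩
  · rw [encard_setOf_isPositiveSolution hs hf hl]
    exact encard_level_of_unimodal hp₀ hcont hmono hanti hlt (hzero.trans_lt hl)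
      (hlim.eventually_lt_const hl).frequently
  · rw [encard_setOf_isPositiveSolution hs hf (hlam p₀ hp₀),
      level_eq_singleton_of_unimodal hp₀ hmono hanti, encard_singleton]
  · rw [setOf_isPositiveSolution_eq hs hf ((hlam p₀ hp₀).trans hlt),
      level_eq_empty_of_unimodal hp₀ hmono hanti hlt, image_empty]
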